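/- Let $d\ge 1$ and let $\Omega\subset\mathbb R^d$ be a non-empty bounded open set that is so regular that every weak solution $u\in H^1_0(\Omega)$ of $-\Delta u=f$ with $f\in L^2(\Omega)$ belongs to $H^2(\Omega)$ (e.g. $\Omega$ convex or with $C^{1,1}$ boundary). All spaces are real. Let $U=H^1_0(\Omega)\cap H^2(\Omega)$ and $\mathcal A=-\Delta:U\to L^2=L^2(\Omega)$, let $U$ carry the inner product $\langle u,v\rangle_U=\langle\mathcal Au,\mathcal Av\rangle_{L^2}$, and let $$\mathcal G:U\times L^2\to L^2\times L^2,\qquad \mathcal G(u,\theta)=(\mathcal Au-\theta,\;u),$$ with the Hilbert product norms. For linear operators $B:U\to U$ and $D:L^2\to L^2$ put $T=\mathrm{diag}(B,D)$ (in the role of $\psi(C_0)$) and consider the link bounds $$\text{(ub)}\quad \exists\,\overline m>0\ \forall x:\ \|\mathcal Gx\|\le\overline m\|Tx\|,\qquad \text{(lb)}\quad\exists\,\underline m>0\ \forall x:\ \underline m\|Tx\|\le\|\mathcal Gx\| .$$ 1. (ub) holds if and only if there are constants with $\|u\|_U\le c\|Bu\|_U$ for all $u\in U$ and $\|\theta\|_{L^2}\le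 c'\|D\theta\|_{L^2}$ for all $\theta\in L^2$. If $B$ and $D$ are self-adjoint (on $U$ and on $L^2$, respectively), as the blocks of every $\psi(C_0)$ are, then (ub) holds if and only if $B:U\to U$ and $D:L^2\to L^2$ are bijective with bounded inverses. 2. (lb) implies that $B$ extends to a bounded operator $L^2\to U$ and that $D$ has an adjoint $D^*$ that is a bounded operator $L^2\to U$. Conversely, these two conditions together with boundedness of $D:L^2\to L^2$ imply (lb). 3. The conditions are contradictory: no $B$ satisfies both $\|u\|_U\le c\|Bu\|_U$ for all $u\in U$, for some constant $c$, and boundedness $L^2\to U$ (in particular, no $B$ that is bijective with bounded inverse on $U$ is bounded $L^2\to U$). No block diagonal operator $T$ satisfies both (lb) and (ub). 4. One-sided contraction bound. An index function is a continuous non-decreasing function on $[0,\infty)$ that vanishes at $0$ and is positive on $(0,\infty)$. Let $C_0$ be a bounded positive self-adjoint operator on $U\times L^2$ and $\psi$ an index function; put $\Theta(t)=\sqrt t\,\psi(t)$, let $f_0^2$ be the inverse function of $\Theta^2$ on $[0,\infty)$, and assume that $f_0^2$ is operator concave (for positive operators on $U\times L^2$). Let $0<\underline m\le 1$ with $\underline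 m\|\psi(C_0)x\|\le\|\mathcal Gx\|$ for all $x\in U\times L^2$. Put $H=C_0^{1/2}\mathcal G^*\mathcal GC_0^{1/2}$, $s_\alpha(t)=\alpha/(\alpha+t)$ and $\varphi_0(t)=\sqrt t$. For $\alpha,\delta>0$, data $y^\delta=\mathcal Gx^*+\delta\eta$ with Gaussian white noise $\eta$, and prior $N(0,\frac{\delta^2}{\alpha}C_0)$, let the posterior be the Gaussian measure on $U\times L^2$ with mean $C_0^{1/2}(\alpha I+H)^{-1}C_0^{1/2}\mathcal G^*y^\delta$ and covariance $\delta^2C_0^{1/2}(\alpha I+H)^{-1}C_0^{1/2}$ (whenever these objects exist), and let $\mathrm{SPC}(\alpha,\delta)=\mathbb E^{x^*}\,\mathbb E_{\mathrm{post}}\|x^*-x\|^2$. Then, for every index function $\varphi$ and every $x^*=\varphi(C_0)v$ with $\|v\|\le1$, $$\mathrm{SPC}(\alpha,\delta)\le\frac1{\underline m^2}\Bigl(\bigl\|s_\alpha(H)f_0(H)\varphi_0(C_0)^{-1}\varphi(C_0)\bigr\|^2+2\delta^2\,\mathrm{tr}\bigl[(\alpha I+H)^{-1}f_0^2(H)\bigr]\Bigr),$$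 an inequality in $[0,\infty]$, in which the operator norm is taken over the natural domain, i.e. over all $v$ for which $\varphi(C_0)v$ lies in the range of $C_0^{1/2}$. 5. Example. Let $s,p\ge1$. Then $T=\mathrm{diag}(\mathcal A^{-s},\mathcal A^{-p})$ satisfies (lb) with some constant $\underline m\in(0,1]$. There are a bounded positive self-adjoint $C_0$ and an index function $\psi$ with operator concave $f_0^2$ such that $\psi(C_0)=T$; and for all such $C_0$ and $\psi$ the bound of part 4 holds with this $\underline m$. -/

import Mathlib

open MeasureTheory Set
open scoped RealInnerProductSpace ContDiff ENNReal NNReal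

universe w

namespace BlockPrior

noncomputable section

/-- `ℝ^d` with the Euclidean norm. -/
abbrev Space (d : ℕ) : Type := EuclideanSpace ℝ (Fin d)

/-- The real Hilbert space `L²(Ω)`. -/
abbrev L2 {d : ℕ} (Ω : Set (Space d)) : Type := Lp ℝ 2 (volume.restrict Ω)

/-- `C_c^∞(Ω)`. -/
def testFunctions {d : ℕ} (Ω : Set (Space d)) : Submodule ℝ (Space d → ℝ) where
  carrier := {φ | ContDiff ℝ ∞ φ ∧ HasCompactSupport φ ∧ tsupport φ ⊆ Ω}
  zero_mem' := by
    refine ⟨contDiff_const, HasCompactSupport.zero, ?_⟩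
    simp [tsupport]
  add_mem' := by
    rintro f g ⟨hf, hf', hf''⟩ ⟨hg, hg', hg''⟩
    exact ⟨hf.add hg, hf'.add hg', (tsupport_add f g).trans (union_subset hf'' hg'')⟩
  smul_mem' := by
    rintro c f ⟨hf, hf', hf''⟩
    exact ⟨contDiff_const.smul hf, hf'.smul_left (f := fun _ => c),
      (tsupport_smul_subset_right (fun _ => c) f).trans hf''⟩

/-- The classical partial derivative `∂_i`. -/
def partialTest {d : ℕ} (Ω : Set (Space d)) (i : Fin d) :
    testFunctions Ω →ₗ[ℝ] testFunctions Ω where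
  toFun φ := ⟨fun x => fderiv ℝ (φ : Space d → ℝ) x (EuclideanSpace.single i 1), by
    obtain ⟨φ, h, h', h''⟩ := φ
    exact ⟨(h.fderiv_right (m := ∞) (by simp)).clm_apply contDiff_const, h'.fderiv_apply (𝕜 := ℝ) _,
      (tsupport_fderiv_apply_subset ℝ _).trans h''⟩⟩
  map_add' φ ψ := by
    ext x
    simp only [Submodule.coe_add, Pi.add_apply]
    rw [fderiv_add (φ.2.1.differentiable (by simp) x) (ψ.2.1.differentiable (by simp) x)]
    simp
  map_smul' c φ := by
    ext x
    simp only [Submodule.coe_smul, Pi.smul_apply, RingHom.id_apply]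
    rw [fderiv_const_smul (φ.2.1.differentiable (by simp) x)]
    simp

theorem memLp_testFunction {d : ℕ} {Ω : Set (Space d)} (φ : testFunctions Ω) :
    MemLp (φ : Space d → ℝ) 2 (volume.restrict Ω) :=
  φ.2.1.continuous.memLp_of_hasCompactSupport φ.2.2.1

/-- The inclusion `C_c^∞(Ω) → L²(Ω)`. -/
def testToL2 {d : ℕ} (Ω : Set (Space d)) : testFunctions Ω →ₗ[ℝ] L2 Ω where
  toFun φ := (memLp_testFunction φ).toLp _
  map_add' _ _ := rfl
  map_smul' _ _ := rfl

theorem coeFn_testToL2 {d : ℕ} {Ω : Set (Space d)} (φ : testFunctions Ω) :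
    (testToL2 Ω φ : Space d → ℝ) =ᵐ[volume.restrict Ω] φ :=
  (memLp_testFunction φ).coeFn_toLp

/-- `g = ∂_i f` in the weak sense: `∫_Ω f ∂_i φ = - ∫_Ω g φ` for all `φ ∈ C_c^∞(Ω)`. -/
def HasWeakPartial {d : ℕ} (Ω : Set (Space d)) (i : Fin d) (f g : L2 Ω) : Prop :=
  ∀ φ : testFunctions Ω, ⟪f, testToL2 Ω (partialTest Ω i φ)⟫ = - ⟪g, testToL2 Ω φ⟫

theorem HasWeakPartial.add {d : ℕ} {Ω : Set (Space d)} {i : Fin d} {f f' g g' : L2 Ω}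
    (h : HasWeakPartial Ω i f g) (h' : HasWeakPartial Ω i f' g') :
    HasWeakPartial Ω i (f + f') (g + g') := fun φ => by
  rw [inner_add_left, inner_add_left, h φ, h' φ]; ring

theorem HasWeakPartial.smul {d : ℕ} {Ω : Set (Space d)} {i : Fin d} {f g : L2 Ω} (c : ℝ)
    (h : HasWeakPartial Ω i f g) : HasWeakPartial Ω i (c • f) (c • g) := fun φ => by
  rw [real_inner_smul_left, real_inner_smul_left, h φ]; ring

theorem inner_testToL2 {d : ℕ} {Ω : Set (Space d)} (f : L2 Ω) (φ : testFunctions Ω) :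
    ⟪f, testToL2 Ω φ⟫ = ∫ x in Ω, f x * (φ : Space d → ℝ) x := by
  rw [L2.inner_def]
  apply integral_congr_ae
  filter_upwards [coeFn_testToL2 φ] with x hx
  simp [hx, mul_comm]

theorem integral_testFunction {d : ℕ} {Ω : Set (Space d)} (φ : testFunctions Ω) (f : Space d → ℝ) :
    ∫ x in Ω, f x * (φ : Space d → ℝ) x = ∫ x, f x * (φ : Space d → ℝ) x := by
  apply setIntegral_eq_integral_of_forall_compl_eq_zero
  intro x hx
  have : (φ : Space d → ℝ) x = 0 := image_eq_zero_of_notMem_tsupport fun h => hx (φ.2.2.2 h)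
  simp [this]

theorem eq_zero_of_inner_test {d : ℕ} {Ω : Set (Space d)} (hΩ : IsOpen Ω) (f : L2 Ω)
    (h : ∀ φ : testFunctions Ω, ⟪f, testToL2 Ω φ⟫ = 0) : f = 0 := by
  have hloc : LocallyIntegrableOn (f : Space d → ℝ) Ω volume := by
    have h1 : LocallyIntegrable (f : Space d → ℝ) (volume.restrict Ω) :=
      (Lp.memLp f).locallyIntegrable (by norm_num)
    exact locallyIntegrableOn_of_locallyIntegrable_restrict h1
  have := hΩ.ae_eq_zero_of_integral_contDiff_smul_eq_zero hloc (fun g hg hg' hg'' => by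
    have := h ⟨g, hg, hg', hg''⟩
    rw [inner_testToL2, integral_testFunction] at this
    simpa [mul_comm] using this)
  rw [Lp.eq_zero_iff_ae_eq_zero]
  exact (ae_restrict_iff' hΩ.measurableSet).2 this

theorem inner_test_test {d : ℕ} {Ω : Set (Space d)} (φ ψ : testFunctions Ω) :
    ⟪testToL2 Ω φ, testToL2 Ω ψ⟫ = ∫ x, (φ : Space d → ℝ) x * (ψ : Space d → ℝ) x := by
  rw [inner_testToL2, ← integral_testFunction]
  apply integral_congr_ae
  filter_upwards [coeFn_testToL2 φ] with x hx
  rw [hx]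

theorem integrable_test_mul {d : ℕ} {Ω : Set (Space d)} (φ : testFunctions Ω) (f : Space d → ℝ)
    (hf : Continuous f) : Integrable (fun x => (φ : Space d → ℝ) x * f x) :=
  (φ.2.1.continuous.mul hf).integrable_of_hasCompactSupport φ.2.2.1.mul_right

theorem hasWeakPartial_test {d : ℕ} {Ω : Set (Space d)} (i : Fin d) (φ : testFunctions Ω) :
    HasWeakPartial Ω i (testToL2 Ω φ) (testToL2 Ω (partialTest Ω i φ)) := by
  intro ψ
  rw [inner_test_test, inner_test_test]
  exact integral_mul_fderiv_eq_neg_fderiv_mul_of_integrable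
    (integrable_test_mul (partialTest Ω i φ) _ ψ.2.1.continuous)
    (integrable_test_mul φ _ (partialTest Ω i ψ).2.1.continuous)
    (integrable_test_mul φ _ ψ.2.1.continuous)
    (fun x _ => φ.2.1.differentiable (by simp) x) (fun x _ => ψ.2.1.differentiable (by simp) x)

theorem poincare_test {d : ℕ} {Ω : Set (Space d)} (i : Fin d) {R : ℝ}
    (hR : ∀ x ∈ Ω, ‖x‖ ≤ R) (φ : testFunctions Ω) :
    ‖testToL2 Ω φ‖ ^ 2 ≤ 4 * R ^ 2 * ‖testToL2 Ω (partialTest Ω i φ)‖ ^ 2 := by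
  rw [← real_inner_self_eq_norm_sq, ← real_inner_self_eq_norm_sq, inner_test_test, inner_test_test]
  set v : Space d := EuclideanSpace.single i 1
  set f : Space d → ℝ := (φ : Space d → ℝ) with hf
  set f' : Space d → ℝ := (partialTest Ω i φ : Space d → ℝ) with hf'
  have hfc : Continuous f := φ.2.1.continuous
  have hfc' : Continuous f' := (partialTest Ω i φ).2.1.continuous
  have hfd : Differentiable ℝ f := φ.2.1.differentiable (by simp)
  let g : Space d →L[ℝ] ℝ := EuclideanSpace.proj i
  have hg1 : ∀ x, fderiv ℝ (fun y => g y) x v = 1 := by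
    intro x
    have : fderiv ℝ (fun y => g y) x = g := g.fderiv
    rw [this]; simp [g, v]
  have hsq : ∀ x, fderiv ℝ (fun y => f y * f y) x v = 2 * (f x * f' x) := by
    intro x
    rw [fderiv_fun_mul (hfd x) (hfd x)]
    simp only [_root_.add_apply, _root_.smul_apply, smul_eq_mul]
    change f x * f' x + f x * f' x = _
    ring
  have key : ∫ x, (f x * f x) * fderiv ℝ (fun y => g y) x v
      = - ∫ x, fderiv ℝ (fun y => f y * f y) x v * g x := by
    refine integral_mul_fderiv_eq_neg_fderiv_mul_of_integrable ?_ ?_ ?_ ?_ ?_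
    · simp_rw [hsq]
      have := integrable_test_mul φ (fun x => 2 * f' x * g x) (by fun_prop)
      refine this.congr (Filter.Eventually.of_forall fun x => ?_)
      simp only [← hf]; ring
    · simp_rw [hg1]
      have := integrable_test_mul φ (fun x => f x) hfc
      refine this.congr (Filter.Eventually.of_forall fun x => ?_)
      simp only [← hf]; ring
    · have := integrable_test_mul φ (fun x => f x * g x) (by fun_prop)
      refine this.congr (Filter.Eventually.of_forall fun x => ?_)
      simp only [← hf]; ring
    · exact fun x _ => (hfd x).mul (hfd x)
    · exact fun x _ => g.differentiableAt
  simp_rw [hg1, hsq, mul_one] at key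
  have hint1 : Integrable (fun x => f x * f x) := integrable_test_mul φ _ hfc
  have hint2 : Integrable (fun x => f' x * f' x) := integrable_test_mul (partialTest Ω i φ) _ hfc'
  have hle : ∫ x, f x * f x ≤ ∫ x, ((1 / 2) * (f x * f x) + 2 * R ^ 2 * (f' x * f' x)) := by
    rw [key, ← integral_neg]
    refine integral_mono ?_ ((hint1.const_mul _).add (hint2.const_mul _)) fun x => ?_
    · have := integrable_test_mul φ (fun x => -(2 * f' x * g x)) (by fun_prop)
      refine this.congr (Filter.Eventually.of_forall fun x => ?_)
      simp only [← hf]; ring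
    · by_cases hx : x ∈ Ω
      · have h1 : |g x| ≤ R := by
          refine le_trans ?_ (hR x hx)
          simpa [g] using PiLp.norm_apply_le x i
        have h2 : (g x) ^ 2 ≤ R ^ 2 := by
          rw [← sq_abs]; gcongr
        have h3 := mul_le_mul_of_nonneg_right h2 (mul_self_nonneg (f' x))
        simp only
        nlinarith [sq_nonneg (f x + 2 * (f' x * g x))]
      · have h0 : f x = 0 := image_eq_zero_of_notMem_tsupport fun h => hx (φ.2.2.2 h)
        simp only [h0]
        nlinarith [mul_nonneg (sq_nonneg R) (mul_self_nonneg (f' x))]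
  rw [integral_add (hint1.const_mul _) (hint2.const_mul _), integral_const_mul,
    integral_const_mul] at hle
  linarith

/-- Pairs consisting of a function and a gradient. -/
abbrev GradPair {d : ℕ} (Ω : Set (Space d)) : Type :=
  WithLp 2 (L2 Ω × PiLp 2 (fun _ : Fin d => L2 Ω))

/-- `φ ↦ (φ, ∇φ)`. -/
def testGraph {d : ℕ} (Ω : Set (Space d)) : testFunctions Ω →ₗ[ℝ] GradPair Ω where
  toFun φ := WithLp.toLp 2 (testToL2 Ω φ, WithLp.toLp 2 fun i => testToL2 Ω (partialTest Ω i φ))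
  map_add' φ ψ := by
    simp only [map_add]; rfl
  map_smul' c φ := by
    simp only [map_smul]; rfl

/-- The pairs `(u, ∇u)`, `u ∈ H¹₀(Ω)`: the closure of `{(φ, ∇φ) : φ ∈ C_c^∞(Ω)}`. -/
def H10Graph {d : ℕ} (Ω : Set (Space d)) : Submodule ℝ (GradPair Ω) :=
  (LinearMap.range (testGraph Ω)).topologicalClosure

/-- `H¹₀(Ω)`, the closure of `C_c^∞(Ω)` in the `H¹` norm. -/
def H10 {d : ℕ} (Ω : Set (Space d)) : Submodule ℝ (L2 Ω) :=
  (H10Graph Ω).map (WithLp.fstₗ 2 ℝ (L2 Ω) (PiLp 2 (fun _ : Fin d => L2 Ω)))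

/-- `H²(Ω)`: all weak derivatives of order at most two are in `L²(Ω)`. -/
def H2 {d : ℕ} (Ω : Set (Space d)) : Submodule ℝ (L2 Ω) where
  carrier := {u | ∀ i, ∃ g, HasWeakPartial Ω i u g ∧ ∀ j, ∃ h, HasWeakPartial Ω j g h}
  zero_mem' := fun i => ⟨0, fun φ => by simp, fun j => ⟨0, fun φ => by simp⟩⟩
  add_mem' := by
    intro u v hu hv i
    obtain ⟨g, hg, hg'⟩ := hu i
    obtain ⟨k, hk, hk'⟩ := hv i
    refine ⟨g + k, hg.add hk, fun j => ?_⟩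
    obtain ⟨h, hh⟩ := hg' j
    obtain ⟨l, hl⟩ := hk' j
    exact ⟨h + l, hh.add hl⟩
  smul_mem' := by
    intro c u hu i
    obtain ⟨g, hg, hg'⟩ := hu i
    refine ⟨c • g, hg.smul c, fun j => ?_⟩
    obtain ⟨h, hh⟩ := hg' j
    exact ⟨c • h, hh.smul c⟩

open Classical in
/-- The weak partial derivative `∂_i f` (`0` if there is none in `L²(Ω)`). -/
def weakPartial {d : ℕ} (Ω : Set (Space d)) (i : Fin d) (f : L2 Ω) : L2 Ω :=
  if h : ∃ g, HasWeakPartial Ω i f g then h.choose else 0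

theorem weakPartial_eq {d : ℕ} {Ω : Set (Space d)} (hΩ : IsOpen Ω) {i : Fin d} {f g : L2 Ω}
    (h : HasWeakPartial Ω i f g) : weakPartial Ω i f = g := by
  have h' : ∃ g, HasWeakPartial Ω i f g := ⟨g, h⟩
  rw [weakPartial, dif_pos h']
  rw [← sub_eq_zero]
  refine eq_zero_of_inner_test hΩ _ fun φ => ?_
  have h1 := h'.choose_spec φ
  have h2 := h φ
  rw [inner_sub_left]
  linarith

/-- `u ↦ -∑ ∂_i ∂_i u`. -/
def negLaplace {d : ℕ} (Ω : Set (Space d)) (u : L2 Ω) : L2 Ω :=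
  - ∑ i, weakPartial Ω i (weakPartial Ω i u)

/-- `u ∈ H¹₀(Ω)` is the weak solution of `-Δu = f`:
`∑ ∫_Ω ∂_i u ∂_i φ = ∫_Ω f φ` for all `φ ∈ C_c^∞(Ω)`. -/
def IsWeakSolution {d : ℕ} (Ω : Set (Space d)) (u f : L2 Ω) : Prop :=
  ∃ p ∈ H10Graph Ω, p.fst = u ∧
    ∀ φ : testFunctions Ω, ∑ i, ⟪p.snd i, testToL2 Ω (partialTest Ω i φ)⟫ = ⟪f, testToL2 Ω φ⟫

/-- A non-empty bounded open set in `ℝ^d`, `d ≥ 1`, whose boundary is so regular that the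
weak solutions in `H¹₀(Ω)` of `-Δu = f`, `f ∈ L²(Ω)`, belong to `H²(Ω)`. -/
class IsH2RegularDomain {d : ℕ} (Ω : Set (Space d)) : Prop where
  dim_pos : 0 < d
  isOpen : IsOpen Ω
  nonempty : Ω.Nonempty
  isBounded : Bornology.IsBounded Ω
  regular : ∀ u f : L2 Ω, IsWeakSolution Ω u f → u ∈ H2 Ω

theorem hasWeakPartial_of_mem {d : ℕ} {Ω : Set (Space d)} {p : GradPair Ω} (hp : p ∈ H10Graph Ω)
    (i : Fin d) : HasWeakPartial Ω i p.fst (p.snd i) := by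
  intro φ
  have hc : IsClosed {p : GradPair Ω | ⟪p.fst, testToL2 Ω (partialTest Ω i φ)⟫
      = - ⟪p.snd i, testToL2 Ω φ⟫} := by
    apply isClosed_eq
    · exact (WithLp.fstL 2 ℝ (L2 Ω) (PiLp 2 (fun _ : Fin d => L2 Ω))).continuous.inner
        continuous_const
    · refine (Continuous.inner ?_ continuous_const).neg
      exact (PiLp.continuous_apply 2 _ i).comp
        (WithLp.sndL 2 ℝ (L2 Ω) (PiLp 2 (fun _ : Fin d => L2 Ω))).continuous
  refine closure_minimal ?_ hc hp
  rintro _ ⟨ψ, rfl⟩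
  exact hasWeakPartial_test i ψ φ

theorem poincare {d : ℕ} {Ω : Set (Space d)} (i : Fin d) {R : ℝ}
    (hR : ∀ x ∈ Ω, ‖x‖ ≤ R) {p : GradPair Ω} (hp : p ∈ H10Graph Ω) :
    ‖p.fst‖ ^ 2 ≤ 4 * R ^ 2 * ‖p.snd‖ ^ 2 := by
  have hc : IsClosed {p : GradPair Ω | ‖p.fst‖ ^ 2 ≤ 4 * R ^ 2 * ‖p.snd‖ ^ 2} := by
    apply isClosed_le
    · exact (WithLp.fstL 2 ℝ (L2 Ω) (PiLp 2 (fun _ : Fin d => L2 Ω))).continuous.norm.pow 2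
    · exact ((WithLp.sndL 2 ℝ (L2 Ω)
        (PiLp 2 (fun _ : Fin d => L2 Ω))).continuous.norm.pow 2).const_mul _
  refine closure_minimal ?_ hc hp
  rintro _ ⟨ψ, rfl⟩
  refine (poincare_test i hR ψ).trans ?_
  gcongr
  exact PiLp.norm_apply_le ((testGraph Ω ψ).snd) i

theorem exists_riesz {V K F : Type*} [NormedAddCommGroup V] [InnerProductSpace ℝ V]
    [CompleteSpace V] [NormedAddCommGroup K] [InnerProductSpace ℝ K] [NormedAddCommGroup F]
    [InnerProductSpace ℝ F] [CompleteSpace F] (S : V →L[ℝ] K) (J : V →L[ℝ] F) {C : ℝ} (hC : 0 < C)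
    (h : ∀ v, ‖v‖ ^ 2 ≤ C * ‖S v‖ ^ 2) (f : F) : ∃ v, ∀ w, ⟪S v, S w⟫ = ⟪f, J w⟫ := by
  let B : V →L[ℝ] V →L[ℝ] ℝ := (innerSL ℝ).bilinearComp S S
  have hB : ∀ v w, B v w = ⟪S v, S w⟫ := fun v w => by simp [B]
  have hcoer : IsCoercive B := by
    refine ⟨1 / C, by positivity, fun v => ?_⟩
    rw [hB, real_inner_self_eq_norm_sq, mul_assoc, ← sq, one_div, inv_mul_le_iff₀ hC]
    exact h v
  refine ⟨hcoer.continuousLinearEquivOfBilin.symm ((ContinuousLinearMap.adjoint J) f),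
    fun w => ?_⟩
  rw [← hB, ← hcoer.continuousLinearEquivOfBilin_apply, ContinuousLinearEquiv.apply_symm_apply,
    ContinuousLinearMap.adjoint_inner_left]

theorem exists_weakSolution {d : ℕ} (Ω : Set (Space d)) [hΩ : IsH2RegularDomain Ω] (f : L2 Ω) :
    ∃ u, IsWeakSolution Ω u f := by
  obtain ⟨R, hR⟩ := hΩ.isBounded.exists_norm_le
  have : CompleteSpace (H10Graph Ω) :=
    (Submodule.isClosed_topologicalClosure _).completeSpace_coe
  obtain ⟨⟨p, hp⟩, hv⟩ := exists_riesz (V := H10Graph Ω)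
    ((WithLp.sndL 2 ℝ (L2 Ω) (PiLp 2 (fun _ : Fin d => L2 Ω))).comp (H10Graph Ω).subtypeL)
    ((WithLp.fstL 2 ℝ (L2 Ω) (PiLp 2 (fun _ : Fin d => L2 Ω))).comp (H10Graph Ω).subtypeL)
    (C := 4 * R ^ 2 + 1) (by positivity) (fun v => by
      have h1 := poincare ⟨0, hΩ.dim_pos⟩ hR v.2
      have h2 := WithLp.prod_norm_sq_eq_of_L2 (v : GradPair Ω)
      have h3 : ‖v‖ ^ 2 = ‖(v : GradPair Ω)‖ ^ 2 := rfl
      rw [h3, h2]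
      simp only [ContinuousLinearMap.comp_apply, Submodule.subtypeL_apply, WithLp.sndL_apply]
      linarith) f
  refine ⟨p.fst, p, hp, rfl, fun φ => ?_⟩
  have h3 := hv ⟨testGraph Ω φ, subset_closure ⟨φ, rfl⟩⟩
  simp only [ContinuousLinearMap.comp_apply, Submodule.subtypeL_apply, WithLp.sndL_apply,
    WithLp.fstL_apply, PiLp.inner_apply] at h3
  exact h3

theorem IsWeakSolution.inner_eq {d : ℕ} {Ω : Set (Space d)} {p : GradPair Ω} {f : L2 Ω}
    (h : ∀ φ : testFunctions Ω,
      ∑ i, ⟪p.snd i, testToL2 Ω (partialTest Ω i φ)⟫ = ⟪f, testToL2 Ω φ⟫)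
    {q : GradPair Ω} (hq : q ∈ H10Graph Ω) : ⟪p.snd, q.snd⟫ = ⟪f, q.fst⟫ := by
  have hc : IsClosed {q : GradPair Ω | ⟪p.snd, q.snd⟫ = ⟪f, q.fst⟫} := by
    apply isClosed_eq
    · exact Continuous.inner continuous_const
        (WithLp.sndL 2 ℝ (L2 Ω) (PiLp 2 (fun _ : Fin d => L2 Ω))).continuous
    · exact Continuous.inner continuous_const
        (WithLp.fstL 2 ℝ (L2 Ω) (PiLp 2 (fun _ : Fin d => L2 Ω))).continuous
  refine closure_minimal ?_ hc hq
  rintro _ ⟨ψ, rfl⟩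
  have := h ψ
  rw [mem_ofPred_eq, PiLp.inner_apply]
  exact this

theorem exists_bound_weakSolution {d : ℕ} (Ω : Set (Space d)) [hΩ : IsH2RegularDomain Ω] :
    ∃ C : ℝ, ∀ u f : L2 Ω, IsWeakSolution Ω u f → ‖u‖ ≤ C * ‖f‖ := by
  obtain ⟨R, hR⟩ := hΩ.isBounded.exists_norm_le
  refine ⟨4 * R ^ 2, ?_⟩
  rintro _ f ⟨p, hp, rfl, h⟩
  have h1 := poincare ⟨0, hΩ.dim_pos⟩ hR hp
  have h2 := IsWeakSolution.inner_eq h hp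
  rw [real_inner_self_eq_norm_sq] at h2
  have h3 := real_inner_le_norm f p.fst
  rcases (norm_nonneg p.fst).eq_or_lt with h0 | h0
  · rw [← h0]; positivity
  · have h4 : ‖p.fst‖ * ‖p.fst‖ ≤ (4 * R ^ 2 * ‖f‖) * ‖p.fst‖ := by
      rw [h2] at h1
      have := mul_le_mul_of_nonneg_left h3 (show 0 ≤ 4 * R ^ 2 by positivity)
      nlinarith
    exact le_of_mul_le_mul_right h4 h0

/-- `U = H¹₀(Ω) ∩ H²(Ω)`. -/
def StateSpace {d : ℕ} (Ω : Set (Space d)) : Type := ↥(H10 Ω ⊓ H2 Ω)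

instance {d : ℕ} (Ω : Set (Space d)) : AddCommGroup (StateSpace Ω) :=
  inferInstanceAs (AddCommGroup ↥(H10 Ω ⊓ H2 Ω))

instance {d : ℕ} (Ω : Set (Space d)) : Module ℝ (StateSpace Ω) :=
  inferInstanceAs (Module ℝ ↥(H10 Ω ⊓ H2 Ω))

/-- The inclusion `U → L²(Ω)`, as a linear map. -/
def stateVal {d : ℕ} (Ω : Set (Space d)) : StateSpace Ω →ₗ[ℝ] L2 Ω := (H10 Ω ⊓ H2 Ω).subtype

theorem isWeakSolution_negLaplace {d : ℕ} (Ω : Set (Space d)) [hΩ : IsH2RegularDomain Ω]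
    (u : StateSpace Ω) : IsWeakSolution Ω (stateVal Ω u) (negLaplace Ω (stateVal Ω u)) := by
  obtain ⟨_, ⟨p, hp, rfl⟩, hu2⟩ := u
  refine ⟨p, hp, rfl, fun φ => ?_⟩
  change _ = ⟪negLaplace Ω p.fst, _⟫
  rw [negLaplace, inner_neg_left, sum_inner, ← Finset.sum_neg_distrib]
  refine Finset.sum_congr rfl fun i _ => ?_
  obtain ⟨g, hg, hg'⟩ := hu2 i
  obtain ⟨k, hk⟩ := hg' i
  have e1 := weakPartial_eq hΩ.isOpen (hasWeakPartial_of_mem hp i)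
  have e2 := weakPartial_eq hΩ.isOpen hg
  have e3 : p.snd i = g := e1.symm.trans e2
  rw [e1, weakPartial_eq hΩ.isOpen (e3 ▸ hk : HasWeakPartial Ω i (p.snd i) k), e3]
  exact hk φ

theorem IsWeakSolution.unique_rhs {d : ℕ} {Ω : Set (Space d)} [hΩ : IsH2RegularDomain Ω]
    {u f g : L2 Ω} (hf : IsWeakSolution Ω u f) (hg : IsWeakSolution Ω u g) : f = g := by
  obtain ⟨p, hp, rfl, h⟩ := hf
  obtain ⟨q, hq, hqp, h'⟩ := hg
  have e : ∀ i, p.snd i = q.snd i := fun i => by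
    rw [← weakPartial_eq hΩ.isOpen (hasWeakPartial_of_mem hp i),
      ← weakPartial_eq hΩ.isOpen (hasWeakPartial_of_mem hq i), hqp]
  rw [← sub_eq_zero]
  refine eq_zero_of_inner_test hΩ.isOpen _ fun φ => ?_
  rw [inner_sub_left, ← h φ, ← h' φ]
  simp [e]

theorem IsWeakSolution.add {d : ℕ} {Ω : Set (Space d)} {u v f g : L2 Ω}
    (hf : IsWeakSolution Ω u f) (hg : IsWeakSolution Ω v g) :
    IsWeakSolution Ω (u + v) (f + g) := by
  obtain ⟨p, hp, rfl, h⟩ := hf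
  obtain ⟨q, hq, rfl, h'⟩ := hg
  refine ⟨p + q, add_mem hp hq, rfl, fun φ => ?_⟩
  rw [inner_add_left, ← h φ, ← h' φ, ← Finset.sum_add_distrib]
  refine Finset.sum_congr rfl fun i _ => ?_
  rw [← inner_add_left]; rfl

theorem IsWeakSolution.smul {d : ℕ} {Ω : Set (Space d)} {u f : L2 Ω} (c : ℝ)
    (hf : IsWeakSolution Ω u f) : IsWeakSolution Ω (c • u) (c • f) := by
  obtain ⟨p, hp, rfl, h⟩ := hf
  refine ⟨c • p, Submodule.smul_mem _ c hp, rfl, fun φ => ?_⟩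
  rw [real_inner_smul_left, ← h φ, Finset.mul_sum]
  refine Finset.sum_congr rfl fun i _ => ?_
  rw [← real_inner_smul_left]; rfl

/-- `𝒜 = -Δ : U → L²(Ω)`, as a linear map. -/
def laplaceLin {d : ℕ} (Ω : Set (Space d)) [IsH2RegularDomain Ω] :
    StateSpace Ω →ₗ[ℝ] L2 Ω where
  toFun u := negLaplace Ω (stateVal Ω u)
  map_add' u v := by
    refine (isWeakSolution_negLaplace Ω (u + v)).unique_rhs ?_
    rw [map_add]
    exact (isWeakSolution_negLaplace Ω u).add (isWeakSolution_negLaplace Ω v)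
  map_smul' c u := by
    refine (isWeakSolution_negLaplace Ω (c • u)).unique_rhs ?_
    rw [map_smul]
    exact (isWeakSolution_negLaplace Ω u).smul c

theorem laplaceLin_injective {d : ℕ} (Ω : Set (Space d)) [hΩ : IsH2RegularDomain Ω] :
    Function.Injective (laplaceLin Ω) := by
  rw [injective_iff_map_eq_zero]
  intro u hu
  obtain ⟨C, hC⟩ := exists_bound_weakSolution Ω
  have h1 := hC _ _ (isWeakSolution_negLaplace Ω u)
  have h2 : negLaplace Ω (stateVal Ω u) = 0 := hu
  rw [h2, norm_zero, mul_zero] at h1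
  exact Subtype.ext (norm_le_zero_iff.1 h1)

theorem laplaceLin_surjective {d : ℕ} (Ω : Set (Space d)) [hΩ : IsH2RegularDomain Ω] :
    Function.Surjective (laplaceLin Ω) := by
  intro f
  obtain ⟨u, hu⟩ := exists_weakSolution Ω f
  have hu1 : u ∈ H10 Ω := by
    obtain ⟨p, hp, rfl, -⟩ := hu
    exact ⟨p, hp, rfl⟩
  exact ⟨⟨u, hu1, hΩ.regular u f hu⟩, IsWeakSolution.unique_rhs
    (isWeakSolution_negLaplace Ω ⟨u, hu1, hΩ.regular u f hu⟩) hu⟩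

/-- The norm of `U` is `‖𝒜 u‖_{L²}`. -/
instance {d : ℕ} (Ω : Set (Space d)) [IsH2RegularDomain Ω] :
    NormedAddCommGroup (StateSpace Ω) :=
  NormedAddCommGroup.induced _ _ (laplaceLin Ω) (laplaceLin_injective Ω)

/-- The inner product of `U` is `⟪𝒜 u, 𝒜 v⟫_{L²}`. -/
instance {d : ℕ} (Ω : Set (Space d)) [IsH2RegularDomain Ω] :
    InnerProductSpace ℝ (StateSpace Ω) :=
  InnerProductSpace.induced (laplaceLin Ω)

/-- `𝒜 : U → L²(Ω)`. -/
def laplace {d : ℕ} (Ω : Set (Space d)) [IsH2RegularDomain Ω] : StateSpace Ω ≃ₗᵢ[ℝ] L2 Ω where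
  toLinearEquiv := LinearEquiv.ofBijective (laplaceLin Ω)
    ⟨laplaceLin_injective Ω, laplaceLin_surjective Ω⟩
  norm_map' _ := rfl

instance {d : ℕ} (Ω : Set (Space d)) [IsH2RegularDomain Ω] : CompleteSpace (StateSpace Ω) :=
  (laplace Ω).toIsometryEquiv.completeSpace

/-- The bounded inclusion `U → L²(Ω)`. -/
def embed {d : ℕ} (Ω : Set (Space d)) [IsH2RegularDomain Ω] : StateSpace Ω →L[ℝ] L2 Ω :=
  (stateVal Ω).mkContinuousOfExistsBound (by
    obtain ⟨C, hC⟩ := exists_bound_weakSolution Ω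
    exact ⟨C, fun u => hC _ _ (isWeakSolution_negLaplace Ω u)⟩)

/-! ### Functional calculus of positive operators on a real Hilbert space -/

/-- `S = f(T)` for a positive operator `T` and a function `f` continuous on `[0, ‖T‖]` (which
contains the spectrum of `T`): whenever a polynomial `p` is uniformly `ε`-close to `f` on
`[0, ‖T‖]`, the operator `p(T)` is `ε`-close to `S` in operator norm. -/
def IsFunctionOf {E : Type*} [NormedAddCommGroup E] [InnerProductSpace ℝ E]
    (f : ℝ → ℝ) (T S : E →L[ℝ] E) : Prop :=
  ∀ (p : Polynomial ℝ) (ε : ℝ), (∀ t ∈ Icc 0 ‖T‖, |p.eval t - f t| ≤ ε) →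
    ‖Polynomial.aeval T p - S‖ ≤ ε

open Classical in
/-- The operator `f(T)` for a positive operator `T` and a function `f` continuous on `[0, ∞)`. -/
def opFun {E : Type*} [NormedAddCommGroup E] [InnerProductSpace ℝ E]
    (f : ℝ → ℝ) (T : E →L[ℝ] E) : E →L[ℝ] E :=
  if h : ∃ S, IsFunctionOf f T S then h.choose else 0

/-- The trace (in `[0, ∞]`) of a positive operator: `∑ ⟪T e_i, e_i⟫` over a Hilbert basis. -/
def posTrace {E : Type*} [NormedAddCommGroup E] [InnerProductSpace ℝ E] [CompleteSpace E]
    (T : E →L[ℝ] E) : ℝ≥0∞ :=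
  ∑' i : (exists_hilbertBasis ℝ E).choose, ENNReal.ofReal ⟪T (i : E), (i : E)⟫

/-- Index functions: continuous, non-decreasing, vanishing at `0` and positive on `(0, ∞)`. -/
structure IsIndexFunction (ψ : ℝ → ℝ) : Prop where
  continuousOn : ContinuousOn ψ (Ici 0)
  monotoneOn : MonotoneOn ψ (Ici 0)
  map_zero : ψ 0 = 0
  pos : ∀ t, 0 < t → 0 < ψ t

/-- `Θ(t) = √t ψ(t)`. -/
def theta (ψ : ℝ → ℝ) (t : ℝ) : ℝ := √t * ψ t

/-- `f₀² = (Θ²)⁻¹`, the inverse of the increasing bijection `Θ² : [0, ∞) → [0, ∞)`. -/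
def f0Sq (ψ : ℝ → ℝ) : ℝ → ℝ := Function.invFunOn (fun t => theta ψ t ^ 2) (Ici 0)

/-- `f₀ = ((Θ²)⁻¹)^{1/2}`. -/
def f0 (ψ : ℝ → ℝ) (s : ℝ) : ℝ := √(f0Sq ψ s)

/-- Operator concavity of `f : [0, ∞) → [0, ∞)`, for positive operators on `E`. -/
def IsOperatorConcave (E : Type*) [NormedAddCommGroup E] [InnerProductSpace ℝ E]
    (f : ℝ → ℝ) : Prop :=
  ∀ S T : E →L[ℝ] E, S.IsPositive → T.IsPositive →
    (1 / 2 : ℝ) • (opFun f S + opFun f T) ≤ opFun f ((1 / 2 : ℝ) • (S + T))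

/-! ### The Bayesian linear Gaussian problem `y = G x + δ η` with white noise `η` and prior
`N(0, (δ² / α) C₀)` -/

section Bayes

variable {X Y : Type*} [NormedAddCommGroup X] [InnerProductSpace ℝ X] [CompleteSpace X]
  [NormedAddCommGroup Y] [InnerProductSpace ℝ Y] [CompleteSpace Y]

/-- `B = G C₀^{1/2}`. -/
def precondOp (G : X →L[ℝ] Y) (C₀ : X →L[ℝ] X) : X →L[ℝ] Y := G ∘L opFun Real.sqrt C₀

/-- `H = B* B = C₀^{1/2} G* G C₀^{1/2}`. -/
def hessOp (G : X →L[ℝ] Y) (C₀ : X →L[ℝ] X) : X →L[ℝ] X :=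
  ContinuousLinearMap.adjoint (precondOp G C₀) ∘L precondOp G C₀

/-- `(α I + H)⁻¹`. -/
def resolventOp (G : X →L[ℝ] Y) (C₀ : X →L[ℝ] X) (α : ℝ) : X →L[ℝ] X :=
  Ring.inverse (α • (1 : X →L[ℝ] X) + hessOp G C₀)

/-- The operator `C₀^{1/2} (α I + H)⁻¹ B*` that maps the data to the posterior mean. -/
def gainOp (G : X →L[ℝ] Y) (C₀ : X →L[ℝ] X) (α : ℝ) : Y →L[ℝ] X :=
  opFun Real.sqrt C₀ ∘L resolventOp G C₀ α ∘L ContinuousLinearMap.adjoint (precondOp G C₀)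

/-- The posterior covariance `δ² C₀^{1/2} (α I + H)⁻¹ C₀^{1/2}`. -/
def posteriorCov (G : X →L[ℝ] Y) (C₀ : X →L[ℝ] X) (α δ : ℝ) : X →L[ℝ] X :=
  δ ^ 2 • (opFun Real.sqrt C₀ ∘L resolventOp G C₀ α ∘L opFun Real.sqrt C₀)

/-- Gaussian white noise on `Y` (law `N(0, I)`), a generalized random variable: `η y` is the random
variable `⟪η, y⟫`. -/
structure IsWhiteNoise {S : Type*} [MeasurableSpace S] (P : Measure S) (η : Y → S → ℝ) : Prop where
  hasLaw : ∀ y, ProbabilityTheory.HasLaw (η y) (ProbabilityTheory.gaussianReal 0 (‖y‖₊ ^ 2)) P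
  linear : ∀ (a b : ℝ) (y z : Y),
    (fun τ => η (a • y + b • z) τ) =ᵐ[P] fun τ => a * η y τ + b * η z τ

/-- `M` is the posterior mean `C₀^{1/2} (α I + H)⁻¹ B* y` for the data `y = G x + δ η`. -/
structure IsPosteriorMean {S : Type*} [MeasurableSpace S] (P : Measure S) (η : Y → S → ℝ)
    (G : X →L[ℝ] Y) (C₀ : X →L[ℝ] X) (α δ : ℝ) (x : X) (M : S → X) : Prop where
  aestronglyMeasurable : AEStronglyMeasurable M P
  inner_eq : ∀ h : X, (fun τ => ⟪M τ, h⟫) =ᵐ[P] fun τ =>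
    ⟪G x, ContinuousLinearMap.adjoint (gainOp G C₀ α) h⟫
      + δ * η (ContinuousLinearMap.adjoint (gainOp G C₀ α) h) τ

/-- `Z` is a random variable with law `N(0, C)` in the Hilbert space `X`. -/
structure IsCenteredGaussian {S : Type*} [MeasurableSpace S] (Q : Measure S) (C : X →L[ℝ] X)
    (Z : S → X) : Prop where
  aestronglyMeasurable : AEStronglyMeasurable Z Q
  hasLaw : ∀ h : X, ProbabilityTheory.HasLaw (fun τ => ⟪Z τ, h⟫)
    (ProbabilityTheory.gaussianReal 0 ⟪C h, h⟫.toNNReal) Q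

/-- The squared posterior contraction `𝔼^x 𝔼_post ‖x - ·‖²`, where the posterior for the noise
realization `τ` is the law of `M τ + Z`. -/
def squaredPosteriorContraction {S S' : Type*} [MeasurableSpace S] [MeasurableSpace S']
    (P : Measure S) (Q : Measure S') (M : S → X) (Z : S' → X) (x : X) : ℝ≥0∞ :=
  ∫⁻ τ, ∫⁻ σ, ‖x - (M τ + Z σ)‖ₑ ^ 2 ∂Q ∂P

/-- `‖s_α(H) f₀(H) φ₀(C₀)⁻¹ φ(C₀)‖ ∈ [0, ∞]` with `s_α(t) = α / (α + t)`, `φ₀(t) = √t`: the norm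
over the natural domain of all `v` such that `φ(C₀) v = C₀^{1/2} w` for some `w`. -/
def biasNorm (G : X →L[ℝ] Y) (C₀ : X →L[ℝ] X) (ψ φ : ℝ → ℝ) (α : ℝ) : ℝ≥0∞ :=
  ⨆ (v : X) (w : X) (_ : ‖v‖ ≤ 1) (_ : opFun Real.sqrt C₀ w = opFun φ C₀ v),
    ‖opFun (fun t => α / (α + t)) (hessOp G C₀) (opFun (f0 ψ) (hessOp G C₀) w)‖ₑ

/-- The one-sided contraction bound
`SPC(α, δ) ≤ m⁻² (‖s_α(H) f₀(H) φ₀(C₀)⁻¹ φ(C₀)‖² + 2 δ² tr[(α + H)⁻¹ f₀²(H)])` for all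
`α, δ > 0`, all index functions `φ` and all true elements `x = φ(C₀) v`, `‖v‖ ≤ 1`. -/
def OneSidedContraction (G : X →L[ℝ] Y) (C₀ : X →L[ℝ] X) (ψ : ℝ → ℝ) (m : ℝ) : Prop :=
  ∀ φ : ℝ → ℝ, IsIndexFunction φ → ∀ v : X, ‖v‖ ≤ 1 → ∀ α δ : ℝ, 0 < α → 0 < δ →
  ∀ (S S' : Type w) [MeasurableSpace S] [MeasurableSpace S'] (P : Measure S) (Q : Measure S')
    [IsProbabilityMeasure P] [IsProbabilityMeasure Q] (η : Y → S → ℝ) (M : S → X) (Z : S' → X),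
    IsWhiteNoise P η → IsPosteriorMean P η G C₀ α δ (opFun φ C₀ v) M →
    IsCenteredGaussian Q (posteriorCov G C₀ α δ) Z →
    squaredPosteriorContraction P Q M Z (opFun φ C₀ v) ≤
      ENNReal.ofReal (1 / m ^ 2) * (biasNorm G C₀ ψ φ α ^ 2 + 2 * ENNReal.ofReal (δ ^ 2) *
        posTrace (resolventOp G C₀ α ∘L opFun (f0Sq ψ) (hessOp G C₀)))

end Bayes

/-! ### The all-at-once inverse source problem and its block diagonal priors -/

section AllAtOnce

variable {d : ℕ} (Ω : Set (Space d)) [IsH2RegularDomain Ω]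

/-- The Hilbert space `U × L²(Ω)` of pairs `(u, θ)`. -/
abbrev PairSpace : Type := WithLp 2 (StateSpace Ω × L2 Ω)

/-- The data space `L²(Ω) × L²(Ω)`. -/
abbrev DataSpace : Type := WithLp 2 (L2 Ω × L2 Ω)

/-- The forward operator `𝒢 (u, θ) = (𝒜 u - θ, u)`. -/
def forwardOp : PairSpace Ω →L[ℝ] DataSpace Ω :=
  (WithLp.prodContinuousLinearEquiv 2 ℝ (L2 Ω) (L2 Ω)).symm.toContinuousLinearMap ∘L
    (((laplace Ω).toContinuousLinearEquiv.toContinuousLinearMap ∘L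
        WithLp.fstL 2 ℝ (StateSpace Ω) (L2 Ω) - WithLp.sndL 2 ℝ (StateSpace Ω) (L2 Ω)).prod
      (embed Ω ∘L WithLp.fstL 2 ℝ (StateSpace Ω) (L2 Ω)))

variable {Ω}

/-- The block diagonal operator `diag(B, D)` on `U × L²(Ω)`. -/
def blockDiag (B : StateSpace Ω →ₗ[ℝ] StateSpace Ω) (D : L2 Ω →ₗ[ℝ] L2 Ω) :
    PairSpace Ω →ₗ[ℝ] PairSpace Ω where
  toFun x := WithLp.toLp 2 (B x.fst, D x.snd)
  map_add' x y := by simp only [WithLp.add_fst, WithLp.add_snd, map_add]; rfl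
  map_smul' c x := by simp only [WithLp.smul_fst, WithLp.smul_snd, map_smul]; rfl

/-- The upper link estimate `‖𝒢 x‖ ≤ M ‖T x‖`, where `T` stands for `ψ(C₀)`. -/
def UpperLink (T : PairSpace Ω →ₗ[ℝ] PairSpace Ω) (M : ℝ) : Prop :=
  ∀ x, ‖forwardOp Ω x‖ ≤ M * ‖T x‖

/-- The lower link estimate `m ‖T x‖ ≤ ‖𝒢 x‖`, where `T` stands for `ψ(C₀)`. -/
def LowerLink (T : PairSpace Ω →ₗ[ℝ] PairSpace Ω) (m : ℝ) : Prop :=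
  ∀ x, m * ‖T x‖ ≤ ‖forwardOp Ω x‖

/-- `‖x‖ ≤ c ‖B x‖` for some constant `c` and all `x`. -/
def IsBoundedBelow {E : Type*} [NormedAddCommGroup E] [NormedSpace ℝ E] (B : E →ₗ[ℝ] E) : Prop :=
  ∃ c : ℝ, ∀ x, ‖x‖ ≤ c * ‖B x‖

/-- `B` is bijective with bounded inverse. -/
def HasBoundedInverse {E : Type*} [NormedAddCommGroup E] [NormedSpace ℝ E] (B : E →ₗ[ℝ] E) :
    Prop :=
  Function.Bijective B ∧ IsBoundedBelow B

/-- `B : U → U` extends to a bounded operator `L²(Ω) → U`. -/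
def IsBoundedL2ToU (B : StateSpace Ω →ₗ[ℝ] StateSpace Ω) : Prop :=
  ∃ B' : L2 Ω →L[ℝ] StateSpace Ω, ∀ u, B' (embed Ω u) = B u

/-- `D` has a Hilbert space adjoint `D* : L²(Ω) → L²(Ω)` which is a bounded operator
`L²(Ω) → U`. -/
def AdjointIsBoundedL2ToU (D : L2 Ω →ₗ[ℝ] L2 Ω) : Prop :=
  ∃ D' : L2 Ω →L[ℝ] StateSpace Ω, ∀ f g, ⟪D f, g⟫ = ⟪f, embed Ω (D' g)⟫

variable (Ω)

/-- `𝒜⁻¹ : L²(Ω) → U`. -/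
def invLaplace : L2 Ω →L[ℝ] StateSpace Ω :=
  (laplace Ω).symm.toContinuousLinearEquiv.toContinuousLinearMap

/-- `𝒜^{-p}` on `L²(Ω)`. -/
def negPowL2 (p : ℝ) : L2 Ω →L[ℝ] L2 Ω := opFun (fun t => t ^ p) (embed Ω ∘L invLaplace Ω)

/-- `𝒜^{-s}` on `U`. -/
def negPowU (s : ℝ) : StateSpace Ω →L[ℝ] StateSpace Ω :=
  opFun (fun t => t ^ s) (invLaplace Ω ∘L embed Ω)

end AllAtOnce

end

end BlockPrior

namespace BlockPrior

noncomputable section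

/-! ### Functional calculus of positive operators -/

section FunctionalCalculus

open Polynomial Filter Topology

variable {E : Type*} [NormedAddCommGroup E] [InnerProductSpace ℝ E]

/-! The link bounds are decided by testing on special pairs. On `(u, 0)` and `(0, θ)` the norm of
`𝒢` dominates `‖u‖_U` and `‖θ‖`, so (ub) forces both blocks to be bounded below; the converse is
boundedness of `𝒢`. A symmetric operator that is bounded below has closed range with trivial
orthogonal complement, hence is bijective.

On the graph `θ = 𝒜u` only the weak norm survives, `‖𝒢(u, 𝒜u)‖ = ‖u‖_{L²}`. So (lb) makes `B` and
`D𝒜` bounded for the `L²` norm on the dense subspace `U`, and the extension `S` of `D𝒜` yields `D* =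
𝒜⁻¹S*`. Both bounds together would give `‖u‖_U ≤ C‖u‖_{L²}`, that is, a bounded Laplacian. This
fails on the oscillating functions `φ cos(k x_i)` and `φ sin(k x_i)` (`oscillation_identity`,
`not_norm_le_embed`).

The contraction bound rests on one operator inequality, `m² C₀ ≤ f₀²(H)`
(`inner_le_inner_opFun_f0Sq`). The link bound at `C₀^{1/2} y` reads `m² Θ²(C₀) ≤ H`; a non-negative
operator concave function is operator monotone, so `f₀²` may be applied; and `f₀²(m² s) ≥ m² f₀²(s)`
because `ψ` is non-decreasing and `m ≤ 1`. The squared contraction splits into squared bias,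
variance of the posterior mean and posterior trace. The variance is at most the posterior trace,
whence the factor 2, and the inequality replaces `C₀` by `m⁻² f₀²(H)` in the bias and in the trace.

For the example, `C₀ = T²` and `ψ = √` give `f₀² = √`, and the square root is shown to be operator
concave.

All of this uses a functional calculus on real Hilbert spaces built from polynomials. Its core is
`norm_aeval_le`: `‖p(T)‖` is at most the supremum of `|p|` on `[0, ‖T‖]`, proved by factoring real
polynomials instead of through spectral theory. -/

theorem isSymmetric_aeval {T : E →L[ℝ] E} (hT : T.IsSymmetric) (p : ℝ[X]) :
    (aeval T p : E →L[ℝ] E).IsSymmetric := by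
  induction p using Polynomial.induction_on' with
  | add p q hp hq =>
    intro x y
    have h1 := hp x y
    have h2 := hq x y
    simp only [map_add, ContinuousLinearMap.coe_coe, _root_.add_apply] at h1 h2 ⊢
    rw [inner_add_left, inner_add_right, h1, h2]
  | monomial n a =>
    intro x y
    have h : ∀ (n : ℕ) (x y : E), ⟪(T ^ n) x, y⟫ = ⟪x, (T ^ n) y⟫ := by
      intro n
      induction n with
      | zero => intro x y; simp
      | succ n ih =>
        intro x y
        have hTxy : ∀ x y, ⟪T x, y⟫ = ⟪x, T y⟫ := hT
        rw [pow_succ, mul_apply_eq_comp, ih, hTxy, ← mul_apply_eq_comp,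
          ← pow_succ', ← pow_succ]
    have h1 : ∀ x, (aeval T (monomial n a) : E →L[ℝ] E) x = a • (T ^ n) x := by
      intro x
      rw [aeval_monomial, ← Algebra.smul_def]; rfl
    simp only [ContinuousLinearMap.coe_coe, h1]
    rw [real_inner_smul_left, real_inner_smul_right, h n]

/-- `S` is bounded below by a positive constant. -/
def BddBelowOp (S : E →L[ℝ] E) : Prop := ∃ c : ℝ, 0 < c ∧ ∀ x, c * ‖x‖ ≤ ‖S x‖

theorem BddBelowOp.mul {S T : E →L[ℝ] E} (hS : BddBelowOp S) (hT : BddBelowOp T) :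
    BddBelowOp (S * T) := by
  obtain ⟨a, ha, hS⟩ := hS
  obtain ⟨b, hb, hT⟩ := hT
  refine ⟨a * b, by positivity, fun x => ?_⟩
  calc a * b * ‖x‖ = a * (b * ‖x‖) := by ring
    _ ≤ a * ‖T x‖ := by gcongr; exact hT x
    _ ≤ _ := hS _

theorem bddBelowOp_of_inner {S : E →L[ℝ] E} {c : ℝ} (hc : 0 < c)
    (h : ∀ x, c * ‖x‖ ^ 2 ≤ |⟪S x, x⟫|) : BddBelowOp S := by
  refine ⟨c, hc, fun x => ?_⟩
  rcases (norm_nonneg x).eq_or_lt with h0 | h0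
  · rw [← h0]; simp
  · refine le_of_mul_le_mul_right ?_ h0
    calc c * ‖x‖ * ‖x‖ = c * ‖x‖ ^ 2 := by ring
      _ ≤ _ := h x
      _ ≤ _ := abs_real_inner_le_norm _ _

theorem bddBelowOp_algebraMap {c : ℝ} (hc : c ≠ 0) : BddBelowOp (algebraMap ℝ (E →L[ℝ] E) c) := by
  refine ⟨|c|, by positivity, fun x => ?_⟩
  rw [Algebra.algebraMap_eq_smul_one]
  simp [norm_smul]

theorem inner_le_norm_mul_sq (T : E →L[ℝ] E) (x : E) : ⟪T x, x⟫ ≤ ‖T‖ * ‖x‖ ^ 2 := by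
  calc ⟪T x, x⟫ ≤ ‖T x‖ * ‖x‖ := real_inner_le_norm _ _
    _ ≤ ‖T‖ * ‖x‖ * ‖x‖ := by gcongr; exact T.le_opNorm x
    _ = _ := by ring

/-- Real irreducibles have degree at most two. In the linear case the root lies outside `[0, ‖T‖]`,
and the form of `T - r` is bounded away from zero by the distance to that interval. In the quadratic
case, completing the square gives `4a p = (2aX + b)² + (4ac - b²)` with `4ac - b² > 0`. -/
theorem bddBelowOp_aeval_irreducible {T : E →L[ℝ] E} (hT : T.IsPositive) {p : ℝ[X]}
    (hp : Irreducible p) (h : ∀ t ∈ Icc 0 ‖T‖, p.eval t ≠ 0) : BddBelowOp (aeval T p) := by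
  obtain ⟨a, b, c, hpe⟩ : ∃ a b c : ℝ, p = C a * X ^ 2 + C b * X + C c :=
    ⟨_, _, _, eq_quadratic_of_degree_le_two hp.degree_le_two⟩
  have hev : ∀ t, p.eval t = a * t ^ 2 + b * t + c := fun t => by simp [hpe]
  by_cases hroot : ∃ r, p.eval r = 0
  · obtain ⟨r, hr⟩ := hroot
    have hdvd : (X - C r) ∣ p := dvd_iff_isRoot.2 hr
    obtain ⟨q, hq⟩ := hdvd
    have hqu : IsUnit q := (hp.isUnit_or_isUnit hq).resolve_left (not_isUnit_X_sub_C r)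
    obtain ⟨k, hk, rfl⟩ := isUnit_iff.1 hqu
    rw [hq, map_mul, aeval_C]
    refine BddBelowOp.mul ?_ (bddBelowOp_algebraMap hk.ne_zero)
    have hrT : r ∉ Icc 0 ‖T‖ := fun hmem => h r hmem hr
    have hap : ∀ x, ⟪(aeval T (X - C r) : E →L[ℝ] E) x, x⟫ = ⟪T x, x⟫ - r * ‖x‖ ^ 2 := by
      intro x
      rw [map_sub, aeval_X, aeval_C, Algebra.algebraMap_eq_smul_one, _root_.sub_apply,
        inner_sub_left]
      simp [real_inner_smul_left]
    rw [mem_Icc, not_and_or, not_le, not_le] at hrT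
    rcases hrT with h0 | h0
    · refine bddBelowOp_of_inner (c := -r) (by linarith) fun x => ?_
      rw [hap]
      have := hT.inner_nonneg_left x
      exact le_trans (by linarith) (le_abs_self _)
    · refine bddBelowOp_of_inner (c := r - ‖T‖) (by linarith) fun x => ?_
      rw [hap]
      have := inner_le_norm_mul_sq T x
      exact le_trans (by linarith) (neg_le_abs _)
  · push Not at hroot
    have hdisc : 0 < 4 * a * c - b ^ 2 ∧ a ≠ 0 := by
      have ha : a ≠ 0 ∨ b = 0 := by
        by_contra! hab
        refine hroot (-c / b) ?_
        rw [hev, hab.1]; field_simp [hab.2]; ring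
      by_cases ha0 : a = 0
      · have hb : b = 0 := ha.resolve_left (not_not.2 ha0)
        exfalso
        have : p = C c := by rw [hpe, ha0, hb]; simp
        by_cases hc : c = 0
        · exact hp.ne_zero (by rw [this, hc, C_0])
        · exact hp.not_isUnit (this ▸ isUnit_C.2 (isUnit_iff_ne_zero.2 hc))
      · refine ⟨?_, ha0⟩
        by_contra! hle
        refine hroot ((-b + √(b ^ 2 - 4 * a * c)) / (2 * a)) ?_
        have hs : √(b ^ 2 - 4 * a * c) ^ 2 = b ^ 2 - 4 * a * c := Real.sq_sqrt (by linarith)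
        rw [hev]
        set w := √(b ^ 2 - 4 * a * c)
        field_simp
        linear_combination hs
    -- `D` is half of the completed square: `D` is symmetric, so `⟪D² x, x⟫ = ‖D x‖² ≥ 0`.
    set D := aeval T (C (2 * a) * X + C b) with hD
    have hDs : ∀ x y, ⟪D x, y⟫ = ⟪x, D y⟫ := isSymmetric_aeval hT.isSymmetric _
    have hid : ∀ x, (4 * a) * ⟪(aeval T p : E →L[ℝ] E) x, x⟫
        = ‖D x‖ ^ 2 + (4 * a * c - b ^ 2) * ‖x‖ ^ 2 := by
      intro x
      have e : C (4 * a) * p = (C (2 * a) * X + C b) * (C (2 * a) * X + C b)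
          + C (4 * a * c - b ^ 2) := by
        rw [hpe]; simp only [C_mul, C_sub, C_pow]
        have : (C (4 : ℝ) : ℝ[X]) = C 2 * C 2 := by rw [← C_mul]; norm_num
        have h2 : (C (2 : ℝ) : ℝ[X]) = 2 := rfl
        rw [this, h2]; ring
      have e2 := congrArg (fun q => ⟪(aeval T q : E →L[ℝ] E) x, x⟫) e
      rw [map_mul (aeval T), map_add (aeval T) (_ * _), map_mul (aeval T), ← hD, aeval_C,
        aeval_C, Algebra.algebraMap_eq_smul_one, Algebra.algebraMap_eq_smul_one] at e2
      simp only [_root_.add_apply, mul_apply_eq_comp, _root_.smul_apply,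
        one_apply_eq_self, inner_add_left, real_inner_smul_left, hDs,
        real_inner_self_eq_norm_sq] at e2
      rw [e2, ← hDs, real_inner_self_eq_norm_sq]
    refine bddBelowOp_of_inner (c := (4 * a * c - b ^ 2) / (4 * |a|))
      (div_pos hdisc.1 (by have := abs_pos.2 hdisc.2; positivity)) fun x => ?_
    have ha := abs_pos.2 hdisc.2
    rw [div_mul_eq_mul_div, div_le_iff₀ (by positivity)]
    have h1 : 4 * |a| * |⟪(aeval T p : E →L[ℝ] E) x, x⟫|
        = |‖D x‖ ^ 2 + (4 * a * c - b ^ 2) * ‖x‖ ^ 2| := by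
      rw [← hid, abs_mul, abs_mul]; norm_num
    rw [mul_comm |⟪_, _⟫|, h1]
    refine le_trans ?_ (le_abs_self _)
    nlinarith [sq_nonneg ‖D x‖]

theorem bddBelowOp_aeval {T : E →L[ℝ] E} (hT : T.IsPositive) (p : ℝ[X])
    (h : ∀ t ∈ Icc 0 ‖T‖, p.eval t ≠ 0) : BddBelowOp (aeval T p) := by
  induction p using WfDvdMonoid.induction_on_irreducible with
  | zero => exact absurd (by simp) (h 0 ⟨le_rfl, norm_nonneg _⟩)
  | unit u hu =>
    obtain ⟨k, hk, rfl⟩ := isUnit_iff.1 hu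
    rw [aeval_C]
    exact bddBelowOp_algebraMap hk.ne_zero
  | mul a i ha hi ih =>
    rw [map_mul]
    refine BddBelowOp.mul (bddBelowOp_aeval_irreducible hT hi fun t ht h0 => h t ht ?_)
      (ih fun t ht h0 => h t ht ?_)
    · rw [eval_mul, h0, zero_mul]
    · rw [eval_mul, h0, mul_zero]

/-- If `N = ‖p(T)‖` exceeded `M`, then `N² - p²` would have no zero on `[0, ‖T‖]`, so `N² - p(T)²`
would be bounded below. This pushes `‖p(T)x‖` uniformly below `N‖x‖`, against the definition of `N`.
-/
theorem norm_aeval_le {T : E →L[ℝ] E} (hT : T.IsPositive) (p : ℝ[X]) {M : ℝ}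
    (h : ∀ t ∈ Icc 0 ‖T‖, |p.eval t| ≤ M) : ‖aeval T p‖ ≤ M := by
  have hM : 0 ≤ M := (abs_nonneg _).trans (h 0 ⟨le_rfl, norm_nonneg _⟩)
  by_contra! hlt
  set S : E →L[ℝ] E := aeval T p with hS
  set N := ‖S‖ with hN
  have hNpos : 0 < N := hM.trans_lt hlt
  have hSs : ∀ x y, ⟪S x, y⟫ = ⟪x, S y⟫ := isSymmetric_aeval hT.isSymmetric _
  obtain ⟨c, hc, hb⟩ := bddBelowOp_aeval hT (C (N ^ 2) - p * p) fun t ht => by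
    have h1 := h t ht
    have h2 : p.eval t * p.eval t ≤ M ^ 2 := by
      rw [← sq, ← sq_abs]; gcongr
    have h3 : M ^ 2 < N ^ 2 := by gcongr
    simp only [eval_sub, eval_C, eval_mul]
    linarith
  have happ : ∀ x, (aeval T (C (N ^ 2) - p * p) : E →L[ℝ] E) x = N ^ 2 • x - S (S x) := by
    intro x
    rw [map_sub, aeval_C, map_mul, Algebra.algebraMap_eq_smul_one]; rfl
  have key : ∀ x, ‖S x‖ ^ 2 ≤ (N ^ 2 - c ^ 2 / (2 * N ^ 2)) * ‖x‖ ^ 2 := by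
    intro x
    have h1 := hb x
    rw [happ] at h1
    have h2 : (c * ‖x‖) ^ 2 ≤ ‖N ^ 2 • x - S (S x)‖ ^ 2 := by gcongr
    rw [norm_sub_sq_real, norm_smul, real_inner_smul_left, ← hSs, real_inner_self_eq_norm_sq] at h2
    have h3 : ‖S (S x)‖ ≤ N * ‖S x‖ := S.le_opNorm _
    have h3' : ‖S (S x)‖ ^ 2 ≤ (N * ‖S x‖) ^ 2 := by gcongr
    have h4 : ‖S x‖ ≤ N * ‖x‖ := S.le_opNorm _
    have h4' : ‖S x‖ ^ 2 ≤ (N * ‖x‖) ^ 2 := by gcongr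
    have h5 : ‖(N ^ 2 : ℝ)‖ = N ^ 2 := by simp
    rw [h5] at h2
    have h6 : N ^ 2 * ‖S x‖ ^ 2 ≤ N ^ 2 * (N * ‖x‖) ^ 2 := by gcongr
    have h7 : c ^ 2 * ‖x‖ ^ 2 ≤ 2 * N ^ 2 * (N ^ 2 * ‖x‖ ^ 2 - ‖S x‖ ^ 2) := by nlinarith
    have h8 : c ^ 2 / (2 * N ^ 2) * ‖x‖ ^ 2 ≤ N ^ 2 * ‖x‖ ^ 2 - ‖S x‖ ^ 2 := by
      rw [div_mul_eq_mul_div, div_le_iff₀ (by positivity)]; linarith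
    linarith
  -- The maximum with `0` keeps the square root meaningful before the sign of the coefficient is
  -- known.
  have hk : N ^ 2 ≤ max 0 (N ^ 2 - c ^ 2 / (2 * N ^ 2)) := by
    have h1 : N ≤ √(max 0 (N ^ 2 - c ^ 2 / (2 * N ^ 2))) := by
      refine S.opNorm_le_bound (Real.sqrt_nonneg _) fun x => ?_
      refine le_of_sq_le_sq ?_ (by positivity)
      rw [mul_pow, Real.sq_sqrt (le_max_left _ _)]
      exact (key x).trans (by gcongr; exact le_max_right _ _)
    calc N ^ 2 ≤ (√(max 0 (N ^ 2 - c ^ 2 / (2 * N ^ 2)))) ^ 2 := by gcongr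
      _ = _ := Real.sq_sqrt (le_max_left _ _)
  have h9 : 0 < c ^ 2 / (2 * N ^ 2) := by positivity
  rcases le_max_iff.1 hk with h | h
  · have : 0 < N ^ 2 := by positivity
    linarith
  · linarith

open Classical in
-- The defining predicates for `f` and `g` coincide, so `opFun` makes the same choice for both.
theorem opFun_congr {T : E →L[ℝ] E} {f g : ℝ → ℝ}
    (h : ∀ t ∈ Icc 0 ‖T‖, f t = g t) : opFun f T = opFun g T := by
  have : ∀ S, IsFunctionOf f T S ↔ IsFunctionOf g T S := fun S => by
    refine forall_congr' fun p => forall_congr' fun ε => imp_congr_left ?_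
    exact forall₂_congr fun t ht => by rw [h t ht]
  have h' : IsFunctionOf f T = IsFunctionOf g T := funext fun S => propext (this S)
  exact congrArg (fun P : (E →L[ℝ] E) → Prop => if h : ∃ S, P S then h.choose else 0) h'

/-! ### Existence and rules of the calculus by polynomial approximation -/

variable [CompleteSpace E]

/-- By `norm_aeval_le`, uniformly close polynomials give close operators, so Weierstrass
approximants form a Cauchy sequence of operators; comparing any other polynomial with them gives the
defining estimate for the limit. -/
theorem exists_isFunctionOf {T : E →L[ℝ] E} (hT : T.IsPositive) {f : ℝ → ℝ}
    (hf : ContinuousOn f (Icc 0 ‖T‖)) : ∃ S, IsFunctionOf f T S := by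
  choose p hp using fun n : ℕ =>
    exists_polynomial_near_of_continuousOn 0 ‖T‖ f hf (1 / ((n : ℝ) + 1)) (by positivity)
  have hlim : Tendsto (fun n : ℕ => 1 / ((n : ℝ) + 1)) atTop (𝓝 0) :=
    tendsto_one_div_add_atTop_nhds_zero_nat
  have hclose : ∀ (q : ℝ[X]) (ε : ℝ) (n : ℕ), (∀ t ∈ Icc 0 ‖T‖, |q.eval t - f t| ≤ ε) →
      ‖aeval T q - aeval T (p n)‖ ≤ ε + 1 / ((n : ℝ) + 1) := by
    intro q ε n hq
    rw [← map_sub]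
    refine norm_aeval_le hT _ fun t ht => ?_
    have h1 := hq t ht
    have h2 := hp n t ht
    rw [eval_sub]
    rw [abs_le] at h1 ⊢
    rw [abs_lt] at h2
    constructor <;> linarith
  have hcau : CauchySeq fun n => (aeval T (p n) : E →L[ℝ] E) := by
    refine cauchySeq_of_le_tendsto_0 (fun N : ℕ => 1 / ((N : ℝ) + 1) + 1 / ((N : ℝ) + 1)) ?_ ?_
    · intro n m N hn hm
      rw [dist_eq_norm]
      refine (hclose (p n) _ m fun t ht => (hp n t ht).le).trans ?_
      gcongr
    · simpa using hlim.add hlim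
  obtain ⟨S, hS⟩ := cauchySeq_tendsto_of_complete hcau
  refine ⟨S, fun q ε hq => ?_⟩
  have h1 : Tendsto (fun n => ‖aeval T q - aeval T (p n)‖) atTop (𝓝 ‖aeval T q - S‖) :=
    (tendsto_const_nhds.sub hS).norm
  have h2 : Tendsto (fun n : ℕ => ε + 1 / ((n : ℝ) + 1)) atTop (𝓝 ε) := by
    simpa using (tendsto_const_nhds (x := ε)).add hlim
  exact le_of_tendsto_of_tendsto' h1 h2 fun n => hclose q ε n hq

theorem isFunctionOf_opFun {T : E →L[ℝ] E} (hT : T.IsPositive) {f : ℝ → ℝ}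
    (hf : ContinuousOn f (Icc 0 ‖T‖)) : IsFunctionOf f T (opFun f T) := by
  have h := exists_isFunctionOf hT hf
  rw [opFun, dif_pos h]
  exact h.choose_spec

theorem exists_aeval_near {T : E →L[ℝ] E} (hT : T.IsPositive) {f : ℝ → ℝ}
    (hf : ContinuousOn f (Icc 0 ‖T‖)) {ε : ℝ} (hε : 0 < ε) :
    ∃ p : ℝ[X], (∀ t ∈ Icc 0 ‖T‖, |p.eval t - f t| ≤ ε) ∧ ‖aeval T p - opFun f T‖ ≤ ε := by
  obtain ⟨p, hp⟩ := exists_polynomial_near_of_continuousOn 0 ‖T‖ f hf ε hε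
  exact ⟨p, fun t ht => (hp t ht).le, isFunctionOf_opFun hT hf p ε fun t ht => (hp t ht).le⟩

/-- The device behind the approximation proofs of identities: `K` must not depend on `ε`, and `ε ≤
1` allows `ε²` to be absorbed into `ε`. -/
theorem eq_of_norm_sub_le {F : Type*} [NormedAddCommGroup F] {a b : F} (K : ℝ)
    (h : ∀ ε, 0 < ε → ε ≤ 1 → ‖a - b‖ ≤ K * ε) : a = b := by
  rw [← sub_eq_zero, ← norm_le_zero_iff]
  have h1 : Tendsto (fun ε : ℝ => K * ε) (𝓝[>] 0) (𝓝 0) := by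
    have : Tendsto (fun ε : ℝ => K * ε) (𝓝 0) (𝓝 (K * 0)) :=
      (continuous_const.mul continuous_id).tendsto 0
    rw [mul_zero] at this
    exact this.mono_left nhdsWithin_le_nhds
  refine ge_of_tendsto h1 ?_
  filter_upwards [Ioc_mem_nhdsGT (zero_lt_one (α := ℝ))] with ε hε
  exact h ε hε.1 hε.2

theorem opFun_eval {T : E →L[ℝ] E} (hT : T.IsPositive) (p : ℝ[X]) :
    opFun (fun t => p.eval t) T = aeval T p := by
  -- A polynomial approximates itself with error `0`.
  have h := isFunctionOf_opFun hT (f := fun t => p.eval t) (by fun_prop) p 0 (by simp)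
  exact (sub_eq_zero.1 (norm_le_zero_iff.1 h)).symm

theorem opFun_id {T : E →L[ℝ] E} (hT : T.IsPositive) : opFun (fun t => t) T = T := by
  simpa using opFun_eval hT X

theorem opFun_const {T : E →L[ℝ] E} (hT : T.IsPositive) (c : ℝ) :
    opFun (fun _ => c) T = c • (1 : E →L[ℝ] E) := by
  simpa [Algebra.algebraMap_eq_smul_one] using opFun_eval hT (C c)

theorem opFun_const_mul_id {T : E →L[ℝ] E} (hT : T.IsPositive) (c : ℝ) :
    opFun (fun t => c * t) T = c • T := by
  have h := opFun_eval hT (C c * X)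
  rw [map_mul, aeval_C, aeval_X, Algebra.algebraMap_eq_smul_one, smul_one_mul] at h
  simpa using h

theorem norm_opFun_le {T : E →L[ℝ] E} (hT : T.IsPositive) {f : ℝ → ℝ}
    (hf : ContinuousOn f (Icc 0 ‖T‖)) {M : ℝ} (h : ∀ t ∈ Icc 0 ‖T‖, |f t| ≤ M) :
    ‖opFun f T‖ ≤ M := by
  -- The zero polynomial approximates `f` with error `M`.
  simpa using isFunctionOf_opFun hT hf 0 M (by simpa using h)

theorem opFun_add {T : E →L[ℝ] E} (hT : T.IsPositive) {f g : ℝ → ℝ}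
    (hf : ContinuousOn f (Icc 0 ‖T‖)) (hg : ContinuousOn g (Icc 0 ‖T‖)) :
    opFun (fun t => f t + g t) T = opFun f T + opFun g T := by
  refine eq_of_norm_sub_le 4 fun ε hε _ => ?_
  obtain ⟨p, hp, hp'⟩ := exists_aeval_near hT hf hε
  obtain ⟨q, hq, hq'⟩ := exists_aeval_near hT hg hε
  have h := isFunctionOf_opFun hT (hf.add hg) (p + q) (2 * ε) fun t ht => by
    have h1 := abs_le.1 (hp t ht)
    have h2 := abs_le.1 (hq t ht)
    rw [eval_add, abs_le]
    simp only [Pi.add_apply]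
    constructor <;> linarith
  rw [map_add] at h
  calc ‖opFun (fun t => f t + g t) T - (opFun f T + opFun g T)‖
      = ‖(aeval T p - opFun f T) + (aeval T q - opFun g T)
          - (aeval T p + aeval T q - opFun (fun t => f t + g t) T)‖ := by congr 1; abel
    _ ≤ ε + ε + 2 * ε := (norm_sub_le _ _).trans (add_le_add ((norm_add_le _ _).trans
        (add_le_add hp' hq')) h)
    _ = 4 * ε := by ring

theorem exists_bound_Icc {f : ℝ → ℝ} {a b : ℝ} (hf : ContinuousOn f (Icc a b)) :
    ∃ K, 0 ≤ K ∧ ∀ t ∈ Icc a b, |f t| ≤ K := by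
  obtain ⟨K, hK⟩ := isCompact_Icc.exists_bound_of_continuousOn hf
  exact ⟨max K 0, le_max_right _ _, fun t ht => (hK t ht).trans (le_max_left _ _)⟩

theorem opFun_mul {T : E →L[ℝ] E} (hT : T.IsPositive) {f g : ℝ → ℝ}
    (hf : ContinuousOn f (Icc 0 ‖T‖)) (hg : ContinuousOn g (Icc 0 ‖T‖)) :
    opFun (fun t => f t * g t) T = opFun f T * opFun g T := by
  obtain ⟨K, hK0, hK⟩ := exists_bound_Icc hf
  obtain ⟨L, hL0, hL⟩ := exists_bound_Icc hg
  have hK' := norm_opFun_le hT hf hK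
  have hL' := norm_opFun_le hT hg hL
  refine eq_of_norm_sub_le (2 * (L + K + 1)) fun ε hε hε1 => ?_
  obtain ⟨p, hp, hp'⟩ := exists_aeval_near hT hf hε
  obtain ⟨q, hq, hq'⟩ := exists_aeval_near hT hg hε
  have h := isFunctionOf_opFun hT (hf.mul hg) (p * q) ((L + K + 1) * ε) fun t ht => by
    have e : (p * q).eval t - f t * g t = (p.eval t - f t) * (q.eval t - g t)
        + (p.eval t - f t) * g t + f t * (q.eval t - g t) := by rw [eval_mul]; ring
    simp only [Pi.mul_apply]
    rw [e]
    refine (abs_add_three _ _ _).trans ?_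
    simp only [abs_mul]
    calc _ ≤ ε * 1 + ε * L + K * ε := by
          gcongr
          · exact hp t ht
          · exact (hq t ht).trans hε1
          · exact hp t ht
          · exact hL t ht
          · exact hK t ht
          · exact hq t ht
      _ = _ := by ring
  rw [map_mul] at h
  have h2 : ‖aeval T p * aeval T q - opFun f T * opFun g T‖ ≤ (L + K + 1) * ε := by
    have e : aeval T p * aeval T q - opFun f T * opFun g T
        = (aeval T p - opFun f T) * (aeval T q - opFun g T)
        + (aeval T p - opFun f T) * opFun g T + opFun f T * (aeval T q - opFun g T) := by
      noncomm_ring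
    rw [e]
    refine (norm_add₃_le).trans ?_
    calc _ ≤ ε * 1 + ε * L + K * ε := by
          gcongr
          · exact (norm_mul_le _ _).trans (by gcongr; exact hq'.trans hε1)
          · exact (norm_mul_le _ _).trans (by gcongr)
          · exact (norm_mul_le _ _).trans (by gcongr)
      _ = _ := by ring
  calc ‖opFun (fun t => f t * g t) T - opFun f T * opFun g T‖
      = ‖(aeval T p * aeval T q - opFun f T * opFun g T)
          - (aeval T p * aeval T q - opFun (fun t => f t * g t) T)‖ := by congr 1; abel
    _ ≤ (L + K + 1) * ε + (L + K + 1) * ε := (norm_sub_le _ _).trans (add_le_add h2 h)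
    _ = _ := by ring

theorem opFun_const_mul {T : E →L[ℝ] E} (hT : T.IsPositive) {f : ℝ → ℝ}
    (hf : ContinuousOn f (Icc 0 ‖T‖)) (c : ℝ) :
    opFun (fun t => c * f t) T = c • opFun f T := by
  rw [opFun_mul hT continuousOn_const hf, opFun_const hT]
  simp

theorem opFun_sub {T : E →L[ℝ] E} (hT : T.IsPositive) {f g : ℝ → ℝ}
    (hf : ContinuousOn f (Icc 0 ‖T‖)) (hg : ContinuousOn g (Icc 0 ‖T‖)) :
    opFun (fun t => f t - g t) T = opFun f T - opFun g T := by
  have h := opFun_add hT hf (g := fun t => -1 * g t) (continuousOn_const.mul hg)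
  have h2 := opFun_const_mul hT hg (-1)
  rw [sub_eq_add_neg, ← neg_one_smul ℝ, ← h2, ← h]
  exact opFun_congr fun t _ => by ring

theorem opFun_mul_comm {T : E →L[ℝ] E} (hT : T.IsPositive) {f g : ℝ → ℝ}
    (hf : ContinuousOn f (Icc 0 ‖T‖)) (hg : ContinuousOn g (Icc 0 ‖T‖)) :
    opFun f T * opFun g T = opFun g T * opFun f T := by
  rw [← opFun_mul hT hf hg, ← opFun_mul hT hg hf]
  exact opFun_congr fun t _ => mul_comm _ _

theorem isSymmetric_opFun {T : E →L[ℝ] E} (hT : T.IsPositive) {f : ℝ → ℝ}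
    (hf : ContinuousOn f (Icc 0 ‖T‖)) : (opFun f T).IsSymmetric := by
  intro x y
  simp only [ContinuousLinearMap.coe_coe]
  refine eq_of_norm_sub_le (2 * ‖x‖ * ‖y‖) fun ε hε _ => ?_
  obtain ⟨p, -, hp⟩ := exists_aeval_near hT hf hε
  have hs : ⟪(aeval T p : E →L[ℝ] E) x, y⟫ = ⟪x, (aeval T p : E →L[ℝ] E) y⟫ :=
    isSymmetric_aeval hT.isSymmetric p x y
  have e : ⟪opFun f T x, y⟫ - ⟪x, opFun f T y⟫
      = ⟪x, (aeval T p - opFun f T) y⟫ - ⟪(aeval T p - opFun f T) x, y⟫ := by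
    rw [_root_.sub_apply, _root_.sub_apply, inner_sub_left, inner_sub_right, hs]; ring
  rw [e]
  calc _ ≤ ‖x‖ * (ε * ‖y‖) + ε * ‖x‖ * ‖y‖ := by
        refine (norm_sub_le _ _).trans (add_le_add ?_ ?_)
        · refine (norm_inner_le_norm _ _).trans ?_
          gcongr
          exact ContinuousLinearMap.le_of_opNorm_le _ hp y
        · refine (norm_inner_le_norm _ _).trans ?_
          gcongr
          exact ContinuousLinearMap.le_of_opNorm_le _ hp x
    _ = _ := by ring

theorem adjoint_opFun {T : E →L[ℝ] E} (hT : T.IsPositive) {f : ℝ → ℝ}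
    (hf : ContinuousOn f (Icc 0 ‖T‖)) :
    ContinuousLinearMap.adjoint (opFun f T) = opFun f T := by
  rw [← ContinuousLinearMap.isSelfAdjoint_iff', ContinuousLinearMap.isSelfAdjoint_iff_isSymmetric]
  exact isSymmetric_opFun hT hf

theorem inner_opFun {T : E →L[ℝ] E} (hT : T.IsPositive) {f : ℝ → ℝ}
    (hf : ContinuousOn f (Icc 0 ‖T‖)) (x y : E) : ⟪opFun f T x, y⟫ = ⟪x, opFun f T y⟫ :=
  isSymmetric_opFun hT hf x y

/-- `f(T)` is the square of the symmetric operator `√f(T)`. Positivity and order in the calculus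
come from here. -/
theorem norm_opFun_sqrt_sq {T : E →L[ℝ] E} (hT : T.IsPositive) {f : ℝ → ℝ}
    (hf : ContinuousOn f (Icc 0 ‖T‖)) (h0 : ∀ t ∈ Icc 0 ‖T‖, 0 ≤ f t) (x : E) :
    ‖opFun (fun t => √(f t)) T x‖ ^ 2 = ⟪opFun f T x, x⟫ := by
  have hs : ContinuousOn (fun t => √(f t)) (Icc 0 ‖T‖) := hf.sqrt
  rw [← real_inner_self_eq_norm_sq, inner_opFun hT hs, ← mul_apply_eq_comp,
    ← opFun_mul hT hs hs, real_inner_comm]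
  rw [opFun_congr fun t ht => Real.mul_self_sqrt (h0 t ht)]

theorem isPositive_opFun {T : E →L[ℝ] E} (hT : T.IsPositive) {f : ℝ → ℝ}
    (hf : ContinuousOn f (Icc 0 ‖T‖)) (h0 : ∀ t ∈ Icc 0 ‖T‖, 0 ≤ f t) :
    (opFun f T).IsPositive := by
  rw [ContinuousLinearMap.isPositive_iff]
  refine ⟨isSymmetric_opFun hT hf, fun x => ?_⟩
  rw [← norm_opFun_sqrt_sq hT hf h0]
  positivity

theorem opFun_mono {T : E →L[ℝ] E} (hT : T.IsPositive) {f g : ℝ → ℝ}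
    (hf : ContinuousOn f (Icc 0 ‖T‖)) (hg : ContinuousOn g (Icc 0 ‖T‖))
    (h : ∀ t ∈ Icc 0 ‖T‖, f t ≤ g t) : opFun f T ≤ opFun g T := by
  rw [ContinuousLinearMap.le_def, ← opFun_sub hT hg hf]
  exact isPositive_opFun hT (hg.sub hf) fun t ht => sub_nonneg.2 (h t ht)

theorem opFun_polynomial_comp {T : E →L[ℝ] E} (hT : T.IsPositive) {g : ℝ → ℝ}
    (hg : ContinuousOn g (Icc 0 ‖T‖)) (p : ℝ[X]) :
    opFun (fun t => p.eval (g t)) T = aeval (opFun g T) p := by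
  have hpow : ∀ n : ℕ, ContinuousOn (fun t => g t ^ n) (Icc 0 ‖T‖) := fun n => hg.pow n
  induction p using Polynomial.induction_on' with
  | add p q hp hq =>
    rw [map_add, ← hp, ← hq, ← opFun_add hT]
    · simp
    · exact p.continuous.comp_continuousOn hg
    · exact q.continuous.comp_continuousOn hg
  | monomial n a =>
    have h : ∀ n : ℕ, opFun (fun t => g t ^ n) T = opFun g T ^ n := by
      intro n
      induction n with
      | zero => simpa using opFun_const hT 1
      | succ n ih =>
        rw [pow_succ, ← ih, ← opFun_mul hT (hpow n) hg]
        rfl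
    rw [aeval_monomial, ← Algebra.smul_def, ← h, ← opFun_const_mul hT (hpow n)]
    simp

theorem opFun_comp {T : E →L[ℝ] E} (hT : T.IsPositive) {f g : ℝ → ℝ}
    (hg : ContinuousOn g (Icc 0 ‖T‖)) (hg0 : ∀ t ∈ Icc 0 ‖T‖, 0 ≤ g t)
    (hf : ContinuousOn f (Ici 0)) :
    opFun f (opFun g T) = opFun (fun t => f (g t)) T := by
  have hgT := isPositive_opFun hT hg hg0
  obtain ⟨K, hK0, hK⟩ := exists_bound_Icc hg
  have hK' := norm_opFun_le hT hg hK
  have hfg : ContinuousOn (fun t => f (g t)) (Icc 0 ‖T‖) := hf.comp hg hg0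
  refine eq_of_norm_sub_le 2 fun ε hε _ => ?_
  -- The interval `[0, K]` contains both the values of `g` and `[0, ‖g(T)‖]`, so one polynomial
  -- serves both sides.
  obtain ⟨p, hp⟩ := exists_polynomial_near_of_continuousOn 0 K f
    (hf.mono Icc_subset_Ici_self) ε hε
  have h1 := isFunctionOf_opFun hgT (f := f) (hf.mono Icc_subset_Ici_self) p ε fun t ht =>
    (hp t ⟨ht.1, ht.2.trans hK'⟩).le
  have h2 : ‖aeval (opFun g T) p - opFun (fun t => f (g t)) T‖ ≤ ε := by
    have hpg : ContinuousOn (fun t => p.eval (g t)) (Icc 0 ‖T‖) := p.continuous.comp_continuousOn hg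
    rw [← opFun_polynomial_comp hT hg, ← opFun_sub hT hpg hfg]
    exact norm_opFun_le hT (hpg.sub hfg) fun t ht =>
      (hp _ ⟨hg0 t ht, (le_abs_self _).trans (hK t ht)⟩).le
  calc _ = ‖(aeval (opFun g T) p - opFun (fun t => f (g t)) T)
        - (aeval (opFun g T) p - opFun f (opFun g T))‖ := by congr 1; abel
    _ ≤ ε + ε := (norm_sub_le _ _).trans (add_le_add h2 h1)
    _ = _ := by ring

theorem opFun_smul {T : E →L[ℝ] E} (hT : T.IsPositive) {f : ℝ → ℝ} {c : ℝ} (hc : 0 ≤ c)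
    (hf : ContinuousOn f (Ici 0)) : opFun f (c • T) = opFun (fun t => f (c * t)) T := by
  rw [← opFun_const_mul_id hT, opFun_comp hT (by fun_prop) (fun t ht => mul_nonneg hc ht.1) hf]

theorem ringInverse_eq_opFun {T : E →L[ℝ] E} (hT : T.IsPositive) {α : ℝ} (hα : 0 < α) :
    Ring.inverse (α • (1 : E →L[ℝ] E) + T) = opFun (fun t => 1 / (α + t)) T := by
  have hc : ContinuousOn (fun t : ℝ => 1 / (α + t)) (Icc 0 ‖T‖) :=
    continuousOn_const.div (by fun_prop) fun t ht => by linarith [ht.1]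
  have hd : ContinuousOn (fun t : ℝ => α + t) (Icc 0 ‖T‖) := by fun_prop
  have e : α • (1 : E →L[ℝ] E) + T = opFun (fun t => α + t) T := by
    rw [opFun_add hT continuousOn_const (by fun_prop), opFun_const hT, opFun_id hT]
  have h1 : opFun (fun t => 1 / (α + t)) T * opFun (fun t => α + t) T = 1 := by
    rw [← opFun_mul hT hc hd, opFun_congr (g := fun _ => 1), opFun_const hT, one_smul]
    intro t ht
    have : α + t ≠ 0 := by linarith [ht.1]
    field_simp
  have h2 : opFun (fun t => α + t) T * opFun (fun t => 1 / (α + t)) T = 1 := by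
    rw [opFun_mul_comm hT hd hc, h1]
  rw [e]
  exact Ring.inverse_unit ⟨_, _, h2, h1⟩

end FunctionalCalculus

/-! ### The inverse function `f₀²` of `Θ²` -/

section InverseFunction

theorem theta_sq {ψ : ℝ → ℝ} {t : ℝ} (ht : 0 ≤ t) : theta ψ t ^ 2 = t * ψ t ^ 2 := by
  rw [theta, mul_pow, Real.sq_sqrt ht]

theorem IsIndexFunction.nonneg {ψ : ℝ → ℝ} (hψ : IsIndexFunction ψ) {t : ℝ} (ht : 0 ≤ t) :
    0 ≤ ψ t := by
  rcases ht.eq_or_lt with rfl | h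
  · rw [hψ.map_zero]
  · exact (hψ.pos t h).le

theorem IsIndexFunction.strictMonoOn_theta_sq {ψ : ℝ → ℝ} (hψ : IsIndexFunction ψ) :
    StrictMonoOn (fun t => theta ψ t ^ 2) (Ici 0) := by
  intro s hs t ht hst
  have hs0 : 0 ≤ s := hs
  have ht0 : 0 < t := hs0.trans_lt hst
  simp only
  rw [theta_sq hs0, theta_sq ht0.le]
  have h1 : ψ s ≤ ψ t := hψ.monotoneOn hs ht hst.le
  have h2 : 0 ≤ ψ s := hψ.nonneg hs0
  have h3 : 0 < ψ t := hψ.pos t ht0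
  calc s * ψ s ^ 2 ≤ s * ψ t ^ 2 := by gcongr
    _ < t * ψ t ^ 2 := by gcongr

theorem IsIndexFunction.continuousOn_theta_sq {ψ : ℝ → ℝ} (hψ : IsIndexFunction ψ) :
    ContinuousOn (fun t => theta ψ t ^ 2) (Ici 0) :=
  (Real.continuous_sqrt.continuousOn.mul hψ.continuousOn).pow 2

theorem IsIndexFunction.surjOn_theta_sq {ψ : ℝ → ℝ} (hψ : IsIndexFunction ψ) :
    SurjOn (fun t => theta ψ t ^ 2) (Ici 0) (Ici 0) := by
  intro s hs
  have hs0 : 0 ≤ s := hs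
  have h1 : 0 < ψ 1 := hψ.pos 1 one_pos
  -- For `b ≥ 1` monotonicity gives `Θ²(b) ≥ b ψ(1)²`, and this `b` makes the right side at least
  -- `s`.
  set b := max 1 (s / ψ 1 ^ 2)
  have hb1 : 1 ≤ b := le_max_left _ _
  have hb : (0 : ℝ) ≤ b := zero_le_one.trans hb1
  have hsb : s ≤ theta ψ b ^ 2 := by
    rw [theta_sq hb]
    have h2 : ψ 1 ≤ ψ b := hψ.monotoneOn (zero_le_one (α := ℝ)) hb hb1
    calc s = s / ψ 1 ^ 2 * ψ 1 ^ 2 := by field_simp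
      _ ≤ b * ψ b ^ 2 := by gcongr; exact le_max_right _ _
  have h0 : theta ψ 0 ^ 2 = 0 := by simp [theta]
  obtain ⟨t, ht, hts⟩ := intermediate_value_Icc hb
    (hψ.continuousOn_theta_sq.mono Icc_subset_Ici_self) (show s ∈ Icc _ _ from ⟨by simpa [h0], hsb⟩)
  exact ⟨t, ht.1, hts⟩

theorem IsIndexFunction.f0Sq_nonneg {ψ : ℝ → ℝ} (hψ : IsIndexFunction ψ) {s : ℝ} (hs : 0 ≤ s) :
    0 ≤ f0Sq ψ s :=
  Function.invFunOn_mem (hψ.surjOn_theta_sq hs)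

theorem IsIndexFunction.theta_f0Sq {ψ : ℝ → ℝ} (hψ : IsIndexFunction ψ) {s : ℝ} (hs : 0 ≤ s) :
    theta ψ (f0Sq ψ s) ^ 2 = s :=
  Function.invFunOn_eq (f := fun t => theta ψ t ^ 2) (hψ.surjOn_theta_sq hs)

theorem IsIndexFunction.f0Sq_theta {ψ : ℝ → ℝ} (hψ : IsIndexFunction ψ) {t : ℝ} (ht : 0 ≤ t) :
    f0Sq ψ (theta ψ t ^ 2) = t :=
  hψ.strictMonoOn_theta_sq.injOn (hψ.f0Sq_nonneg (sq_nonneg _)) ht (hψ.theta_f0Sq (sq_nonneg _))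

/-- `Θ²` is a strictly monotone surjection of `[0, ∞)`, hence an order isomorphism, and the inverse
of an order isomorphism is continuous in the order topology. -/
theorem IsIndexFunction.continuousOn_f0Sq {ψ : ℝ → ℝ} (hψ : IsIndexFunction ψ) :
    ContinuousOn (f0Sq ψ) (Ici 0) := by
  let G : Ici (0 : ℝ) → Ici (0 : ℝ) := fun t => ⟨theta ψ t ^ 2, sq_nonneg (theta ψ t)⟩
  have hmono : StrictMono G := fun s t h => hψ.strictMonoOn_theta_sq s.2 t.2 h
  have hsurj : Function.Surjective G := fun s => by
    obtain ⟨t, ht, hts⟩ := hψ.surjOn_theta_sq s.2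
    exact ⟨⟨t, ht⟩, Subtype.ext hts⟩
  let e := hmono.orderIsoOfSurjective G hsurj
  rw [continuousOn_iff_continuous_domRestrict]
  have h : (Ici (0 : ℝ)).domRestrict (f0Sq ψ) = fun s => ((e.symm s : Ici (0 : ℝ)) : ℝ) := by
    funext s
    obtain ⟨t, rfl⟩ := e.surjective s
    rw [e.symm_apply_apply]
    exact hψ.f0Sq_theta t.2
  rw [h]
  exact continuous_subtype_val.comp e.symm.continuous

/-- Since `ψ` is non-decreasing, `Θ²(c t) ≤ c Θ²(t)` for `c ≤ 1`; inverting reverses the inequality.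
This is what lets the link constant be pulled out of `f₀²`, and the reason for `m ≤ 1`. -/
theorem IsIndexFunction.mul_f0Sq_le {ψ : ℝ → ℝ} (hψ : IsIndexFunction ψ) {c s : ℝ} (hc : 0 ≤ c)
    (hc1 : c ≤ 1) (hs : 0 ≤ s) : c * f0Sq ψ s ≤ f0Sq ψ (c * s) := by
  have h0 := hψ.f0Sq_nonneg hs
  have hcs := mul_nonneg hc hs
  have hc0 := mul_nonneg hc h0
  rw [← hψ.strictMonoOn_theta_sq.le_iff_le hc0 (hψ.f0Sq_nonneg hcs)]
  rw [hψ.theta_f0Sq hcs, theta_sq hc0]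
  have hle : c * f0Sq ψ s ≤ f0Sq ψ s := mul_le_of_le_one_left h0 hc1
  have h1 : ψ (c * f0Sq ψ s) ≤ ψ (f0Sq ψ s) := hψ.monotoneOn hc0 h0 hle
  have h2 := hψ.nonneg hc0
  have h3 := hψ.theta_f0Sq hs
  rw [theta_sq h0] at h3
  calc c * f0Sq ψ s * ψ (c * f0Sq ψ s) ^ 2 ≤ c * f0Sq ψ s * ψ (f0Sq ψ s) ^ 2 := by gcongr
    _ = c * s := by rw [mul_assoc, h3]

end InverseFunction

/-! ### Operator monotonicity -/

section OperatorMonotone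

open Filter Topology

variable {E : Type*} [NormedAddCommGroup E] [InnerProductSpace ℝ E]

theorem opLe_iff {S T : E →L[ℝ] E} (hS : S.IsSymmetric) (hT : T.IsSymmetric) :
    S ≤ T ↔ ∀ x, ⟪S x, x⟫ ≤ ⟪T x, x⟫ := by
  rw [ContinuousLinearMap.le_def, ContinuousLinearMap.isPositive_iff]
  have hs : (T - S).IsSymmetric := fun x y => by
    have h1 := hS x y
    have h2 := hT x y
    simp only [ContinuousLinearMap.coe_coe, _root_.sub_apply] at h1 h2 ⊢
    rw [inner_sub_left, inner_sub_right, h1, h2]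
  rw [and_iff_right hs]
  simp [inner_sub_left]

theorem inner_le_of_opLe {S T : E →L[ℝ] E} (h : S ≤ T) (x : E) : ⟪S x, x⟫ ≤ ⟪T x, x⟫ := by
  have := ContinuousLinearMap.IsPositive.inner_nonneg_left h x
  rw [_root_.sub_apply, inner_sub_left] at this
  linarith

theorem isPositive_smul {S : E →L[ℝ] E} (hS : S.IsPositive) {c : ℝ} (hc : 0 ≤ c) :
    (c • S).IsPositive := hS.smul_of_nonneg hc

/-- Averaging with `S` halves the weight of `T`, so midpoint concavity iterates to the weights
`2⁻ⁿ`, which suffice for the limit in `IsOperatorConcave.monotone`. -/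
theorem IsOperatorConcave.le_opFun_pow {f : ℝ → ℝ} (hf : IsOperatorConcave E f)
    {S T : E →L[ℝ] E} (hS : S.IsPositive) (hT : T.IsPositive) (n : ℕ) (x : E) :
    (1 - (1 / 2 : ℝ) ^ n) * ⟪opFun f S x, x⟫ + (1 / 2 : ℝ) ^ n * ⟪opFun f T x, x⟫
      ≤ ⟪opFun f ((1 - (1 / 2 : ℝ) ^ n) • S + (1 / 2 : ℝ) ^ n • T) x, x⟫ := by
  induction n with
  | zero => simp
  | succ n ih =>
    have hn : (1 / 2 : ℝ) ^ n ≤ 1 := pow_le_one₀ (by norm_num) (by norm_num)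
    have hpos : ((1 - (1 / 2 : ℝ) ^ n) • S + (1 / 2 : ℝ) ^ n • T).IsPositive :=
      (isPositive_smul hS (by linarith)).add (isPositive_smul hT (by positivity))
    have h := inner_le_of_opLe (hf S _ hS hpos) x
    have e : (1 / 2 : ℝ) • (S + ((1 - (1 / 2 : ℝ) ^ n) • S + (1 / 2 : ℝ) ^ n • T))
        = (1 - (1 / 2 : ℝ) ^ (n + 1)) • S + (1 / 2 : ℝ) ^ (n + 1) • T := by
      rw [pow_succ]; module
    rw [e] at h
    refine le_trans ?_ h
    simp only [_root_.smul_apply, _root_.add_apply, real_inner_smul_left, inner_add_left]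
    rw [pow_succ]
    linarith

theorem isIndexFunction_sqrt : IsIndexFunction Real.sqrt where
  continuousOn := Real.continuous_sqrt.continuousOn
  monotoneOn := fun _ _ _ _ h => Real.sqrt_le_sqrt h
  map_zero := Real.sqrt_zero
  pos := fun _ => Real.sqrt_pos.2

/-- For `ψ = √` one has `Θ²(t) = t²` on `[0, ∞)`. -/
theorem f0Sq_sqrt {s : ℝ} (hs : 0 ≤ s) : f0Sq Real.sqrt s = √s := by
  have h := isIndexFunction_sqrt.f0Sq_theta (Real.sqrt_nonneg s)
  rwa [theta_sq (Real.sqrt_nonneg s), Real.sq_sqrt (Real.sqrt_nonneg s), Real.mul_self_sqrt hs] at h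

theorem opFun_f0Sq_sqrt (T : E →L[ℝ] E) : opFun (f0Sq Real.sqrt) T = opFun Real.sqrt T :=
  opFun_congr fun _ ht => f0Sq_sqrt ht.1

theorem continuousOn_sqrt {s : Set ℝ} : ContinuousOn Real.sqrt s :=
  Real.continuous_sqrt.continuousOn

variable [CompleteSpace E]

theorem tendsto_opFun_smul {T : E →L[ℝ] E} (hT : T.IsPositive) {f : ℝ → ℝ}
    (hf : ContinuousOn f (Ici 0)) {l : ℕ → ℝ} (hl : ∀ n, l n ∈ Icc (0 : ℝ) 1)
    (hl1 : Tendsto l atTop (𝓝 1)) :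
    Tendsto (fun n => opFun f (l n • T)) atTop (𝓝 (opFun f T)) := by
  have huc : UniformContinuousOn f (Icc 0 ‖T‖) :=
    isCompact_Icc.uniformContinuousOn_of_continuous (hf.mono Icc_subset_Ici_self)
  rw [Metric.uniformContinuousOn_iff] at huc
  rw [Metric.tendsto_atTop]
  intro ε hε
  obtain ⟨δ, hδ, h⟩ := huc (ε / 2) (by positivity)
  have h2 : Tendsto (fun n => (1 - l n) * ‖T‖) atTop (𝓝 0) := by
    have := (tendsto_const_nhds (x := (1 : ℝ))).sub hl1 |>.mul_const ‖T‖
    simpa using this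
  obtain ⟨N, hN⟩ := (Filter.eventually_atTop.1 (h2.eventually_lt_const hδ))
  refine ⟨N, fun n hn => ?_⟩
  have h0 : ∀ t ∈ Icc 0 ‖T‖, l n * t ∈ Icc 0 ‖T‖ := fun t ht =>
    ⟨mul_nonneg (hl n).1 ht.1, (mul_le_of_le_one_left ht.1 (hl n).2).trans ht.2⟩
  have hfc : ContinuousOn f (Icc 0 ‖T‖) := hf.mono Icc_subset_Ici_self
  have hc : ContinuousOn (fun t => f (l n * t)) (Icc 0 ‖T‖) := hfc.comp (by fun_prop) h0
  rw [dist_eq_norm, opFun_smul hT (hl n).1 hf, ← opFun_sub hT hc hfc]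
  refine (norm_opFun_le hT (hc.sub hfc) (M := ε / 2) fun t ht => ?_).trans_lt (by linarith)
  refine (h _ (h0 t ht) t ht ?_).le
  rw [Real.dist_eq, abs_sub_comm, abs_of_nonneg (by nlinarith [(hl n).2, ht.1])]
  refine lt_of_le_of_lt ?_ (hN n hn)
  have := (hl n).2
  calc t - l n * t = (1 - l n) * t := by ring
    _ ≤ _ := by exact mul_le_mul_of_nonneg_left ht.2 (by linarith)

/-- A non-negative operator concave function is operator monotone. -/
theorem IsOperatorConcave.monotone {f : ℝ → ℝ} (hf : IsOperatorConcave E f)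
    (hfc : ContinuousOn f (Ici 0)) (hf0 : ∀ t, 0 ≤ t → 0 ≤ f t) {S T : E →L[ℝ] E}
    (hS : S.IsPositive) (hT : T.IsPositive) (hST : S ≤ T) (x : E) :
    ⟪opFun f S x, x⟫ ≤ ⟪opFun f T x, x⟫ := by
  have hr : Tendsto (fun n : ℕ => 1 - (1 / 2 : ℝ) ^ n) atTop (𝓝 1) := by
    simpa using (tendsto_const_nhds (x := (1 : ℝ))).sub
      (tendsto_pow_atTop_nhds_zero_of_lt_one (r := (1 / 2 : ℝ)) (by norm_num) (by norm_num))
  have hr01 : ∀ n : ℕ, 1 - (1 / 2 : ℝ) ^ n ∈ Icc (0 : ℝ) 1 := fun n => by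
    have h1 : (1 / 2 : ℝ) ^ n ≤ 1 := pow_le_one₀ (by norm_num) (by norm_num)
    have h2 : 0 ≤ (1 / 2 : ℝ) ^ n := by positivity
    constructor <;> linarith
  have h1 : Tendsto (fun n : ℕ => ⟪opFun f ((1 - (1 / 2 : ℝ) ^ n) • T) x, x⟫) atTop
      (𝓝 ⟪opFun f T x, x⟫) :=
    (((ContinuousLinearMap.apply ℝ E x).continuous.tendsto _).comp
      (tendsto_opFun_smul hT hfc hr01 hr)).inner tendsto_const_nhds
  have h2 : Tendsto (fun n : ℕ => (1 - (1 / 2 : ℝ) ^ n) * ⟪opFun f S x, x⟫) atTop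
      (𝓝 ⟪opFun f S x, x⟫) := by
    simpa using hr.mul_const ⟪opFun f S x, x⟫
  refine le_of_tendsto_of_tendsto' h2 h1 fun n => ?_
  have hn := hr01 n
  -- With `r = 2⁻ⁿ` this operator `R` is scaled so that `(1 - r) S + r R = (1 - r) T`. Concavity and
  -- `f(R) ≥ 0` then give `(1 - r) f(S) ≤ f((1 - r) T)`, and `n → ∞` finishes.
  have hR : (((2 : ℝ) ^ n * (1 - (1 / 2 : ℝ) ^ n)) • (T - S)).IsPositive :=
    isPositive_smul hST (mul_nonneg (by positivity) hn.1)
  have h3 := hf.le_opFun_pow hS hR n x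
  have e : (1 - (1 / 2 : ℝ) ^ n) • S
      + (1 / 2 : ℝ) ^ n • (((2 : ℝ) ^ n * (1 - (1 / 2 : ℝ) ^ n)) • (T - S))
      = (1 - (1 / 2 : ℝ) ^ n) • T := by
    rw [smul_smul, ← mul_assoc, ← mul_pow]
    norm_num
    module
  rw [e] at h3
  refine le_trans ?_ h3
  have h4 : 0 ≤ ⟪opFun f (((2 : ℝ) ^ n * (1 - (1 / 2 : ℝ) ^ n)) • (T - S)) x, x⟫ :=
    (isPositive_opFun hR (hfc.mono Icc_subset_Ici_self) fun t ht => hf0 t ht.1).inner_nonneg_left x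
  have : 0 ≤ (1 / 2 : ℝ) ^ n := by positivity
  nlinarith [mul_nonneg this h4]

theorem norm_sq_le_norm_mul_inner {N : E →L[ℝ] E} (hN : N.IsPositive) (x : E) :
    ‖N x‖ ^ 2 ≤ ‖N‖ * ⟪N x, x⟫ := by
  have h1 : opFun (fun t => t * t) N ≤ opFun (fun t => ‖N‖ * t) N :=
    opFun_mono hN (by fun_prop) (by fun_prop) fun t ht => mul_le_mul_of_nonneg_right ht.2 ht.1
  have h2 := inner_le_of_opLe h1 x
  rw [opFun_mul hN (by fun_prop) (by fun_prop), opFun_const_mul_id hN, opFun_id hN,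
    mul_apply_eq_comp, _root_.smul_apply, real_inner_smul_left] at h2
  rwa [← real_inner_self_eq_norm_sq, ← hN.inner_left_eq_inner_right]

/-- Otherwise, expanding `‖N x - ‖N‖ x‖²` and using `‖N x‖² ≤ ‖N‖ ⟪N x, x⟫` gives `‖N x‖² ≤ (‖N‖² -
ε²) ‖x‖²` for all `x`, too small for the norm of `N`. -/
theorem exists_approx_eigenvector {N : E →L[ℝ] E} (hN : N.IsPositive) (hN0 : 0 < ‖N‖) {ε : ℝ}
    (hε : 0 < ε) : ∃ x, x ≠ 0 ∧ ‖N x - ‖N‖ • x‖ ≤ ε * ‖x‖ := by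
  by_contra! hcon
  have key : ∀ x, ‖N x‖ ^ 2 ≤ (‖N‖ ^ 2 - ε ^ 2) * ‖x‖ ^ 2 := by
    intro x
    by_cases hx : x = 0
    · simp [hx]
    · have h1 : (ε * ‖x‖) ^ 2 ≤ ‖N x - ‖N‖ • x‖ ^ 2 := by
        have := hcon x hx
        gcongr
      rw [norm_sub_sq_real, norm_smul, real_inner_smul_right, norm_norm] at h1
      have := norm_sq_le_norm_mul_inner hN x
      nlinarith
  have hk : ‖N‖ ^ 2 ≤ max 0 (‖N‖ ^ 2 - ε ^ 2) := by
    have h1 : ‖N‖ ≤ √(max 0 (‖N‖ ^ 2 - ε ^ 2)) := by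
      refine N.opNorm_le_bound (Real.sqrt_nonneg _) fun x => ?_
      refine le_of_sq_le_sq ?_ (by positivity)
      rw [mul_pow, Real.sq_sqrt (le_max_left _ _)]
      exact (key x).trans (by gcongr; exact le_max_right _ _)
    calc ‖N‖ ^ 2 ≤ (√(max 0 (‖N‖ ^ 2 - ε ^ 2))) ^ 2 := by gcongr
      _ = _ := Real.sq_sqrt (le_max_left _ _)
  have h9 : 0 < ε ^ 2 := by positivity
  have h10 : 0 < ‖N‖ ^ 2 := by positivity
  rcases le_max_iff.1 hk with h | h <;> linarith

/-- The square root is operator monotone. -/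
theorem inner_le_of_norm_le {A B : E →L[ℝ] E} (hA : A.IsPositive) (hB : B.IsPositive)
    (h : ∀ x, ‖A x‖ ≤ ‖B x‖) (x : E) : ⟪A x, x⟫ ≤ ⟪B x, x⟫ := by
  set D := B - A with hD
  have hDap : ∀ y, D y = B y - A y := fun y => rfl
  -- If `‖N‖ ≤ ‖D‖`, then `D ≥ 0`, which is the claim. Otherwise `-l`, with `l = ‖N‖ - ‖D‖ > 0`, is
  -- an approximate eigenvalue of `D = B - A`.
  set N := ‖D‖ • (1 : E →L[ℝ] E) - D with hN
  have hNap : ∀ y, N y = ‖D‖ • y - D y := fun y => rfl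
  have hNpos : N.IsPositive := by
    rw [ContinuousLinearMap.isPositive_iff]
    refine ⟨fun y z => ?_, fun y => ?_⟩
    · simp only [ContinuousLinearMap.coe_coe, hNap, hDap, inner_sub_left, inner_sub_right,
        real_inner_smul_left, real_inner_smul_right, hA.inner_left_eq_inner_right,
        hB.inner_left_eq_inner_right]
    · rw [hNap, inner_sub_left, real_inner_smul_left, real_inner_self_eq_norm_sq]
      linarith [inner_le_norm_mul_sq D y]
  by_cases hle : ‖N‖ ≤ ‖D‖
  · have h1 := inner_le_norm_mul_sq N x
    rw [hNap, hDap, inner_sub_left, inner_sub_left, real_inner_smul_left,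
      real_inner_self_eq_norm_sq] at h1
    nlinarith [mul_le_mul_of_nonneg_right hle (sq_nonneg ‖x‖)]
  exfalso
  push Not at hle
  set l := ‖N‖ - ‖D‖ with hl
  have hl0 : 0 < l := sub_pos.2 hle
  set K := ‖A + B‖ with hK
  have hK0 : 0 ≤ K := norm_nonneg _
  -- At the approximate eigenvector `y`, the identity `‖B y‖² - ‖A y‖² = ⟪D y, (A + B) y⟫` and the
  -- hypothesis bound `l ⟪(A + B) y, y⟫` by `ε K ‖y‖²`, while that inner product is at least `(l -
  -- ε) ‖y‖²`. Hence `l² ≤ ε (l + K)`, and this `ε` makes the right side `l² / 2`.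
  set ε := l ^ 2 / (2 * (l + K)) with hε
  have hlK : 0 < l + K := by linarith
  have hε0 : 0 < ε := by positivity
  obtain ⟨y, hy, hy'⟩ := exists_approx_eigenvector hNpos ((norm_nonneg D).trans_lt hle) hε0
  set r := D y + l • y with hr
  have hrn : ‖r‖ ≤ ε * ‖y‖ := by
    have : r = -(N y - ‖N‖ • y) := by rw [hNap, hr, hl]; module
    rw [this, norm_neg]; exact hy'
  have hy0 : 0 < ‖y‖ ^ 2 := by have := norm_pos_iff.2 hy; positivity
  have hAy := hA.inner_nonneg_left y
  have hBy := hB.inner_nonneg_left y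
  have e1 : D y = r - l • y := by rw [hr]; abel
  have e2 : ‖B y‖ ^ 2 - ‖A y‖ ^ 2 = ⟪r, (A + B) y⟫ - l * (⟪A y, y⟫ + ⟪B y, y⟫) := by
    have : ⟪D y, (A + B) y⟫ = ‖B y‖ ^ 2 - ‖A y‖ ^ 2 := by
      rw [hDap, _root_.add_apply, inner_sub_left, inner_add_right, inner_add_right,
        real_inner_self_eq_norm_sq, real_inner_self_eq_norm_sq, real_inner_comm (A y) (B y)]
      ring
    rw [← this, e1, inner_sub_left, real_inner_smul_left, _root_.add_apply, inner_add_right y,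
      real_inner_comm (A y) y, real_inner_comm (B y) y]
  have e3 : ‖A y‖ ^ 2 ≤ ‖B y‖ ^ 2 := by have := h y; gcongr
  have e4 : ⟪r, (A + B) y⟫ ≤ ε * K * ‖y‖ ^ 2 := by
    calc ⟪r, (A + B) y⟫ ≤ ‖r‖ * ‖(A + B) y‖ := real_inner_le_norm _ _
      _ ≤ (ε * ‖y‖) * (K * ‖y‖) := by gcongr; exact (A + B).le_opNorm y
      _ = _ := by ring
  have e5 : ⟪B y, y⟫ - ⟪A y, y⟫ = ⟪r, y⟫ - l * ‖y‖ ^ 2 := by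
    rw [← inner_sub_left, ← hDap, e1, inner_sub_left, real_inner_smul_left,
      real_inner_self_eq_norm_sq]
  have e6 : ⟪r, y⟫ ≤ ε * ‖y‖ ^ 2 := by
    calc ⟪r, y⟫ ≤ ‖r‖ * ‖y‖ := real_inner_le_norm _ _
      _ ≤ (ε * ‖y‖) * ‖y‖ := by gcongr
      _ = _ := by ring
  have e7 : l * (l * ‖y‖ ^ 2) ≤ (ε * (l + K)) * ‖y‖ ^ 2 := by nlinarith
  have e8 : ε * (l + K) = l ^ 2 / 2 := by rw [hε]; field_simp
  rw [e8] at e7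
  nlinarith [mul_pos (pow_pos hl0 2) hy0]

theorem isPositive_opFun_sqrt {T : E →L[ℝ] E} (hT : T.IsPositive) :
    (opFun Real.sqrt T).IsPositive :=
  isPositive_opFun hT continuousOn_sqrt fun _ _ => Real.sqrt_nonneg _

theorem norm_opFun_sqrt_apply_sq {T : E →L[ℝ] E} (hT : T.IsPositive) (x : E) :
    ‖opFun Real.sqrt T x‖ ^ 2 = ⟪T x, x⟫ := by
  have h := norm_opFun_sqrt_sq hT (f := fun t => t) (by fun_prop) (fun t ht => ht.1) x
  rwa [opFun_id hT] at h

/-- The square root is operator concave. -/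
theorem isOperatorConcave_f0Sq_sqrt (E : Type*) [NormedAddCommGroup E] [InnerProductSpace ℝ E]
    [CompleteSpace E] : IsOperatorConcave E (f0Sq Real.sqrt) := by
  intro S T hS hT
  simp only [opFun_f0Sq_sqrt]
  have hST : ((1 / 2 : ℝ) • (S + T)).IsPositive := isPositive_smul (hS.add hT) (by norm_num)
  have hP : ((1 / 2 : ℝ) • (opFun Real.sqrt S + opFun Real.sqrt T)).IsPositive :=
    isPositive_smul ((isPositive_opFun_sqrt hS).add (isPositive_opFun_sqrt hT)) (by norm_num)
  rw [opLe_iff hP.isSymmetric (isPositive_opFun_sqrt hST).isSymmetric]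
  -- Square-root monotonicity reduces the claim to norms, where it is the parallelogram law with the
  -- term `‖√S x - √T x‖²` dropped.
  refine inner_le_of_norm_le hP (isPositive_opFun_sqrt hST) fun x => ?_
  refine le_of_sq_le_sq ?_ (norm_nonneg _)
  rw [norm_opFun_sqrt_apply_sq hST]
  simp only [_root_.smul_apply, _root_.add_apply, real_inner_smul_left, inner_add_left]
  rw [← norm_opFun_sqrt_apply_sq hS, ← norm_opFun_sqrt_apply_sq hT, norm_smul, mul_pow]
  have h := parallelogram_law_with_norm ℝ (opFun Real.sqrt S x) (opFun Real.sqrt T x)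
  norm_num
  nlinarith [sq_nonneg ‖opFun Real.sqrt S x - opFun Real.sqrt T x‖]

end OperatorMonotone

/-! ### The link estimate and the preconditioned operator -/

section Link

variable {X Y : Type*} [NormedAddCommGroup X] [InnerProductSpace ℝ X] [CompleteSpace X]
  [NormedAddCommGroup Y] [InnerProductSpace ℝ Y] [CompleteSpace Y]

theorem isPositive_hessOp (G : X →L[ℝ] Y) (C₀ : X →L[ℝ] X) : (hessOp G C₀).IsPositive :=
  ContinuousLinearMap.isPositive_adjoint_comp_self _

/-- The central inequality `m² C₀ ≤ f₀²(m² Θ²(C₀)) ≤ f₀²(H)`: the first step is scalar, by the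
calculus of `C₀`, and the second is operator monotonicity of `f₀²`. -/
theorem inner_le_inner_opFun_f0Sq (G : X →L[ℝ] Y) {C₀ : X →L[ℝ] X} (hC : C₀.IsPositive)
    {ψ : ℝ → ℝ} (hψ : IsIndexFunction ψ) (hconc : IsOperatorConcave X (f0Sq ψ)) {m : ℝ}
    (hm : 0 < m) (hm1 : m ≤ 1) (hlink : ∀ x, m * ‖opFun ψ C₀ x‖ ≤ ‖G x‖) (x : X) :
    m ^ 2 * ⟪C₀ x, x⟫ ≤ ⟪opFun (f0Sq ψ) (hessOp G C₀) x, x⟫ := by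
  have hψc : ContinuousOn ψ (Icc 0 ‖C₀‖) := hψ.continuousOn.mono Icc_subset_Ici_self
  have hθ : ContinuousOn (theta ψ) (Icc 0 ‖C₀‖) := continuousOn_sqrt.mul hψc
  have hθ2 : ContinuousOn (fun t => theta ψ t ^ 2) (Icc 0 ‖C₀‖) := hθ.pow 2
  have hg : ContinuousOn (fun t => m ^ 2 * theta ψ t ^ 2) (Icc 0 ‖C₀‖) :=
    continuousOn_const.mul hθ2
  have hg0 : ∀ t ∈ Icc 0 ‖C₀‖, 0 ≤ m ^ 2 * theta ψ t ^ 2 := fun t _ => by positivity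
  have hS : (opFun (fun t => m ^ 2 * theta ψ t ^ 2) C₀).IsPositive := isPositive_opFun hC hg hg0
  -- The link bound is evaluated at `C₀^{1/2} y`, where `ψ(C₀) C₀^{1/2} = Θ(C₀)`.
  have hle : opFun (fun t => m ^ 2 * theta ψ t ^ 2) C₀ ≤ hessOp G C₀ := by
    rw [opLe_iff hS.isSymmetric (isPositive_hessOp G C₀).isSymmetric]
    intro y
    have h1 : ⟪hessOp G C₀ y, y⟫ = ‖G (opFun Real.sqrt C₀ y)‖ ^ 2 := by
      rw [hessOp, ContinuousLinearMap.comp_apply, ContinuousLinearMap.adjoint_inner_left,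
        real_inner_self_eq_norm_sq]
      rfl
    have h2 : opFun ψ C₀ (opFun Real.sqrt C₀ y) = opFun (theta ψ) C₀ y := by
      rw [← mul_apply_eq_comp, opFun_mul_comm hC hψc continuousOn_sqrt,
        ← opFun_mul hC continuousOn_sqrt hψc]
      rfl
    have h3 : ⟪opFun (fun t => theta ψ t ^ 2) C₀ y, y⟫ = ‖opFun (theta ψ) C₀ y‖ ^ 2 := by
      have : opFun (fun t => theta ψ t ^ 2) C₀ = opFun (theta ψ) C₀ * opFun (theta ψ) C₀ := by
        rw [← opFun_mul hC hθ hθ]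
        exact opFun_congr fun t _ => sq _
      rw [this, mul_apply_eq_comp, inner_opFun hC hθ, real_inner_self_eq_norm_sq]
    rw [h1, opFun_const_mul hC hθ2, _root_.smul_apply, real_inner_smul_left, h3, ← h2, ← mul_pow]
    have := hlink (opFun Real.sqrt C₀ y)
    gcongr
  refine le_trans ?_ (hconc.monotone hψ.continuousOn_f0Sq (fun t => hψ.f0Sq_nonneg) hS
    (isPositive_hessOp G C₀) hle x)
  rw [opFun_comp hC hg hg0 hψ.continuousOn_f0Sq]
  have h4 : opFun (fun t => m ^ 2 * t) C₀ ≤ opFun (fun t => f0Sq ψ (m ^ 2 * theta ψ t ^ 2)) C₀ := by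
    refine opFun_mono hC (by fun_prop) (hψ.continuousOn_f0Sq.comp hg hg0) fun t ht => ?_
    have h5 := hψ.mul_f0Sq_le (c := m ^ 2) (by positivity) (pow_le_one₀ hm.le hm1)
      (sq_nonneg (theta ψ t))
    rwa [hψ.f0Sq_theta ht.1] at h5
  have h6 := inner_le_of_opLe h4 x
  rwa [opFun_const_mul_id hC, _root_.smul_apply, real_inner_smul_left] at h6

end Link

/-! ### Traces and Gaussian second moments -/

section Trace

open ProbabilityTheory

variable {X : Type*} [NormedAddCommGroup X] [InnerProductSpace ℝ X]

theorem ofReal_norm_sq_eq_tsum {ι : Type*} (b : HilbertBasis ι ℝ X) (x : X) :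
    ENNReal.ofReal (‖x‖ ^ 2) = ∑' i, ENNReal.ofReal (⟪x, b i⟫ ^ 2) := by
  have h := b.hasSum_inner_mul_inner x x
  have h' : HasSum (fun i => ⟪x, b i⟫ ^ 2) (‖x‖ ^ 2) := by
    rw [← real_inner_self_eq_norm_sq]
    have e : (fun i => ⟪x, b i⟫ ^ 2) = fun i => ⟪x, b i⟫ * ⟪b i, x⟫ :=
      funext fun i => by rw [sq, real_inner_comm x (b i)]
    rwa [e]
  rw [← h'.tsum_eq, ENNReal.ofReal_tsum_of_nonneg (fun i => sq_nonneg _) h'.summable]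

/-- Basis vectors are `√2` apart, so the balls of radius `1/2` are disjoint. Countability is needed
to exchange the sum over the basis with the integral. -/
theorem countable_hilbertBasis [TopologicalSpace.SeparableSpace X] {ι : Type*}
    (b : HilbertBasis ι ℝ X) : Countable ι := by
  have h : Pairwise (Function.onFun Disjoint fun i => Metric.ball (b i) (1 / 2)) := by
    intro i j hij
    refine Metric.ball_disjoint_ball ?_
    have h1 : ‖b i - b j‖ ^ 2 = 2 := by
      rw [norm_sub_sq_real, b.orthonormal.1 i, b.orthonormal.1 j, b.orthonormal.2 hij]; norm_num
    rw [dist_eq_norm]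
    nlinarith [norm_nonneg (b i - b j)]
  have h2 : (univ : Set ι).Countable :=
    Set.PairwiseDisjoint.countable_of_isOpen (pairwise_univ.2 h) (fun i _ => Metric.isOpen_ball)
      (fun i _ => Metric.nonempty_ball.2 (by norm_num))
  exact countable_univ_iff.1 h2

theorem lintegral_sq_gaussian {S : Type*} [MeasurableSpace S] {P : Measure S} {ξ : S → ℝ} {v : ℝ≥0}
    (h : HasLaw ξ (gaussianReal 0 v) P) (a c : ℝ) :
    ∫⁻ τ, ENNReal.ofReal ((a - c * ξ τ) ^ 2) ∂P
      = ENNReal.ofReal (a ^ 2) + ENNReal.ofReal (c ^ 2 * v) := by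
  rw [h.lintegral_comp (f := fun t => ENNReal.ofReal ((a - c * t) ^ 2)) (by fun_prop)]
  have hL : MemLp id 2 (gaussianReal 0 v) := memLp_id_gaussianReal 2
  have h1 : Integrable (fun t : ℝ => t) (gaussianReal 0 v) := hL.integrable (by norm_num)
  have h2 : Integrable (fun t : ℝ => t ^ 2) (gaussianReal 0 v) := hL.integrable_sq
  have hv : ∫ t, t ^ 2 ∂(gaussianReal 0 v) = v := by
    have h3 := variance_id_gaussianReal (μ := 0) (v := v)
    rw [variance_of_integral_eq_zero aemeasurable_id (by simp)] at h3
    exact h3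
  have he : ∀ t : ℝ, (a - c * t) ^ 2 = a ^ 2 + (-2 * a * c) * t + c ^ 2 * t ^ 2 := fun t => by ring
  simp only [he]
  have hi1 := h1.const_mul (-2 * a * c)
  have hi2 := h2.const_mul (c ^ 2)
  have hi0 : Integrable (fun _ : ℝ => a ^ 2) (gaussianReal 0 v) := integrable_const _
  have hi01 : Integrable (fun t : ℝ => a ^ 2 + (-2 * a * c) * t) (gaussianReal 0 v) := hi0.add hi1
  have hi : Integrable (fun t : ℝ => a ^ 2 + (-2 * a * c) * t + c ^ 2 * t ^ 2)
      (gaussianReal 0 v) := hi01.add hi2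
  rw [← ofReal_integral_eq_lintegral_ofReal hi
    (Filter.Eventually.of_forall fun t => (sq_nonneg (a - c * t)).trans_eq (he t))]
  rw [integral_add hi01 hi2, integral_add hi0 hi1, integral_const_mul, integral_const_mul,
    hv, integral_id_gaussianReal, ← ENNReal.ofReal_add (by positivity) (by positivity)]
  simp

/-- By Parseval only second moments of the coordinates enter, so no joint law is required. It is
applied to the posterior mean (`c = δ`) and to the centered posterior (`z = 0`, `c = 1`). -/
theorem lintegral_enorm_sub_sq {S : Type*} [MeasurableSpace S] {P : Measure S}
    {ι : Type*} [Countable ι] (b : HilbertBasis ι ℝ X) {N : S → X} {ξ : X → S → ℝ}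
    {v : X → ℝ≥0} {c : ℝ} {z : X} (hξ : ∀ h, HasLaw (ξ h) (gaussianReal 0 (v h)) P)
    (hN : ∀ h, (fun τ => ⟪N τ, h⟫) =ᵐ[P] fun τ => ⟪z, h⟫ + c * ξ h τ) (a : X) :
    ∫⁻ τ, ‖a - N τ‖ₑ ^ 2 ∂P = ENNReal.ofReal (‖a - z‖ ^ 2)
      + ∑' i, ENNReal.ofReal (c ^ 2 * v (b i)) := by
  have h1 : ∀ τ, ‖a - N τ‖ₑ ^ 2 = ∑' i, ENNReal.ofReal (⟪a - N τ, b i⟫ ^ 2) := fun τ => by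
    rw [← ofReal_norm_sq_eq_tsum, ← ofReal_norm, ENNReal.ofReal_pow (norm_nonneg _)]
  have h2 : ∀ i, (fun τ => ENNReal.ofReal (⟪a - N τ, b i⟫ ^ 2)) =ᵐ[P]
      fun τ => ENNReal.ofReal ((⟪a - z, b i⟫ - c * ξ (b i) τ) ^ 2) := fun i => by
    filter_upwards [hN (b i)] with τ hτ
    rw [inner_sub_left, hτ, inner_sub_left]
    congr 2; ring
  have hm : ∀ i, AEMeasurable (fun τ => ENNReal.ofReal ((⟪a - z, b i⟫ - c * ξ (b i) τ) ^ 2)) P :=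
    fun i => by
      have := (hξ (b i)).aemeasurable
      fun_prop
  simp only [h1]
  rw [lintegral_tsum fun i => (hm i).congr (h2 i).symm, ofReal_norm_sq_eq_tsum b, ← ENNReal.tsum_add]
  refine tsum_congr fun i => ?_
  rw [lintegral_congr_ae (h2 i), lintegral_sq_gaussian (hξ _)]

variable [CompleteSpace X]

/-- Both sides are the double sum of the squared matrix entries, and sums in `[0, ∞]` commute. -/
theorem tsum_norm_sq_adjoint {ι : Type*} (b : HilbertBasis ι ℝ X) (R : X →L[ℝ] X) :
    ∑' i, ENNReal.ofReal (‖R (b i)‖ ^ 2)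
      = ∑' i, ENNReal.ofReal (‖ContinuousLinearMap.adjoint R (b i)‖ ^ 2) := by
  simp only [ofReal_norm_sq_eq_tsum b]
  rw [ENNReal.tsum_comm]
  refine tsum_congr fun i => tsum_congr fun j => ?_
  rw [ContinuousLinearMap.adjoint_inner_left, real_inner_comm]

theorem exists_basis_posTrace (X : Type*) [NormedAddCommGroup X] [InnerProductSpace ℝ X]
    [CompleteSpace X] : ∃ (ι : Set X) (b : HilbertBasis ι ℝ X),
      ∀ T : X →L[ℝ] X, posTrace T = ∑' i, ENNReal.ofReal ⟪T (b i), b i⟫ := by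
  obtain ⟨b, hb⟩ := (exists_hilbertBasis ℝ X).choose_spec
  exact ⟨_, b, fun T => by rw [posTrace, hb]⟩

end Trace

/-! ### The squared posterior contraction -/

section Contraction

open ProbabilityTheory

variable {X Y : Type*} [NormedAddCommGroup X] [InnerProductSpace ℝ X] [CompleteSpace X]
  [NormedAddCommGroup Y] [InnerProductSpace ℝ Y] [CompleteSpace Y]

/-- Squared bias, variance of the posterior mean and trace of the posterior covariance: the integral
over `Z` gives the last term for each noise realization, and the integral over the noise gives the
other two. -/
theorem squaredPosteriorContraction_eq {S S' : Type*} [MeasurableSpace S]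
    [MeasurableSpace S'] {P : Measure S} {Q : Measure S'} [IsProbabilityMeasure P]
    [IsProbabilityMeasure Q] {G : X →L[ℝ] Y} {C₀ : X →L[ℝ] X} {α δ : ℝ} {x : X}
    {η : Y → S → ℝ} {M : S → X} {Z : S' → X} (hη : IsWhiteNoise P η)
    (hM : IsPosteriorMean P η G C₀ α δ x M) (hZ : IsCenteredGaussian Q (posteriorCov G C₀ α δ) Z)
    {ι : Type*} [Countable ι] (b : HilbertBasis ι ℝ X) :
    squaredPosteriorContraction P Q M Z x =
      ENNReal.ofReal (‖x - gainOp G C₀ α (G x)‖ ^ 2)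
        + ∑' i, ENNReal.ofReal (δ ^ 2 * ‖ContinuousLinearMap.adjoint (gainOp G C₀ α) (b i)‖ ^ 2)
        + ∑' i, ENNReal.ofReal ⟪posteriorCov G C₀ α δ (b i), b i⟫ := by
  have h1 : ∀ τ, ∫⁻ σ, ‖x - (M τ + Z σ)‖ₑ ^ 2 ∂Q = ‖x - M τ‖ₑ ^ 2
      + ∑' i, ENNReal.ofReal ⟪posteriorCov G C₀ α δ (b i), b i⟫ := fun τ => by
    have := lintegral_enorm_sub_sq b (c := 1) (z := 0) (N := Z) hZ.hasLaw (by simp) (x - M τ)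
    simp only [sub_sub] at this
    rw [this, add_zero, ← ofReal_norm, ENNReal.ofReal_pow (norm_nonneg _)]
    congr 1
    refine tsum_congr fun i => ?_
    rw [one_pow, one_mul, ENNReal.ofReal_coe_nnreal]; rfl
  rw [squaredPosteriorContraction]
  simp only [h1]
  rw [lintegral_add_right _ measurable_const, lintegral_const, measure_univ, mul_one]
  congr 1
  have h2 := lintegral_enorm_sub_sq b (c := δ) (z := gainOp G C₀ α (G x)) (N := M)
    (ξ := fun h => η (ContinuousLinearMap.adjoint (gainOp G C₀ α) h)) (fun h => hη.hasLaw _)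
    (fun h => by
      refine (hM.inner_eq h).trans (Filter.Eventually.of_forall fun τ => ?_)
      simp only [ContinuousLinearMap.adjoint_inner_right]) x
  rw [h2]
  congr 1

theorem continuousOn_resolvent {α : ℝ} (hα : 0 < α) {b : ℝ} :
    ContinuousOn (fun t : ℝ => 1 / (α + t)) (Icc 0 b) :=
  continuousOn_const.div (by fun_prop) fun t ht => by linarith [ht.1]

theorem resolventOp_eq (G : X →L[ℝ] Y) (C₀ : X →L[ℝ] X) {α : ℝ} (hα : 0 < α) :
    resolventOp G C₀ α = opFun (fun t => 1 / (α + t)) (hessOp G C₀) :=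
  ringInverse_eq_opFun (isPositive_hessOp G C₀) hα

theorem adjoint_gainOp (G : X →L[ℝ] Y) {C₀ : X →L[ℝ] X} (hC : C₀.IsPositive)
    {α : ℝ} (hα : 0 < α) (h : X) : ContinuousLinearMap.adjoint (gainOp G C₀ α) h
    = precondOp G C₀ (resolventOp G C₀ α (opFun Real.sqrt C₀ h)) := by
  rw [gainOp, ContinuousLinearMap.adjoint_comp, ContinuousLinearMap.adjoint_comp,
    ContinuousLinearMap.adjoint_adjoint, adjoint_opFun hC continuousOn_sqrt, resolventOp_eq G C₀ hα,
    adjoint_opFun (isPositive_hessOp G C₀) (continuousOn_resolvent hα)]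
  rfl

/-- The left side is the form of `t / (α + t)²` at `H`, the right side that of `1 / (α + t)`. So the
variance of the mean is at most the posterior trace. -/
theorem norm_adjoint_gainOp_sq_le (G : X →L[ℝ] Y) {C₀ : X →L[ℝ] X} (hC : C₀.IsPositive)
    {α : ℝ} (hα : 0 < α) (h : X) :
    ‖ContinuousLinearMap.adjoint (gainOp G C₀ α) h‖ ^ 2
      ≤ ⟪resolventOp G C₀ α (opFun Real.sqrt C₀ h), opFun Real.sqrt C₀ h⟫ := by
  have hH := isPositive_hessOp G C₀
  have hR := continuousOn_resolvent hα (b := ‖hessOp G C₀‖)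
  rw [adjoint_gainOp G hC hα]
  set y := opFun Real.sqrt C₀ h
  have h1 : ∀ z, ‖precondOp G C₀ z‖ ^ 2 = ⟪hessOp G C₀ z, z⟫ := fun z => by
    rw [hessOp, ContinuousLinearMap.comp_apply, ContinuousLinearMap.adjoint_inner_left,
      real_inner_self_eq_norm_sq]
  rw [h1, resolventOp_eq G C₀ hα, ← inner_opFun hH hR]
  set r : ℝ → ℝ := fun t => 1 / (α + t) with hr
  have htr : ContinuousOn (fun t => t * r t) (Icc 0 ‖hessOp G C₀‖) := (continuousOn_id' _).mul hR
  have h2 : opFun r (hessOp G C₀) (hessOp G C₀ (opFun r (hessOp G C₀) y))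
      = opFun (fun t => r t * (t * r t)) (hessOp G C₀) y := by
    rw [opFun_mul hH hR htr, opFun_mul hH (continuousOn_id' _) hR,
      opFun_id hH]
    rfl
  rw [h2]
  refine inner_le_of_opLe (opFun_mono hH (f := fun t => r t * (t * r t)) (hR.mul htr) hR
    fun t ht => ?_) y
  have hαt : 0 < α + t := by linarith [ht.1]
  simp only [hr]
  rw [mul_one_div]
  have h3 : t / (α + t) ≤ 1 := by rw [div_le_one hαt]; linarith
  have : 0 ≤ 1 / (α + t) := by positivity
  nlinarith

/-- With `R = (α + H)⁻¹`, the left sum is the squared Hilbert–Schmidt norm of `R^{1/2} C₀^{1/2}`.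
Passing to the adjoint `C₀^{1/2} R^{1/2}` puts `C₀` in the middle, where `m² C₀ ≤ f(H)` applies, and
`f(H)` commutes with `R^{1/2}`. -/
theorem tsum_inner_resolventOp_le (G : X →L[ℝ] Y) {C₀ : X →L[ℝ] X} (hC : C₀.IsPositive)
    {α : ℝ} (hα : 0 < α) {f : ℝ → ℝ} (hf : ContinuousOn f (Ici 0)) {m : ℝ} (hm : 0 < m)
    (hle : ∀ x, m ^ 2 * ⟪C₀ x, x⟫ ≤ ⟪opFun f (hessOp G C₀) x, x⟫) {ι : Type*}
    (b : HilbertBasis ι ℝ X) :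
    ∑' i, ENNReal.ofReal
        ⟪resolventOp G C₀ α (opFun Real.sqrt C₀ (b i)), opFun Real.sqrt C₀ (b i)⟫
      ≤ ENNReal.ofReal (1 / m ^ 2) * ∑' i, ENNReal.ofReal
        ⟪(resolventOp G C₀ α ∘L opFun f (hessOp G C₀)) (b i), b i⟫ := by
  have hH := isPositive_hessOp G C₀
  set H := hessOp G C₀ with hHdef
  have hR := continuousOn_resolvent hα (b := ‖H‖)
  have hR0 : ∀ t ∈ Icc 0 ‖H‖, 0 ≤ 1 / (α + t) := fun t ht => by
    have : 0 < α + t := by linarith [ht.1]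
    positivity
  have hfc : ContinuousOn f (Icc 0 ‖H‖) := hf.mono Icc_subset_Ici_self
  set q : ℝ → ℝ := fun t => √(1 / (α + t)) with hq
  have hqc : ContinuousOn q (Icc 0 ‖H‖) := hR.sqrt
  have h1 : ∀ y, ⟪resolventOp G C₀ α y, y⟫ = ‖opFun q H y‖ ^ 2 := fun y => by
    rw [resolventOp_eq G C₀ hα, norm_opFun_sqrt_sq hH hR hR0]
  have h2 := tsum_norm_sq_adjoint b (opFun q H ∘L opFun Real.sqrt C₀)
  rw [ContinuousLinearMap.adjoint_comp, adjoint_opFun hC continuousOn_sqrt,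
    adjoint_opFun hH hqc] at h2
  simp only [h1]
  simp only [ContinuousLinearMap.comp_apply] at h2
  rw [h2, ← ENNReal.tsum_mul_left]
  refine ENNReal.tsum_le_tsum fun i => ?_
  rw [← ENNReal.ofReal_mul (by positivity)]
  refine ENNReal.ofReal_le_ofReal ?_
  rw [norm_opFun_sqrt_apply_sq hC, div_mul_eq_mul_div, one_mul, le_div_iff₀' (by positivity)]
  refine (hle _).trans (le_of_eq ?_)
  rw [← inner_opFun hH hqc, resolventOp_eq G C₀ hα, ← mul_apply_eq_comp, ← mul_apply_eq_comp,
    mul_assoc, opFun_mul_comm hH hfc hqc, ← mul_assoc, ← opFun_mul hH hqc hqc,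
    opFun_congr (g := fun t => 1 / (α + t)) fun t ht => Real.mul_self_sqrt (hR0 t ht)]
  rfl

/-- On the range of `C₀^{1/2}` the residual is `C₀^{1/2} (I - (α + H)⁻¹ H) y`, and `1 - t / (α + t)
= s_α(t)`. -/
theorem sub_gainOp_sqrt (G : X →L[ℝ] Y) (C₀ : X →L[ℝ] X) {α : ℝ} (hα : 0 < α) (y : X) :
    opFun Real.sqrt C₀ y - gainOp G C₀ α (G (opFun Real.sqrt C₀ y))
      = opFun Real.sqrt C₀ (opFun (fun t => α / (α + t)) (hessOp G C₀) y) := by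
  have hH := isPositive_hessOp G C₀
  have hR := continuousOn_resolvent hα (b := ‖hessOp G C₀‖)
  have e1 : gainOp G C₀ α (G (opFun Real.sqrt C₀ y))
      = opFun Real.sqrt C₀ (resolventOp G C₀ α (hessOp G C₀ y)) := rfl
  have e2 : opFun (fun t => α / (α + t)) (hessOp G C₀)
      = 1 - opFun (fun t => 1 / (α + t)) (hessOp G C₀) * hessOp G C₀ := by
    have h1 := opFun_mul hH hR (continuousOn_id' _)
    have h2 := opFun_sub hH (f := fun _ => 1) continuousOn_const (hR.mul (continuousOn_id' _))
    rw [opFun_const hH, one_smul] at h2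
    rw [opFun_id hH] at h1
    rw [← h1]
    refine Eq.trans (opFun_congr fun t ht => ?_) h2
    have : α + t ≠ 0 := by linarith [ht.1]
    simp only [Pi.mul_apply]
    field_simp
    ring
  rw [e1, resolventOp_eq G C₀ hα, ← map_sub, e2]
  rfl

theorem enorm_sub_gainOp_sqrt_le (G : X →L[ℝ] Y) {C₀ : X →L[ℝ] X} (hC : C₀.IsPositive)
    {α : ℝ} (hα : 0 < α) {ψ : ℝ → ℝ} (hψ : IsIndexFunction ψ) {m : ℝ} (hm : 0 < m)
    (hle : ∀ x, m ^ 2 * ⟪C₀ x, x⟫ ≤ ⟪opFun (f0Sq ψ) (hessOp G C₀) x, x⟫) (y : X) :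
    ‖opFun Real.sqrt C₀ y - gainOp G C₀ α (G (opFun Real.sqrt C₀ y))‖ₑ
      ≤ ENNReal.ofReal (1 / m) * ‖opFun (fun t => α / (α + t)) (hessOp G C₀)
          (opFun (f0 ψ) (hessOp G C₀) y)‖ₑ := by
  have hH := isPositive_hessOp G C₀
  have hfc : ContinuousOn (f0Sq ψ) (Icc 0 ‖hessOp G C₀‖) :=
    hψ.continuousOn_f0Sq.mono Icc_subset_Ici_self
  have hs : ContinuousOn (fun t => α / (α + t)) (Icc 0 ‖hessOp G C₀‖) :=
    continuousOn_const.div (by fun_prop) fun t ht => by linarith [ht.1]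
  have hf0c : ContinuousOn (f0 ψ) (Icc 0 ‖hessOp G C₀‖) := hfc.sqrt
  rw [sub_gainOp_sqrt G C₀ hα, ← mul_apply_eq_comp (opFun _ (hessOp G C₀)),
    opFun_mul_comm hH hs hf0c, mul_apply_eq_comp]
  set z := opFun (fun t => α / (α + t)) (hessOp G C₀) y
  rw [← ofReal_norm, ← ofReal_norm, ← ENNReal.ofReal_mul (by positivity)]
  refine ENNReal.ofReal_le_ofReal ?_
  rw [div_mul_eq_mul_div, one_mul, le_div_iff₀' hm]
  refine le_of_sq_le_sq ?_ (norm_nonneg _)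
  rw [mul_pow, norm_opFun_sqrt_apply_sq hC]
  refine (hle z).trans (le_of_eq ?_)
  exact (norm_opFun_sqrt_sq hH hfc (fun t ht => hψ.f0Sq_nonneg ht.1) z).symm

/-- `φ(C₀) v` need not lie in the range of `C₀^{1/2}`. Replacing `v` by `C₀ (C₀ + c)⁻¹ v` puts it
there without increasing the norm of `v`, and `φ(0) = 0` makes the error small. -/
theorem exists_mem_range_sqrt_near {C₀ : X →L[ℝ] X} (hC : C₀.IsPositive)
    {φ : ℝ → ℝ} (hφ : IsIndexFunction φ) {ε : ℝ} (hε : 0 < ε)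
    {v : X} (hv : ‖v‖ ≤ 1) : ∃ v' y : X, ‖v'‖ ≤ 1 ∧ opFun Real.sqrt C₀ y = opFun φ C₀ v' ∧
      ‖opFun φ C₀ v' - opFun φ C₀ v‖ ≤ ε := by
  have hφc : ContinuousOn φ (Icc 0 ‖C₀‖) := hφ.continuousOn.mono Icc_subset_Ici_self
  obtain ⟨K, hK0, hK⟩ := exists_bound_Icc hφc
  obtain ⟨r, hr, hr'⟩ : ∃ r > 0, ∀ t, 0 ≤ t → t < r → φ t ≤ ε := by
    have h1 := hφ.continuousOn 0 self_mem_Ici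
    rw [Metric.continuousWithinAt_iff] at h1
    obtain ⟨r, hr, h⟩ := h1 ε hε
    refine ⟨r, hr, fun t ht htr => ?_⟩
    have h2 := h (x := t) ht (by rw [Real.dist_eq, sub_zero, abs_of_nonneg ht]; exact htr)
    rw [hφ.map_zero, Real.dist_eq, sub_zero] at h2
    exact (le_abs_self _).trans h2.le
  -- The error symbol is `φ(t) c / (t + c)`. For `t < r` it is at most `φ(t) ≤ ε`; for `t ≥ r` it is
  -- at most `K c / (t + c) ≤ ε` by this choice.
  set c := ε * r / (K + 1) with hc
  have hc0 : 0 < c := by positivity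
  have hne : ∀ t ∈ Icc 0 ‖C₀‖, t + c ≠ 0 := fun t ht => by linarith [ht.1]
  have hg : ContinuousOn (fun t : ℝ => t / (t + c)) (Icc 0 ‖C₀‖) :=
    (continuousOn_id' _).div (by fun_prop) hne
  have hk : ContinuousOn (fun t : ℝ => √t * φ t / (t + c)) (Icc 0 ‖C₀‖) :=
    (continuousOn_sqrt.mul hφc).div (by fun_prop) hne
  have hmul : opFun φ C₀ * opFun (fun t => t / (t + c)) C₀
      = opFun (fun t => φ t * (t / (t + c))) C₀ := (opFun_mul hC hφc hg).symm
  refine ⟨opFun (fun t => t / (t + c)) C₀ v, opFun (fun t => √t * φ t / (t + c)) C₀ v, ?_, ?_, ?_⟩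
  · have h1 : ‖opFun (fun t => t / (t + c)) C₀‖ ≤ 1 := norm_opFun_le hC hg fun t ht => by
      have htc : 0 < t + c := by linarith [ht.1]
      rw [abs_of_nonneg (div_nonneg ht.1 htc.le), div_le_one htc]
      linarith
    calc _ ≤ 1 * ‖v‖ := ContinuousLinearMap.le_of_opNorm_le _ h1 v
      _ ≤ 1 := by simpa
  · rw [← mul_apply_eq_comp, ← mul_apply_eq_comp, hmul, ← opFun_mul hC continuousOn_sqrt hk]
    congr 1
    refine opFun_congr fun t ht => ?_
    have h1 : √t * √t = t := Real.mul_self_sqrt ht.1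
    rw [← mul_div_assoc, ← mul_assoc, h1]
    ring
  · have hφg : ContinuousOn (fun t => φ t * (t / (t + c))) (Icc 0 ‖C₀‖) := hφc.mul hg
    rw [← mul_apply_eq_comp, hmul, ← _root_.sub_apply, ← opFun_sub hC hφg hφc]
    have h1 : ‖opFun (fun t => φ t * (t / (t + c)) - φ t) C₀‖ ≤ ε := by
      refine norm_opFun_le hC (f := fun t => φ t * (t / (t + c)) - φ t)
        (hφg.sub hφc) fun t ht => ?_
      have htc : 0 < t + c := by linarith [ht.1]
      have hφ0 := hφ.nonneg ht.1
      have e : φ t * (t / (t + c)) - φ t = -(φ t * (c / (t + c))) := by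
        have := hne t ht
        field_simp
        ring
      have hcle : c / (t + c) ≤ 1 := by rw [div_le_one htc]; linarith [ht.1]
      have hc00 : 0 ≤ c / (t + c) := by positivity
      rw [e, abs_neg, abs_of_nonneg (mul_nonneg hφ0 hc00)]
      by_cases htr : t < r
      · have := hr' t ht.1 htr
        nlinarith
      · push Not at htr
        have hKt := (le_abs_self _).trans (hK t ht)
        rw [mul_div_assoc', div_le_iff₀ htc]
        have h3 : c * (K + 1) = ε * r := by rw [hc]; field_simp
        nlinarith
    calc _ ≤ ε * ‖v‖ := ContinuousLinearMap.le_of_opNorm_le _ h1 v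
      _ ≤ ε := mul_le_of_le_one_right hε.le hv

/-- The inequality defines a closed set of true elements and holds for those in the natural domain
of `biasNorm`, which approximate the given one. -/
theorem enorm_sub_gainOp_le (G : X →L[ℝ] Y) {C₀ : X →L[ℝ] X} (hC : C₀.IsPositive)
    {α : ℝ} (hα : 0 < α) {ψ φ : ℝ → ℝ} (hψ : IsIndexFunction ψ) (hφ : IsIndexFunction φ)
    {m : ℝ} (hm : 0 < m)
    (hle : ∀ x, m ^ 2 * ⟪C₀ x, x⟫ ≤ ⟪opFun (f0Sq ψ) (hessOp G C₀) x, x⟫) {v : X} (hv : ‖v‖ ≤ 1) :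
    ‖opFun φ C₀ v - gainOp G C₀ α (G (opFun φ C₀ v))‖ₑ
      ≤ ENNReal.ofReal (1 / m) * biasNorm G C₀ ψ φ α := by
  have hcl : IsClosed {z : X | ‖z - gainOp G C₀ α (G z)‖ₑ
      ≤ ENNReal.ofReal (1 / m) * biasNorm G C₀ ψ φ α} :=
    isClosed_le (by fun_prop) continuous_const
  refine hcl.closure_subset (Metric.mem_closure_iff.2 fun ε hε => ?_)
  obtain ⟨v', y, hv', hy, hd⟩ := exists_mem_range_sqrt_near hC hφ (half_pos hε) hv
  refine ⟨opFun φ C₀ v', ?_, ?_⟩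
  · change ‖_‖ₑ ≤ _
    rw [← hy]
    refine (enorm_sub_gainOp_sqrt_le G hC hα hψ hm hle y).trans ?_
    gcongr
    exact le_iSup₂_of_le v' y (le_iSup₂_of_le hv' hy le_rfl)
  · rw [dist_comm, dist_eq_norm]
    linarith

theorem oneSidedContraction_of_link [TopologicalSpace.SeparableSpace X] (G : X →L[ℝ] Y)
    {C₀ : X →L[ℝ] X} (hC : C₀.IsPositive) {ψ : ℝ → ℝ} (hψ : IsIndexFunction ψ)
    (hconc : IsOperatorConcave X (f0Sq ψ)) {m : ℝ} (hm : 0 < m) (hm1 : m ≤ 1)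
    (hlink : ∀ x, m * ‖opFun ψ C₀ x‖ ≤ ‖G x‖) : OneSidedContraction.{w} G C₀ ψ m := by
  intro φ hφ v hv α δ hα hδ S S' _ _ P Q _ _ η M Z hη hM hZ
  have hle := inner_le_inner_opFun_f0Sq G hC hψ hconc hm hm1 hlink
  obtain ⟨ι, b, hb⟩ := exists_basis_posTrace X
  have : Countable ι := countable_hilbertBasis b
  rw [squaredPosteriorContraction_eq hη hM hZ b, hb]
  set V := ∑' i, ENNReal.ofReal
    ⟪resolventOp G C₀ α (opFun Real.sqrt C₀ (b i)), opFun Real.sqrt C₀ (b i)⟫ with hV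
  have hVle := tsum_inner_resolventOp_le G hC hα hψ.continuousOn_f0Sq hm hle b
  rw [← hV] at hVle
  set W := ∑' i, ENNReal.ofReal
    ⟪(resolventOp G C₀ α ∘L opFun (f0Sq ψ) (hessOp G C₀)) (b i), b i⟫
  have h1 : ENNReal.ofReal (‖opFun φ C₀ v - gainOp G C₀ α (G (opFun φ C₀ v))‖ ^ 2)
      ≤ ENNReal.ofReal (1 / m ^ 2) * biasNorm G C₀ ψ φ α ^ 2 := by
    rw [ENNReal.ofReal_pow (norm_nonneg _), ofReal_norm, ← one_div_pow,
      ENNReal.ofReal_pow (by positivity), ← mul_pow]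
    have := enorm_sub_gainOp_le G hC hα hψ hφ hm hle hv
    gcongr
  have h2 : ∑' i, ENNReal.ofReal (δ ^ 2 * ‖ContinuousLinearMap.adjoint (gainOp G C₀ α) (b i)‖ ^ 2)
      ≤ ENNReal.ofReal (δ ^ 2) * V := by
    rw [hV, ← ENNReal.tsum_mul_left]
    refine ENNReal.tsum_le_tsum fun i => ?_
    rw [ENNReal.ofReal_mul (by positivity)]
    gcongr
    exact norm_adjoint_gainOp_sq_le G hC hα (b i)
  have h3 : ∑' i, ENNReal.ofReal ⟪posteriorCov G C₀ α δ (b i), b i⟫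
      = ENNReal.ofReal (δ ^ 2) * V := by
    rw [hV, ← ENNReal.tsum_mul_left]
    refine tsum_congr fun i => ?_
    rw [← ENNReal.ofReal_mul (by positivity), posteriorCov, _root_.smul_apply,
      real_inner_smul_left]
    simp only [ContinuousLinearMap.comp_apply]
    rw [inner_opFun hC continuousOn_sqrt]
  rw [h3]
  calc _ ≤ ENNReal.ofReal (1 / m ^ 2) * biasNorm G C₀ ψ φ α ^ 2
        + ENNReal.ofReal (δ ^ 2) * (ENNReal.ofReal (1 / m ^ 2) * W)
        + ENNReal.ofReal (δ ^ 2) * (ENNReal.ofReal (1 / m ^ 2) * W) := by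
        gcongr
        exact h2.trans (by gcongr)
    _ = _ := by ring

end Contraction

/-! ### The Dirichlet Laplacian -/

section Laplacian

variable {d : ℕ} {Ω : Set (Space d)}

/-- The product of a test function and a smooth function. -/
def mulTest (φ : testFunctions Ω) (g : Space d → ℝ) (hg : ContDiff ℝ ∞ g) : testFunctions Ω :=
  ⟨fun x => (φ : Space d → ℝ) x * g x, φ.2.1.mul hg, φ.2.2.1.mul_right,
    (tsupport_mul_subset_left).trans φ.2.2.2⟩

theorem partialTest_mulTest (i : Fin d) (φ : testFunctions Ω) (g : Space d → ℝ)
    (hg : ContDiff ℝ ∞ g) (x : Space d) :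
    (partialTest Ω i (mulTest φ g hg) : Space d → ℝ) x
      = (partialTest Ω i φ : Space d → ℝ) x * g x
        + (φ : Space d → ℝ) x * fderiv ℝ g x (EuclideanSpace.single i 1) := by
  change fderiv ℝ (fun x => (φ : Space d → ℝ) x * g x) x _
    = fderiv ℝ (φ : Space d → ℝ) x _ * g x + _
  rw [fderiv_fun_mul (φ.2.1.differentiable (by simp) x) (hg.differentiable (by simp) x)]
  simp only [_root_.add_apply, _root_.smul_apply, smul_eq_mul]
  ring

theorem norm_testToL2_sq (φ : testFunctions Ω) :
    ‖testToL2 Ω φ‖ ^ 2 = ∫ x, (φ : Space d → ℝ) x * (φ : Space d → ℝ) x := by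
  rw [← real_inner_self_eq_norm_sq, inner_test_test]

theorem contDiff_coord (i : Fin d) (k : ℝ) : ContDiff ℝ ∞ fun x : Space d => k * x i :=
  contDiff_const.mul (EuclideanSpace.proj (𝕜 := ℝ) i).contDiff

theorem hasFDerivAt_coord (i : Fin d) (k : ℝ) (x : Space d) :
    HasFDerivAt (fun x : Space d => k * x i) (k • (EuclideanSpace.proj i : Space d →L[ℝ] ℝ)) x :=
  ((EuclideanSpace.proj (𝕜 := ℝ) i).hasFDerivAt).const_mul k

/-- Take `φ cos(k x_i)` and `φ sin(k x_i)`: the cross terms of the derivatives cancel in the sum.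
The total `L²` mass stays fixed while the gradient gains `k²`. -/
theorem oscillation_identity (i : Fin d) (φ : testFunctions Ω) (k : ℝ) :
    ∃ ψ χ : testFunctions Ω, ‖testToL2 Ω ψ‖ ^ 2 + ‖testToL2 Ω χ‖ ^ 2 = ‖testToL2 Ω φ‖ ^ 2 ∧
      ‖testToL2 Ω (partialTest Ω i ψ)‖ ^ 2 + ‖testToL2 Ω (partialTest Ω i χ)‖ ^ 2
        = ‖testToL2 Ω (partialTest Ω i φ)‖ ^ 2 + k ^ 2 * ‖testToL2 Ω φ‖ ^ 2 := by
  have hc : ContDiff ℝ ∞ fun x : Space d => Real.cos (k * x i) := (contDiff_coord i k).cos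
  have hs : ContDiff ℝ ∞ fun x : Space d => Real.sin (k * x i) := (contDiff_coord i k).sin
  have hsq : ∀ φ : testFunctions Ω,
      Integrable fun x => (φ : Space d → ℝ) x * (φ : Space d → ℝ) x :=
    fun φ => integrable_test_mul φ _ φ.2.1.continuous
  have hc' : ∀ x : Space d, fderiv ℝ (fun x : Space d => Real.cos (k * x i)) x
      (EuclideanSpace.single i 1) = - k * Real.sin (k * x i) := fun x => by
    rw [(hasFDerivAt_coord i k x).cos.fderiv]
    simp; ring
  have hs' : ∀ x : Space d, fderiv ℝ (fun x : Space d => Real.sin (k * x i)) x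
      (EuclideanSpace.single i 1) = k * Real.cos (k * x i) := fun x => by
    rw [(hasFDerivAt_coord i k x).sin.fderiv]
    simp; ring
  refine ⟨mulTest φ _ hc, mulTest φ _ hs, ?_, ?_⟩
  · simp only [norm_testToL2_sq]
    rw [← integral_add (hsq _) (hsq _)]
    refine integral_congr_ae (Filter.Eventually.of_forall fun x => ?_)
    simp only [mulTest]
    linear_combination ((φ : Space d → ℝ) x) ^ 2 * Real.sin_sq_add_cos_sq (k * x i)
  · simp only [norm_testToL2_sq]
    rw [← integral_const_mul, ← integral_add (hsq _) (hsq _),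
      ← integral_add (hsq _) ((hsq _).const_mul _)]
    refine integral_congr_ae (Filter.Eventually.of_forall fun x => ?_)
    simp only [partialTest_mulTest, hc', hs']
    linear_combination (((partialTest Ω i φ : Space d → ℝ) x) ^ 2
      + k ^ 2 * ((φ : Space d → ℝ) x) ^ 2) * Real.sin_sq_add_cos_sq (k * x i)

variable [hΩ : IsH2RegularDomain Ω]

theorem exists_gradient (u : StateSpace Ω) : ∃ p ∈ H10Graph Ω, p.fst = embed Ω u ∧
    ∀ q ∈ H10Graph Ω, ⟪p.snd, q.snd⟫ = ⟪laplace Ω u, q.fst⟫ := by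
  obtain ⟨p, hp, hpu, h⟩ := isWeakSolution_negLaplace Ω u
  exact ⟨p, hp, hpu, fun q hq => IsWeakSolution.inner_eq h hq⟩

theorem snd_eq_of_fst_eq {p q : GradPair Ω} (hp : p ∈ H10Graph Ω) (hq : q ∈ H10Graph Ω)
    (h : p.fst = q.fst) : p.snd = q.snd := by
  ext1 i
  rw [← weakPartial_eq hΩ.isOpen (hasWeakPartial_of_mem hp i),
    ← weakPartial_eq hΩ.isOpen (hasWeakPartial_of_mem hq i), h]

/-- Green's formula: both sides equal the Dirichlet form `⟪∇u, ∇v⟫`. -/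
theorem inner_laplace_embed (u v : StateSpace Ω) :
    ⟪laplace Ω u, embed Ω v⟫ = ⟪embed Ω u, laplace Ω v⟫ := by
  obtain ⟨p, hp, hpu, h⟩ := exists_gradient u
  obtain ⟨q, hq, hqv, h'⟩ := exists_gradient v
  rw [← hqv, ← hpu, ← h q hq, real_inner_comm, h' p hp, real_inner_comm]

theorem inner_laplace_embed_self_nonneg (u : StateSpace Ω) : 0 ≤ ⟪laplace Ω u, embed Ω u⟫ := by
  obtain ⟨p, hp, hpu, h⟩ := exists_gradient u
  rw [← hpu, ← h p hp]
  exact real_inner_self_nonneg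

theorem embed_injective : Function.Injective (embed Ω) := fun _ _ h => Subtype.ext h

theorem inner_laplace_laplace (u v : StateSpace Ω) : ⟪laplace Ω u, laplace Ω v⟫ = ⟪u, v⟫ :=
  (laplace Ω).inner_map_map u v

/-- If `𝒜w` is orthogonal to `U`, symmetry makes `w` orthogonal to the range of `𝒜`, which is all of
`L²`; hence `w = 0`. -/
theorem denseRange_embed : DenseRange (embed Ω) := by
  have h : (LinearMap.range (embed Ω : StateSpace Ω →ₗ[ℝ] L2 Ω)).topologicalClosure = ⊤ := by
    rw [Submodule.topologicalClosure_eq_top_iff, Submodule.eq_bot_iff]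
    intro f hf
    obtain ⟨w, rfl⟩ := (laplace Ω).surjective f
    have h1 : embed Ω w = 0 := by
      rw [← inner_self_eq_zero (𝕜 := ℝ)]
      obtain ⟨u, hu⟩ := (laplace Ω).surjective (embed Ω w)
      nth_rewrite 1 [← hu]
      rw [inner_laplace_embed]
      exact hf _ ⟨u, rfl⟩
    rw [embed_injective (h1.trans (map_zero (embed Ω)).symm), map_zero]
  have h2 := Submodule.dense_iff_topologicalClosure_eq_top.2 h
  exact h2

/-- Test functions as elements of `U`. -/
def testState (φ : testFunctions Ω) : StateSpace Ω :=
  ⟨testToL2 Ω φ, ⟨testGraph Ω φ, subset_closure ⟨φ, rfl⟩, rfl⟩, fun i =>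
    ⟨_, hasWeakPartial_test i φ, fun j => ⟨_, hasWeakPartial_test j _⟩⟩⟩

/-- A bounded Laplacian would bound the gradient through `‖∇φ‖² = ⟪𝒜φ, φ⟫`. -/
theorem norm_partialTest_sq_le {C : ℝ} (hC : ∀ u : StateSpace Ω, ‖u‖ ≤ C * ‖embed Ω u‖)
    (i : Fin d) (φ : testFunctions Ω) :
    ‖testToL2 Ω (partialTest Ω i φ)‖ ^ 2 ≤ C * ‖testToL2 Ω φ‖ ^ 2 := by
  obtain ⟨p, hp, hpu, h⟩ := exists_gradient (testState φ)
  have hq : testGraph Ω φ ∈ H10Graph Ω := subset_closure ⟨φ, rfl⟩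
  have h1 := h _ hq
  rw [snd_eq_of_fst_eq hp hq hpu, real_inner_self_eq_norm_sq] at h1
  have h2 : ‖testToL2 Ω (partialTest Ω i φ)‖ ≤ ‖(testGraph Ω φ).snd‖ :=
    PiLp.norm_apply_le ((testGraph Ω φ).snd) i
  have h3 : ‖laplace Ω (testState φ)‖ ≤ C * ‖testToL2 Ω φ‖ :=
    ((laplace Ω).norm_map _).le.trans (hC (testState φ))
  calc _ ≤ ‖(testGraph Ω φ).snd‖ ^ 2 := by gcongr
    _ = ⟪laplace Ω (testState φ), testToL2 Ω φ⟫ := h1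
    _ ≤ ‖laplace Ω (testState φ)‖ * ‖testToL2 Ω φ‖ := real_inner_le_norm _ _
    _ ≤ C * ‖testToL2 Ω φ‖ * ‖testToL2 Ω φ‖ := by gcongr
    _ = _ := by ring

theorem exists_testFunction_ne_zero : ∃ φ : testFunctions Ω, 0 < ‖testToL2 Ω φ‖ := by
  obtain ⟨x, hx⟩ := hΩ.nonempty
  obtain ⟨r, hr, hr'⟩ := Metric.nhds_basis_closedBall.mem_iff.1 (hΩ.isOpen.mem_nhds hx)
  let f : ContDiffBump x := ⟨r / 2, r, half_pos hr, half_lt_self hr⟩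
  let φ : testFunctions Ω := ⟨f, f.contDiff, f.hasCompactSupport, by
    rw [f.tsupport_eq]; exact hr'⟩
  refine ⟨φ, ?_⟩
  have h1 : 0 < ∫ y, (φ : Space d → ℝ) y * (φ : Space d → ℝ) y := by
    refine Continuous.integral_pos_of_hasCompactSupport_nonneg_nonzero (x := x)
      (φ.2.1.continuous.mul φ.2.1.continuous) φ.2.2.1.mul_right (fun y => mul_self_nonneg _) ?_
    have : (φ : Space d → ℝ) x = 1 :=
      f.one_of_mem_closedBall (Metric.mem_closedBall_self (half_pos hr).le)
    rw [this]; norm_num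
  rw [← norm_testToL2_sq] at h1
  exact (sq_pos_iff.1 h1).lt_of_le' (norm_nonneg _)

/-- The Laplacian is unbounded: the `U` norm is not dominated by the `L²` norm. -/
theorem not_norm_le_embed (C : ℝ) : ¬ ∀ u : StateSpace Ω, ‖u‖ ≤ C * ‖embed Ω u‖ := by
  intro hC
  obtain ⟨φ, hφ⟩ := exists_testFunction_ne_zero (Ω := Ω)
  set i : Fin d := ⟨0, hΩ.dim_pos⟩
  -- The frequency `k = |C| + 1` satisfies `k² > C`, whereas the summed gradient bounds would give
  -- `k² ≤ C`.
  obtain ⟨ψ, χ, h1, h2⟩ := oscillation_identity i φ (|C| + 1)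
  have h3 := norm_partialTest_sq_le hC i ψ
  have h4 := norm_partialTest_sq_le hC i χ
  have h5 : (|C| + 1) ^ 2 * ‖testToL2 Ω φ‖ ^ 2 ≤ C * ‖testToL2 Ω φ‖ ^ 2 := by
    rw [← h1, mul_add C]
    rw [← h1] at h2
    nlinarith [sq_nonneg ‖testToL2 Ω (partialTest Ω i φ)‖]
  have h6 : (|C| + 1) ^ 2 ≤ C := le_of_mul_le_mul_right h5 (by positivity)
  nlinarith [le_abs_self C, abs_nonneg C]

end Laplacian

/-! ### The link estimates for block diagonal operators -/

section BlockLink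

variable {d : ℕ} {Ω : Set (Space d)} [hΩ : IsH2RegularDomain Ω]

theorem norm_forwardOp_sq (x : PairSpace Ω) :
    ‖forwardOp Ω x‖ ^ 2 = ‖laplace Ω x.fst - x.snd‖ ^ 2 + ‖embed Ω x.fst‖ ^ 2 :=
  WithLp.prod_norm_sq_eq_of_L2 _

theorem norm_blockDiag_sq (B : StateSpace Ω →ₗ[ℝ] StateSpace Ω) (D : L2 Ω →ₗ[ℝ] L2 Ω)
    (x : PairSpace Ω) : ‖blockDiag B D x‖ ^ 2 = ‖B x.fst‖ ^ 2 + ‖D x.snd‖ ^ 2 :=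
  WithLp.prod_norm_sq_eq_of_L2 _

theorem norm_laplace_sub_le (x : PairSpace Ω) : ‖laplace Ω x.fst - x.snd‖ ≤ ‖forwardOp Ω x‖ := by
  refine le_of_sq_le_sq ?_ (norm_nonneg _)
  rw [norm_forwardOp_sq]
  linarith [sq_nonneg ‖embed Ω x.fst‖]

theorem norm_embed_le (x : PairSpace Ω) : ‖embed Ω x.fst‖ ≤ ‖forwardOp Ω x‖ := by
  refine le_of_sq_le_sq ?_ (norm_nonneg _)
  rw [norm_forwardOp_sq]
  linarith [sq_nonneg ‖laplace Ω x.fst - x.snd‖]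

theorem norm_fst_le_blockDiag (B : StateSpace Ω →ₗ[ℝ] StateSpace Ω) (D : L2 Ω →ₗ[ℝ] L2 Ω)
    (x : PairSpace Ω) : ‖B x.fst‖ ≤ ‖blockDiag B D x‖ := by
  refine le_of_sq_le_sq ?_ (norm_nonneg _)
  rw [norm_blockDiag_sq]
  linarith [sq_nonneg ‖D x.snd‖]

theorem norm_snd_le_blockDiag (B : StateSpace Ω →ₗ[ℝ] StateSpace Ω) (D : L2 Ω →ₗ[ℝ] L2 Ω)
    (x : PairSpace Ω) : ‖D x.snd‖ ≤ ‖blockDiag B D x‖ := by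
  refine le_of_sq_le_sq ?_ (norm_nonneg _)
  rw [norm_blockDiag_sq]
  linarith [sq_nonneg ‖B x.fst‖]

theorem norm_blockDiag_le (B : StateSpace Ω →ₗ[ℝ] StateSpace Ω) (D : L2 Ω →ₗ[ℝ] L2 Ω)
    (x : PairSpace Ω) : ‖blockDiag B D x‖ ≤ ‖B x.fst‖ + ‖D x.snd‖ := by
  refine le_of_sq_le_sq ?_ (by positivity)
  rw [norm_blockDiag_sq]
  nlinarith [mul_nonneg (norm_nonneg (B x.fst)) (norm_nonneg (D x.snd))]

theorem upperLink_iff (B : StateSpace Ω →ₗ[ℝ] StateSpace Ω) (D : L2 Ω →ₗ[ℝ] L2 Ω) :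
    (∃ M, 0 < M ∧ UpperLink (blockDiag B D) M) ↔ IsBoundedBelow B ∧ IsBoundedBelow D := by
  constructor
  · rintro ⟨M, -, h⟩
    refine ⟨⟨M, fun u => ?_⟩, ⟨M, fun θ => ?_⟩⟩
    · have h1 := h (WithLp.toLp 2 (u, 0))
      have h2 := norm_laplace_sub_le (WithLp.toLp 2 (u, 0) : PairSpace Ω)
      have h3 : ‖blockDiag B D (WithLp.toLp 2 (u, 0))‖ = ‖B u‖ := by
        rw [← sq_eq_sq₀ (norm_nonneg _) (norm_nonneg _), norm_blockDiag_sq]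
        simp
      rw [h3] at h1
      refine le_trans ?_ (h2.trans h1)
      simp
    · have h1 := h (WithLp.toLp 2 (0, θ))
      have h2 := norm_laplace_sub_le (WithLp.toLp 2 (0, θ) : PairSpace Ω)
      have h3 : ‖blockDiag B D (WithLp.toLp 2 (0, θ))‖ = ‖D θ‖ := by
        rw [← sq_eq_sq₀ (norm_nonneg _) (norm_nonneg _), norm_blockDiag_sq]
        simp
      rw [h3] at h1
      refine le_trans ?_ (h2.trans h1)
      simp
  · rintro ⟨⟨c, hc⟩, ⟨c', hc'⟩⟩
    refine ⟨‖forwardOp Ω‖ * (|c| + |c'|) + 1, by positivity, fun x => ?_⟩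
    have h1 : ‖x‖ ≤ ‖x.fst‖ + ‖x.snd‖ := by
      refine le_of_sq_le_sq ?_ (by positivity)
      rw [WithLp.prod_norm_sq_eq_of_L2]
      nlinarith [mul_nonneg (norm_nonneg x.fst) (norm_nonneg x.snd)]
    have h2 : ‖x.fst‖ ≤ |c| * ‖blockDiag B D x‖ := by
      refine (hc x.fst).trans ?_
      have := norm_fst_le_blockDiag B D x
      have := le_abs_self c
      gcongr
    have h3 : ‖x.snd‖ ≤ |c'| * ‖blockDiag B D x‖ := by
      refine (hc' x.snd).trans ?_
      have := norm_snd_le_blockDiag B D x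
      have := le_abs_self c'
      gcongr
    calc ‖forwardOp Ω x‖ ≤ ‖forwardOp Ω‖ * ‖x‖ := (forwardOp Ω).le_opNorm x
      _ ≤ ‖forwardOp Ω‖ * (|c| * ‖blockDiag B D x‖ + |c'| * ‖blockDiag B D x‖) := by
        gcongr; linarith
      _ ≤ _ := by nlinarith [norm_nonneg (blockDiag B D x)]

/-- A symmetric operator defined everywhere is continuous (Hellinger–Toeplitz). Bounded below, it
has closed range, whose orthogonal complement is the trivial kernel. -/
theorem IsBoundedBelow.hasBoundedInverse {E : Type*} [NormedAddCommGroup E] [InnerProductSpace ℝ E]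
    [CompleteSpace E] {B : E →ₗ[ℝ] E} (hB : IsBoundedBelow B) (hs : B.IsSymmetric) :
    HasBoundedInverse B := by
  obtain ⟨c, hc⟩ := hB
  have hinj : Function.Injective B := (injective_iff_map_eq_zero B).2 fun x hx => by
    have := hc x
    rw [hx, norm_zero, mul_zero] at this
    exact norm_le_zero_iff.1 this
  refine ⟨⟨hinj, ?_⟩, c, hc⟩
  let B' : E →L[ℝ] E := ⟨B, hs.continuous⟩
  have hanti : AntilipschitzWith (Real.toNNReal c) B' :=
    B'.antilipschitz_of_bound fun x => (hc x).trans (by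
      have := Real.le_coe_toNNReal c
      gcongr
      rfl)
  have hcl : IsClosed (LinearMap.range B : Set E) := by
    rw [LinearMap.coe_range]
    exact hanti.isClosed_range B'.uniformContinuous
  have : CompleteSpace (LinearMap.range B) := hcl.completeSpace_coe
  rw [← LinearMap.range_eq_top, ← Submodule.orthogonal_eq_bot_iff, Submodule.eq_bot_iff]
  intro y hy
  refine (injective_iff_map_eq_zero B).1 hinj y ?_
  rw [← inner_self_eq_zero (𝕜 := ℝ), hs]
  have := hy (B (B y)) ⟨_, rfl⟩
  rwa [real_inner_comm] at this

theorem norm_forwardOp_graph (u : StateSpace Ω) :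
    ‖forwardOp Ω (WithLp.toLp 2 (u, laplace Ω u))‖ = ‖embed Ω u‖ := by
  rw [← sq_eq_sq₀ (norm_nonneg _) (norm_nonneg _), norm_forwardOp_sq]
  simp

theorem LowerLink.norm_graph_le {B : StateSpace Ω →ₗ[ℝ] StateSpace Ω} {D : L2 Ω →ₗ[ℝ] L2 Ω}
    {m : ℝ} (hm : 0 < m) (h : LowerLink (blockDiag B D) m) (u : StateSpace Ω) :
    ‖B u‖ ≤ m⁻¹ * ‖embed Ω u‖ ∧ ‖D (laplace Ω u)‖ ≤ m⁻¹ * ‖embed Ω u‖ := by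
  have h1 := h (WithLp.toLp 2 (u, laplace Ω u))
  rw [norm_forwardOp_graph, ← le_inv_mul_iff₀ hm] at h1
  exact ⟨(norm_fst_le_blockDiag B D (WithLp.toLp 2 (u, laplace Ω u))).trans h1,
    (norm_snd_le_blockDiag B D (WithLp.toLp 2 (u, laplace Ω u))).trans h1⟩

/-- The graph estimates extend `B` and `D𝒜` from the dense subspace `U` to `L²`. With `S` the
extension of `D𝒜`, symmetry of `𝒜` identifies the adjoint of `D` as `𝒜⁻¹ S*`. -/
theorem isBoundedL2ToU_and_adjoint_of_lowerLink {B : StateSpace Ω →ₗ[ℝ] StateSpace Ω}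
    {D : L2 Ω →ₗ[ℝ] L2 Ω} {m : ℝ} (hm : 0 < m) (h : LowerLink (blockDiag B D) m) :
    IsBoundedL2ToU B ∧ AdjointIsBoundedL2ToU D := by
  let e : StateSpace Ω →ₗ[ℝ] L2 Ω := embed Ω
  let DA : StateSpace Ω →ₗ[ℝ] L2 Ω := D ∘ₗ (laplace Ω).toLinearEquiv.toLinearMap
  have he : DenseRange e := denseRange_embed
  refine ⟨⟨B.extendOfNorm e, fun u => LinearMap.extendOfNorm_eq he
    ⟨m⁻¹, fun u => (h.norm_graph_le hm u).1⟩ u⟩, ?_⟩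
  have hS : ∀ u, DA.extendOfNorm e (embed Ω u) = D (laplace Ω u) := fun u =>
    LinearMap.extendOfNorm_eq he ⟨m⁻¹, fun u => (h.norm_graph_le hm u).2⟩ u
  refine ⟨invLaplace Ω ∘L ContinuousLinearMap.adjoint (DA.extendOfNorm e), fun f g => ?_⟩
  obtain ⟨u, rfl⟩ := (laplace Ω).surjective f
  rw [← hS, ← ContinuousLinearMap.adjoint_inner_right, ContinuousLinearMap.comp_apply,
    inner_laplace_embed]
  congr 1
  exact ((laplace Ω).apply_symm_apply _).symm

/-- Moving `𝒜` onto `D*` gives `‖D𝒜u‖ ≤ ‖D*‖ ‖u‖_{L²}`. Then `Dθ = D𝒜u - D(𝒜u - θ)` splits into a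
part controlled by the second component of `𝒢` and a part controlled by the first. -/
theorem exists_lowerLink {B : StateSpace Ω →ₗ[ℝ] StateSpace Ω} {D : L2 Ω →ₗ[ℝ] L2 Ω}
    (hB : IsBoundedL2ToU B) (hD : AdjointIsBoundedL2ToU D) (hDb : ∃ c : ℝ, ∀ f, ‖D f‖ ≤ c * ‖f‖) :
    ∃ m, 0 < m ∧ LowerLink (blockDiag B D) m := by
  obtain ⟨B', hB⟩ := hB
  obtain ⟨D', hD⟩ := hD
  obtain ⟨c, hc⟩ := hDb
  have h1 : ∀ u, ‖D (laplace Ω u)‖ ≤ ‖D'‖ * ‖embed Ω u‖ := fun u => by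
    have h2 : ‖D (laplace Ω u)‖ * ‖D (laplace Ω u)‖
        ≤ (‖D'‖ * ‖embed Ω u‖) * ‖D (laplace Ω u)‖ := by
      rw [← sq, ← real_inner_self_eq_norm_sq, hD, inner_laplace_embed]
      refine (real_inner_le_norm _ _).trans ?_
      rw [(laplace Ω).norm_map, mul_comm ‖D'‖, mul_assoc]
      gcongr
      exact D'.le_opNorm _
    rcases (norm_nonneg (D (laplace Ω u))).eq_or_lt with h0 | h0
    · rw [← h0]; positivity
    · exact le_of_mul_le_mul_right h2 h0
  refine ⟨(‖B'‖ + ‖D'‖ + |c| + 1)⁻¹, by positivity, fun x => ?_⟩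
  rw [inv_mul_le_iff₀ (by positivity)]
  have h2 := norm_embed_le x
  have h3 := norm_laplace_sub_le x
  have h4 : ‖B x.fst‖ ≤ ‖B'‖ * ‖forwardOp Ω x‖ := by
    rw [← hB]
    exact (B'.le_opNorm _).trans (by gcongr)
  have h5 : ‖D x.snd‖ ≤ ‖D'‖ * ‖forwardOp Ω x‖ + |c| * ‖forwardOp Ω x‖ := by
    have e : D x.snd = D (laplace Ω x.fst) - D (laplace Ω x.fst - x.snd) := by
      rw [map_sub]; abel
    rw [e]
    refine (norm_sub_le _ _).trans (add_le_add ((h1 _).trans (by gcongr)) ((hc _).trans ?_))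
    have := le_abs_self c
    gcongr
  have h6 := norm_blockDiag_le B D x
  nlinarith [norm_nonneg (forwardOp Ω x)]

theorem not_isBoundedBelow_and_isBoundedL2ToU (B : StateSpace Ω →ₗ[ℝ] StateSpace Ω) :
    ¬ (IsBoundedBelow B ∧ IsBoundedL2ToU B) := by
  rintro ⟨⟨c, hc⟩, ⟨B', hB⟩⟩
  refine not_norm_le_embed (Ω := Ω) (|c| * ‖B'‖) fun u => (hc u).trans ?_
  rw [← hB, mul_assoc]
  have := le_abs_self c
  gcongr
  exact B'.le_opNorm _

end BlockLink

/-! ### Powers of the inverse Laplacian -/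

section Powers

variable {d : ℕ} {Ω : Set (Space d)} [hΩ : IsH2RegularDomain Ω]

theorem laplace_invLaplace (f : L2 Ω) : laplace Ω (invLaplace Ω f) = f :=
  (laplace Ω).apply_symm_apply f

theorem isPositive_embed_invLaplace : (embed Ω ∘L invLaplace Ω).IsPositive := by
  rw [ContinuousLinearMap.isPositive_iff]
  refine ⟨fun f g => ?_, fun f => ?_⟩
  · change ⟪embed Ω (invLaplace Ω f), g⟫ = ⟪f, embed Ω (invLaplace Ω g)⟫
    conv_lhs => rw [← laplace_invLaplace g]
    rw [← inner_laplace_embed, laplace_invLaplace]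
  · change 0 ≤ ⟪embed Ω (invLaplace Ω f), f⟫
    have h := inner_laplace_embed_self_nonneg (invLaplace Ω f)
    rwa [laplace_invLaplace, real_inner_comm] at h

theorem inner_invLaplace_embed (u v : StateSpace Ω) :
    ⟪invLaplace Ω (embed Ω u), v⟫ = ⟪embed Ω u, laplace Ω v⟫ := by
  rw [← inner_laplace_laplace, laplace_invLaplace]

theorem isPositive_invLaplace_embed : (invLaplace Ω ∘L embed Ω).IsPositive := by
  rw [ContinuousLinearMap.isPositive_iff]
  refine ⟨fun u v => ?_, fun u => ?_⟩
  · change ⟪invLaplace Ω (embed Ω u), v⟫ = ⟪u, invLaplace Ω (embed Ω v)⟫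
    rw [inner_invLaplace_embed, real_inner_comm _ u, inner_invLaplace_embed, real_inner_comm,
      inner_laplace_embed]
  · change 0 ≤ ⟪invLaplace Ω (embed Ω u), u⟫
    rw [inner_invLaplace_embed, real_inner_comm]
    exact inner_laplace_embed_self_nonneg u

theorem continuousOn_rpow {p : ℝ} (hp : 0 ≤ p) {s : Set ℝ} :
    ContinuousOn (fun t : ℝ => t ^ p) s :=
  (Real.continuous_rpow_const hp).continuousOn

theorem opFun_rpow_eq_mul {E : Type*} [NormedAddCommGroup E] [InnerProductSpace ℝ E]
    [CompleteSpace E] {T : E →L[ℝ] E} (hT : T.IsPositive) {p : ℝ} (hp : 1 ≤ p) :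
    opFun (fun t => t ^ p) T = opFun (fun t => t ^ (p - 1)) T * T := by
  have h := opFun_mul hT (continuousOn_rpow (sub_nonneg.2 hp)) (continuousOn_id' _)
  rw [opFun_id hT] at h
  rw [← h]
  refine opFun_congr fun t ht => ?_
  have := Real.rpow_add_one' (y := p - 1) ht.1 (by linarith)
  rwa [sub_add_cancel] at this

theorem isPositive_opFun_rpow {E : Type*} [NormedAddCommGroup E] [InnerProductSpace ℝ E]
    [CompleteSpace E] {T : E →L[ℝ] E} (hT : T.IsPositive) {p : ℝ} (hp : 0 ≤ p) :
    (opFun (fun t => t ^ p) T).IsPositive :=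
  isPositive_opFun hT (continuousOn_rpow hp) fun _ ht => Real.rpow_nonneg ht.1 p

/-- One factor `𝒜⁻¹` is split off and absorbs the gap between `L²` and `U`; the remaining exponent
`s - 1` is non-negative. -/
theorem isBoundedL2ToU_negPowU {s : ℝ} (hs : 1 ≤ s) :
    IsBoundedL2ToU (negPowU Ω s : StateSpace Ω →ₗ[ℝ] StateSpace Ω) :=
  ⟨opFun (fun t => t ^ (s - 1)) (invLaplace Ω ∘L embed Ω) ∘L invLaplace Ω, fun u => by
    rw [ContinuousLinearMap.coe_coe, negPowU, opFun_rpow_eq_mul isPositive_invLaplace_embed hs]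
    rfl⟩

theorem adjointIsBoundedL2ToU_negPowL2 {p : ℝ} (hp : 1 ≤ p) :
    AdjointIsBoundedL2ToU (negPowL2 Ω p : L2 Ω →ₗ[ℝ] L2 Ω) := by
  have hK := isPositive_embed_invLaplace (Ω := Ω)
  refine ⟨invLaplace Ω ∘L opFun (fun t => t ^ (p - 1)) (embed Ω ∘L invLaplace Ω), fun f g => ?_⟩
  have h1 : opFun (fun t => t ^ p) (embed Ω ∘L invLaplace Ω)
      = (embed Ω ∘L invLaplace Ω) * opFun (fun t => t ^ (p - 1)) (embed Ω ∘L invLaplace Ω) := by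
    have h := opFun_mul_comm hK (continuousOn_rpow (sub_nonneg.2 hp)) (continuousOn_id' _)
    rw [opFun_id hK] at h
    rw [opFun_rpow_eq_mul hK hp, h]
  rw [ContinuousLinearMap.coe_coe, negPowL2,
    inner_opFun hK (continuousOn_rpow (zero_le_one.trans hp)), h1]
  rfl

/-- The bounded block diagonal operator `diag(B, D)`. -/
def blockDiagL (B : StateSpace Ω →L[ℝ] StateSpace Ω) (D : L2 Ω →L[ℝ] L2 Ω) :
    PairSpace Ω →L[ℝ] PairSpace Ω :=
  (WithLp.prodContinuousLinearEquiv 2 ℝ (StateSpace Ω) (L2 Ω)).symm.toContinuousLinearMap ∘L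
    (B ∘L WithLp.fstL 2 ℝ (StateSpace Ω) (L2 Ω)).prod
      (D ∘L WithLp.sndL 2 ℝ (StateSpace Ω) (L2 Ω))

theorem isPositive_blockDiagL {B : StateSpace Ω →L[ℝ] StateSpace Ω} {D : L2 Ω →L[ℝ] L2 Ω}
    (hB : B.IsPositive) (hD : D.IsPositive) : (blockDiagL B D).IsPositive := by
  rw [ContinuousLinearMap.isPositive_iff]
  refine ⟨fun x y => ?_, fun x => ?_⟩
  · rw [WithLp.prod_inner_apply, WithLp.prod_inner_apply]
    change ⟪B x.fst, y.fst⟫ + ⟪D x.snd, y.snd⟫ = ⟪x.fst, B y.fst⟫ + ⟪x.snd, D y.snd⟫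
    rw [hB.inner_left_eq_inner_right, hD.inner_left_eq_inner_right]
  · rw [WithLp.prod_inner_apply]
    exact add_nonneg (hB.inner_nonneg_left x.fst) (hD.inner_nonneg_left x.snd)

theorem opFun_sqrt_sq {E : Type*} [NormedAddCommGroup E] [InnerProductSpace ℝ E]
    [CompleteSpace E] {T : E →L[ℝ] E} (hT : T.IsPositive) :
    opFun Real.sqrt (opFun (fun t => t ^ 2) T) = T := by
  rw [opFun_comp hT (by fun_prop) (fun t _ => sq_nonneg t) continuousOn_sqrt]
  conv_rhs => rw [← opFun_id hT]
  exact opFun_congr fun t ht => Real.sqrt_sq ht.1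

theorem exists_lowerLink_negPow {s p : ℝ} (hs : 1 ≤ s) (hp : 1 ≤ p) :
    ∃ m, 0 < m ∧ m ≤ 1 ∧ LowerLink (blockDiag (negPowU Ω s : StateSpace Ω →ₗ[ℝ] StateSpace Ω)
      (negPowL2 Ω p : L2 Ω →ₗ[ℝ] L2 Ω)) m := by
  obtain ⟨m, hm, h⟩ := exists_lowerLink (isBoundedL2ToU_negPowU (Ω := Ω) hs)
    (adjointIsBoundedL2ToU_negPowL2 hp) ⟨‖negPowL2 Ω p‖, (negPowL2 Ω p).le_opNorm⟩
  refine ⟨min m 1, lt_min hm one_pos, min_le_right _ _, fun x => ?_⟩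
  refine le_trans ?_ (h x)
  gcongr
  exact min_le_left _ _

/-- Take `C₀ = T²` and `ψ = √`, for which `f₀²` is the operator concave square root. -/
theorem exists_opFun_eq_blockDiag {s p : ℝ} (hs : 0 ≤ s) (hp : 0 ≤ p) :
    ∃ (C₀ : PairSpace Ω →L[ℝ] PairSpace Ω) (ψ : ℝ → ℝ),
      C₀.IsPositive ∧ IsIndexFunction ψ ∧ IsOperatorConcave (PairSpace Ω) (f0Sq ψ) ∧
      (opFun ψ C₀ : PairSpace Ω →ₗ[ℝ] PairSpace Ω) =
        blockDiag (negPowU Ω s : StateSpace Ω →ₗ[ℝ] StateSpace Ω)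
          (negPowL2 Ω p : L2 Ω →ₗ[ℝ] L2 Ω) := by
  have hT : (blockDiagL (negPowU Ω s) (negPowL2 Ω p)).IsPositive :=
    isPositive_blockDiagL (isPositive_opFun_rpow isPositive_invLaplace_embed hs)
      (isPositive_opFun_rpow isPositive_embed_invLaplace hp)
  refine ⟨opFun (fun t => t ^ 2) (blockDiagL (negPowU Ω s) (negPowL2 Ω p)), Real.sqrt,
    isPositive_opFun hT (by fun_prop) (fun t _ => sq_nonneg t), isIndexFunction_sqrt,
    isOperatorConcave_f0Sq_sqrt _, ?_⟩
  rw [opFun_sqrt_sq hT]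
  rfl

end Powers

/-! ### Separability of the pair space -/

section Separable

theorem separableSpace_L2 {d : ℕ} (Ω : Set (Space d)) : TopologicalSpace.SeparableSpace (L2 Ω) := by
  have : Fact ((2 : ℝ≥0∞) ≠ ⊤) := ⟨by simp⟩
  infer_instance

theorem separableSpace_pairSpace {d : ℕ} (Ω : Set (Space d)) [IsH2RegularDomain Ω] :
    TopologicalSpace.SeparableSpace (PairSpace Ω) := by
  have h1 := separableSpace_L2 Ω
  have h2 : TopologicalSpace.SeparableSpace (StateSpace Ω) :=
    (laplace Ω).symm.surjective.denseRange.separableSpace (laplace Ω).symm.continuous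
  exact (WithLp.prodContinuousLinearEquiv 2 ℝ (StateSpace Ω) (L2 Ω)).symm.surjective.denseRange
    |>.separableSpace (WithLp.prodContinuousLinearEquiv 2 ℝ (StateSpace Ω) (L2 Ω)).symm.continuous

end Separable

end

end BlockPrior

open BlockPrior in
theorem mainTheorem6 {d : ℕ} (Ω : Set (Space d)) [IsH2RegularDomain Ω] :
    -- the upper link bound, for arbitrary linear blocks
    (∀ (B : StateSpace Ω →ₗ[ℝ] StateSpace Ω) (D : L2 Ω →ₗ[ℝ] L2 Ω),
      (∃ M, 0 < M ∧ UpperLink (blockDiag B D) M) ↔ IsBoundedBelow B ∧ IsBoundedBelow D) ∧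
    -- the upper link bound, for self-adjoint blocks, which the blocks of `ψ(C₀)` are
    (∀ (B : StateSpace Ω →ₗ[ℝ] StateSpace Ω) (D : L2 Ω →ₗ[ℝ] L2 Ω),
      B.IsSymmetric → D.IsSymmetric →
      ((∃ M, 0 < M ∧ UpperLink (blockDiag B D) M) ↔ HasBoundedInverse B ∧ HasBoundedInverse D)) ∧
    -- the lower link bound: necessary conditions
    (∀ (B : StateSpace Ω →ₗ[ℝ] StateSpace Ω) (D : L2 Ω →ₗ[ℝ] L2 Ω),
      (∃ m, 0 < m ∧ LowerLink (blockDiag B D) m) →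
        IsBoundedL2ToU B ∧ AdjointIsBoundedL2ToU D) ∧
    -- the lower link bound: sufficient conditions
    (∀ (B : StateSpace Ω →ₗ[ℝ] StateSpace Ω) (D : L2 Ω →ₗ[ℝ] L2 Ω),
      IsBoundedL2ToU B → AdjointIsBoundedL2ToU D → (∃ c : ℝ, ∀ f, ‖D f‖ ≤ c * ‖f‖) →
        ∃ m, 0 < m ∧ LowerLink (blockDiag B D) m) ∧
    -- the two sets of conditions, and the two link bounds, exclude each other
    (∀ B : StateSpace Ω →ₗ[ℝ] StateSpace Ω, ¬ (IsBoundedBelow B ∧ IsBoundedL2ToU B)) ∧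
    (∀ (B : StateSpace Ω →ₗ[ℝ] StateSpace Ω) (D : L2 Ω →ₗ[ℝ] L2 Ω),
      ¬ ((∃ m, 0 < m ∧ LowerLink (blockDiag B D) m) ∧
        ∃ M, 0 < M ∧ UpperLink (blockDiag B D) M)) ∧
    -- the lower link bound alone yields the one-sided contraction bound
    (∀ (C₀ : PairSpace Ω →L[ℝ] PairSpace Ω) (ψ : ℝ → ℝ) (m : ℝ),
      C₀.IsPositive → IsIndexFunction ψ → IsOperatorConcave (PairSpace Ω) (f0Sq ψ) →
      0 < m → m ≤ 1 → LowerLink (opFun ψ C₀ : PairSpace Ω →ₗ[ℝ] PairSpace Ω) m →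
        OneSidedContraction.{w} (forwardOp Ω) C₀ ψ m) ∧
    -- the example `ψ(C₀) = diag(𝒜^{-s}, 𝒜^{-p})`
    (∀ s p : ℝ, 1 ≤ s → 1 ≤ p →
      ∃ m, 0 < m ∧ m ≤ 1 ∧
        LowerLink (blockDiag (negPowU Ω s : StateSpace Ω →ₗ[ℝ] StateSpace Ω)
          (negPowL2 Ω p : L2 Ω →ₗ[ℝ] L2 Ω)) m ∧
        (∃ (C₀ : PairSpace Ω →L[ℝ] PairSpace Ω) (ψ : ℝ → ℝ),
          C₀.IsPositive ∧ IsIndexFunction ψ ∧ IsOperatorConcave (PairSpace Ω) (f0Sq ψ) ∧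
          (opFun ψ C₀ : PairSpace Ω →ₗ[ℝ] PairSpace Ω) =
            blockDiag (negPowU Ω s : StateSpace Ω →ₗ[ℝ] StateSpace Ω)
              (negPowL2 Ω p : L2 Ω →ₗ[ℝ] L2 Ω)) ∧
        ∀ (C₀ : PairSpace Ω →L[ℝ] PairSpace Ω) (ψ : ℝ → ℝ),
          C₀.IsPositive → IsIndexFunction ψ → IsOperatorConcave (PairSpace Ω) (f0Sq ψ) →
          (opFun ψ C₀ : PairSpace Ω →ₗ[ℝ] PairSpace Ω) =
            blockDiag (negPowU Ω s : StateSpace Ω →ₗ[ℝ] StateSpace Ω)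
              (negPowL2 Ω p : L2 Ω →ₗ[ℝ] L2 Ω) →
          OneSidedContraction.{w} (forwardOp Ω) C₀ ψ m) := by
  refine ⟨upperLink_iff, fun B D hB hD => ?_, ?_, fun B D => exists_lowerLink,
    not_isBoundedBelow_and_isBoundedL2ToU, ?_, ?_, fun s p hs hp => ?_⟩
  · rw [upperLink_iff]
    exact ⟨fun h => ⟨h.1.hasBoundedInverse hB, h.2.hasBoundedInverse hD⟩,
      fun h => ⟨h.1.2, h.2.2⟩⟩
  · rintro B D ⟨m, hm, h⟩
    exact isBoundedL2ToU_and_adjoint_of_lowerLink hm h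
  · rintro B D ⟨⟨m, hm, h⟩, hub⟩
    exact not_isBoundedBelow_and_isBoundedL2ToU B
      ⟨((upperLink_iff B D).1 hub).1, (isBoundedL2ToU_and_adjoint_of_lowerLink hm h).1⟩
  · intro C₀ ψ m hC hψ hconc hm hm1 hlink
    have := separableSpace_pairSpace Ω
    exact oneSidedContraction_of_link (forwardOp Ω) hC hψ hconc hm hm1 hlink
  · obtain ⟨m, hm, hm1, h⟩ := exists_lowerLink_negPow (Ω := Ω) hs hp
    refine ⟨m, hm, hm1, h, exists_opFun_eq_blockDiag (zero_le_one.trans hs) (zero_le_one.trans hp),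
      fun C₀ ψ hC hψ hconc he => ?_⟩
    have := separableSpace_pairSpace Ω
    -- The constant `m` was obtained from `T` alone, so it serves every `C₀` and `ψ` with `ψ(C₀) =
    -- T`.
    rw [← he] at h
    exact oneSidedContraction_of_link (forwardOp Ω) hC hψ hconc hm hm1 h
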